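/- Let $\Bbbk$ be an algebraically closed field of characteristic $0$, let $n\geq 2$, $q\in\Bbbk^\times$, and let $\zeta\in\Bbbk$ be a primitive $(n+1)$-th root of unity. Let $A_q=\Bbbk\langle u,v\rangle/(vu-quv)$, let $G$ be the cyclic group of order $n+1$ whose generator acts on $A_q$ by $u\mapsto\zeta u$, $v\mapsto\zeta^{-1}v$, and let $B=B_q=A_q^G$. Let $\Lambda=\Lambda_q$ be the path algebra (paths composed from left to right) of the quiver with vertices $i\in\mathbb Z/(n+1)$ and arrows $\alpha_i:i\to i+1$, $\overline\alpha_i:i+1\to i$, modulo the relations $\overline\alpha_i\alpha_i=q\,\alpha_{i+1}\overline\alpha_{i+1}$ for all $i$, and let $e_0$ be the idempotent of the vertex $0$. The homomorphism $A_q\to\Lambda$, $u\mapsto\sum_i\alpha_i$, $v\mapsto\sum_i\overline\alpha_i$, identifies $B$ with $e_0\Lambda e_0$ via $b\mapsto e_0b$, and makes $e_0\Lambda$ a $(B,\Lambda)$-bimodule and $\Lambda e_0$ a $(\Lambda,B)$-bimodule. Modules are right modules; for a ring $R$, $D(R)$ is the derived category of $R$-modules, $\mathrm{Perf}(R)$ its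 full subcategory of complexes isomorphic to a bounded complex of finitely generated projectives, and $\mathscr D(R)$ its full subcategory of complexes with bounded cohomology and noetherian cohomology modules (which is $D^b(\mathrm{mod}\,R)$ if $R$ is noetherian). Then: 1. $\Lambda$ is homologically smooth: as a $\Lambda$-bimodule it has a finite projective resolution with finitely generated terms. 2. The functors $\psi_*=\mathrm{Hom}_\Lambda(e_0\Lambda,-)$ and $\psi_!=-\otimes_\Lambda\Lambda e_0$ from $\Lambda$-modules to $B$-modules are naturally isomorphic. 3. The functor $-\otimes_Be_0\Lambda$ has a left derived functor $\psi^*:\mathrm{Perf}(B)\to D(\Lambda)$. This functor and the functor $\psi_*:D(\Lambda)\to D(B)$ induced by the exact functor $\mathrm{Hom}_\Lambda(e_0\Lambda,-)$ are triangulated. For $P\in\mathrm{Perf}(B)$ and $F\in D(\Lambda)$ there are bijections, natural in $P$ and $F$, $$\mathrm{Hom}_{D(\Lambda)}(\psi^*P,F)\cong\mathrm{Hom}_{D(B)}(P,\psi_*F),\qquad \mathrm{Hom}_{D(B)}(\psi_*F,P)\cong\mathrm{Hom}_{D(\Lambda)}(F,\psi^*P),$$ and the unit $P\to\psi_*\psi^*P$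 of the first one is an isomorphism. 4. Moreover $\mathrm{Perf}(B)\subseteq\mathscr D(B)$, $\psi^*$ takes values in $\mathscr D(\Lambda)$, $\psi_*$ maps $\mathscr D(\Lambda)$ to $\mathscr D(B)$, and the resulting functors $\psi^*:\mathrm{Perf}(B)\to\mathscr D(\Lambda)$ and $\psi_*:\mathscr D(\Lambda)\to\mathscr D(B)$ have the same properties. In other words, $\psi^*$ and $\psi_*$ define a weakly crepant categorical resolution of $\mathscr D(B)$. -/

import Mathlib

open CategoryTheory CategoryTheory.Limits MulOpposite TensorProduct

open scoped ZeroObject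

universe w₁ w₂ u

namespace QuantumKleinian

noncomputable section

/-! ### The quantum plane and its invariant ring -/

section Algebras

variable {k : Type u} [Field k]

/-- The relation `v u = q u v` of the quantum plane, with `u = ι 0` and `v = ι 1`. -/
inductive PlaneRel (q : k) : FreeAlgebra k (Fin 2) → FreeAlgebra k (Fin 2) → Prop
  | comm : PlaneRel q (FreeAlgebra.ι k 1 * FreeAlgebra.ι k 0)
      (q • (FreeAlgebra.ι k 0 * FreeAlgebra.ι k 1))

/-- The quantum plane `A_q = k⟨u, v⟩ / (v u - q u v)`. -/
def QuantumPlane (q : k) : Type u := RingQuot (PlaneRel q)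

instance (q : k) : Ring (QuantumPlane q) := inferInstanceAs (Ring (RingQuot (PlaneRel q)))

instance (q : k) : Algebra k (QuantumPlane q) :=
  inferInstanceAs (Algebra k (RingQuot (PlaneRel q)))

/-- The quotient map from the free algebra to the quantum plane. -/
def QuantumPlane.mk (q : k) : FreeAlgebra k (Fin 2) →ₐ[k] QuantumPlane q :=
  RingQuot.mkAlgHom k (PlaneRel q)

/-- The generator `u` of the quantum plane. -/
def QuantumPlane.u (q : k) : QuantumPlane q :=
  QuantumPlane.mk q (FreeAlgebra.ι k 0)

/-- The generator `v` of the quantum plane. -/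
def QuantumPlane.v (q : k) : QuantumPlane q :=
  QuantumPlane.mk q (FreeAlgebra.ι k 1)

/-- The universal property of the quantum plane. -/
def QuantumPlane.lift {q : k} {R : Type u} [Ring R] [Algebra k R] (x y : R)
    (h : y * x = q • (x * y)) : QuantumPlane q →ₐ[k] R :=
  RingQuot.liftAlgHom k ⟨FreeAlgebra.lift k ![x, y], by
    rintro _ _ ⟨⟩
    simpa using h⟩

@[simp]
theorem QuantumPlane.lift_u {q : k} {R : Type u} [Ring R] [Algebra k R] (x y : R)
    (h : y * x = q • (x * y)) : QuantumPlane.lift x y h (QuantumPlane.u q) = x := by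
  exact (RingQuot.liftAlgHom_mkAlgHom_apply k _ _ _).trans (by simp)

@[simp]
theorem QuantumPlane.lift_v {q : k} {R : Type u} [Ring R] [Algebra k R] (x y : R)
    (h : y * x = q • (x * y)) : QuantumPlane.lift x y h (QuantumPlane.v q) = y := by
  exact (RingQuot.liftAlgHom_mkAlgHom_apply k _ _ _).trans (by simp)

theorem QuantumPlane.v_mul_u (q : k) :
    QuantumPlane.v q * QuantumPlane.u q = q • (QuantumPlane.u q * QuantumPlane.v q) := by
  have : QuantumPlane.mk q _ = QuantumPlane.mk q _ :=
    RingQuot.mkAlgHom_rel k (PlaneRel.comm (q := q))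
  simpa [QuantumPlane.u, QuantumPlane.v] using this

theorem QuantumPlane.induction {q : k} {p : QuantumPlane q → Prop}
    (halg : ∀ c : k, p (algebraMap k _ c)) (hu : p (QuantumPlane.u q))
    (hv : p (QuantumPlane.v q)) (hadd : ∀ a b, p a → p b → p (a + b))
    (hmul : ∀ a b, p a → p b → p (a * b)) (a : QuantumPlane q) : p a := by
  obtain ⟨a, rfl⟩ : ∃ x, QuantumPlane.mk q x = a := RingQuot.mkAlgHom_surjective k (PlaneRel q) a
  induction a using FreeAlgebra.induction with
  | grade0 c => simpa using halg c
  | grade1 i =>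
    fin_cases i
    · exact hu
    · exact hv
  | mul a b ha hb => simpa using hmul _ _ ha hb
  | add a b ha hb => simpa using hadd _ _ ha hb

/-- The action on the quantum plane of the generator `g = diag(ζ, ζ⁻¹)` of the cyclic group `G`:
`g • u = ζ u` and `g • v = ζ⁻¹ v`. -/
def generatorAction (q ζ : k) : QuantumPlane q →ₐ[k] QuantumPlane q :=
  QuantumPlane.lift (ζ • QuantumPlane.u q) (ζ⁻¹ • QuantumPlane.v q) (by
    simp only [smul_mul_smul_comm, QuantumPlane.v_mul_u, smul_smul]
    congr 1
    ring)

/-- The invariant ring `B_q = A_q^G`: since `G` is generated by `g`, it consists of the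
elements of `A_q` that are fixed by `g`. -/
def invariantSubalgebra (q ζ : k) : Subalgebra k (QuantumPlane q) :=
  AlgHom.equalizer (generatorAction q ζ) (AlgHom.id k _)

/-- The quantum Kleinian singularity `B_q`, as a ring. -/
abbrev B (q ζ : k) : Type u := invariantSubalgebra q ζ

/-! ### The quiver algebra `Λ_q` -/

/-- Vertices and arrows of the cyclic double quiver with vertex set `ℤ/(n+1)`:
`arrow i : i → i + 1` is `α_i`, and `coarrow i : i + 1 → i` is `\bar α_i`. -/
inductive QuiverGen (n : ℕ) : Type
  | vertex (i : ZMod (n + 1))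
  | arrow (i : ZMod (n + 1))
  | coarrow (i : ZMod (n + 1))

open QuiverGen FreeAlgebra in
/-- The defining relations of `Λ_q`. All but the last present the path algebra (paths are
composed from left to right); the last is `\bar α_i α_i = q α_{i+1} \bar α_{i+1}`. -/
inductive QuiverRel (n : ℕ) (q : k) :
    FreeAlgebra k (QuiverGen n) → FreeAlgebra k (QuiverGen n) → Prop
  | vertex_mul_self (i : ZMod (n + 1)) :
      QuiverRel n q (ι k (vertex i) * ι k (vertex i)) (ι k (vertex i))
  | vertex_mul_vertex (i j : ZMod (n + 1)) (hij : i ≠ j) :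
      QuiverRel n q (ι k (vertex i) * ι k (vertex j)) 0
  | sum_vertex : QuiverRel n q (∑ i, ι k (vertex i)) 1
  | vertex_mul_arrow (i : ZMod (n + 1)) :
      QuiverRel n q (ι k (vertex i) * ι k (arrow i)) (ι k (arrow i))
  | arrow_mul_vertex (i : ZMod (n + 1)) :
      QuiverRel n q (ι k (arrow i) * ι k (vertex (i + 1))) (ι k (arrow i))
  | vertex_mul_coarrow (i : ZMod (n + 1)) :
      QuiverRel n q (ι k (vertex (i + 1)) * ι k (coarrow i)) (ι k (coarrow i))
  | coarrow_mul_vertex (i : ZMod (n + 1)) :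
      QuiverRel n q (ι k (coarrow i) * ι k (vertex i)) (ι k (coarrow i))
  | preprojective (i : ZMod (n + 1)) :
      QuiverRel n q (ι k (coarrow i) * ι k (arrow i))
        (q • (ι k (arrow (i + 1)) * ι k (coarrow (i + 1))))

/-- The algebra `Λ_q`: the path algebra of the quiver modulo the relations
`\bar α_i α_i = q α_{i+1} \bar α_{i+1}`. -/
def Lambda (n : ℕ) (q : k) : Type u := RingQuot (QuiverRel n q)

instance (n : ℕ) (q : k) : Ring (Lambda n q) := inferInstanceAs (Ring (RingQuot (QuiverRel n q)))

instance (n : ℕ) (q : k) : Algebra k (Lambda n q) :=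
  inferInstanceAs (Algebra k (RingQuot (QuiverRel n q)))

/-- The quotient map from the free algebra to `Λ_q`. -/
def Lambda.mk (n : ℕ) (q : k) : FreeAlgebra k (QuiverGen n) →ₐ[k] Lambda n q :=
  RingQuot.mkAlgHom k (QuiverRel n q)

theorem Lambda.mk_rel {n : ℕ} {q : k} {x y : FreeAlgebra k (QuiverGen n)}
    (h : QuiverRel n q x y) : Lambda.mk n q x = Lambda.mk n q y :=
  RingQuot.mkAlgHom_rel k h

namespace Lambda

variable (n : ℕ) (q : k)

/-- The idempotent `e_i` of `Λ_q`. -/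
def e (i : ZMod (n + 1)) : Lambda n q :=
  Lambda.mk n q (FreeAlgebra.ι k (.vertex i))

/-- The arrow `α_i : i → i + 1`. -/
def α (i : ZMod (n + 1)) : Lambda n q :=
  Lambda.mk n q (FreeAlgebra.ι k (.arrow i))

/-- The arrow `\bar α_i : i + 1 → i`. -/
def αbar (i : ZMod (n + 1)) : Lambda n q :=
  Lambda.mk n q (FreeAlgebra.ι k (.coarrow i))

theorem e_mul_self (i : ZMod (n + 1)) : e n q i * e n q i = e n q i := by
  simpa [e] using Lambda.mk_rel (QuiverRel.vertex_mul_self (q := q) i)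

theorem e_mul_e {i j : ZMod (n + 1)} (h : i ≠ j) : e n q i * e n q j = 0 := by
  simpa [e] using Lambda.mk_rel (QuiverRel.vertex_mul_vertex (q := q) i j h)

theorem sum_e : ∑ i, e n q i = 1 := by
  simpa [e] using Lambda.mk_rel (QuiverRel.sum_vertex (n := n) (q := q))

theorem e_mul_α (i : ZMod (n + 1)) : e n q i * α n q i = α n q i := by
  simpa [e, α] using Lambda.mk_rel (QuiverRel.vertex_mul_arrow (q := q) i)

theorem α_mul_e (i : ZMod (n + 1)) : α n q i * e n q (i + 1) = α n q i := by
  simpa [e, α] using Lambda.mk_rel (QuiverRel.arrow_mul_vertex (q := q) i)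

theorem e_mul_αbar (i : ZMod (n + 1)) : e n q (i + 1) * αbar n q i = αbar n q i := by
  simpa [e, αbar] using Lambda.mk_rel (QuiverRel.vertex_mul_coarrow (q := q) i)

theorem αbar_mul_e (i : ZMod (n + 1)) : αbar n q i * e n q i = αbar n q i := by
  simpa [e, αbar] using Lambda.mk_rel (QuiverRel.coarrow_mul_vertex (q := q) i)

theorem αbar_mul_α (i : ZMod (n + 1)) :
    αbar n q i * α n q i = q • (α n q (i + 1) * αbar n q (i + 1)) := by
  simpa [α, αbar] using Lambda.mk_rel (QuiverRel.preprojective (q := q) i)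

theorem α_mul_αbar_of_ne {i j : ZMod (n + 1)} (h : i ≠ j) : α n q i * αbar n q j = 0 := by
  rw [← α_mul_e, ← e_mul_αbar, mul_assoc, ← mul_assoc (e n q (i + 1)),
    e_mul_e n q (fun h' => h (add_right_cancel h')), zero_mul, mul_zero]

theorem αbar_mul_α_of_ne {i j : ZMod (n + 1)} (h : i ≠ j) : αbar n q i * α n q j = 0 := by
  rw [← αbar_mul_e, ← e_mul_α, mul_assoc, ← mul_assoc (e n q i), e_mul_e n q h,
    zero_mul, mul_zero]

/-- The algebra homomorphism `A_q → Λ_q` with `u ↦ ∑ α_i` and `v ↦ ∑ \bar α_i`. -/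
def ofPlane : QuantumPlane q →ₐ[k] Lambda n q :=
  QuantumPlane.lift (∑ i, α n q i) (∑ i, αbar n q i) (by
    have h₁ : (∑ i, αbar n q i) * (∑ i, α n q i) = ∑ i, αbar n q i * α n q i := by
      rw [Finset.sum_mul_sum]
      refine Finset.sum_congr rfl fun i _ => ?_
      exact Finset.sum_eq_single i (fun j _ hj => αbar_mul_α_of_ne n q hj.symm) (by simp)
    have h₂ : (∑ i, α n q i) * (∑ i, αbar n q i) = ∑ i, α n q i * αbar n q i := by
      rw [Finset.sum_mul_sum]
      refine Finset.sum_congr rfl fun i _ => ?_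
      exact Finset.sum_eq_single i (fun j _ hj => α_mul_αbar_of_ne n q hj.symm) (by simp)
    rw [h₁, h₂, ← Equiv.sum_comp (Equiv.addRight (1 : ZMod (n + 1)))
      (fun i => α n q i * αbar n q i), Finset.smul_sum]
    exact Finset.sum_congr rfl fun i _ => αbar_mul_α n q i)

variable {n q} {ζ : k}

/-- Scalar by which the generator of the cyclic group acts at the vertex `i`. -/
def weight (ζ : k) (i : ZMod (n + 1)) : k := (ζ ^ i.val)⁻¹

theorem weight_injective (hζ : IsPrimitiveRoot ζ (n + 1)) :
    Function.Injective (weight (n := n) ζ) := by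
  intro i j h
  have := hζ.pow_inj (ZMod.val_lt i) (ZMod.val_lt j) (inv_injective h)
  exact ZMod.val_injective _ this

theorem weight_add_one (hζ : IsPrimitiveRoot ζ (n + 1)) (i : ZMod (n + 1)) :
    weight ζ i = ζ * weight ζ (i + 1) := by
  have hζ0 : ζ ≠ 0 := hζ.ne_zero (Nat.succ_ne_zero n)
  have h : ζ ^ (i + 1).val = ζ ^ (i.val + 1) := by
    rw [ZMod.val_add, ← pow_mod_orderOf, ← hζ.eq_orderOf, Nat.mod_mod]
    conv_rhs => rw [← pow_mod_orderOf, ← hζ.eq_orderOf]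
    rcases n with _ | n
    · simp [Nat.mod_one]
    · rw [ZMod.val_one'' (by lia)]
  rw [weight, weight, h, pow_succ]
  field_simp

/-- The element of `Λ_q` that corresponds to the generator of the cyclic group. -/
def groupElement (n : ℕ) (q ζ : k) : Lambda n q := ∑ i, weight ζ i • e n q i

theorem groupElement_mul (hζ : IsPrimitiveRoot ζ (n + 1)) (a : QuantumPlane q) :
    groupElement n q ζ * ofPlane n q a =
      ofPlane n q (generatorAction q ζ a) * groupElement n q ζ := by
  have hζ0 : ζ ≠ 0 := hζ.ne_zero (Nat.succ_ne_zero n)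
  induction a using QuantumPlane.induction with
  | halg c => simp [Algebra.commutes]
  | hu =>
    have h₁ : ∀ i, groupElement n q ζ * α n q i = weight ζ i • α n q i := fun i => by
      rw [groupElement, Finset.sum_mul, Finset.sum_eq_single i, smul_mul_assoc, e_mul_α]
      · intro j _ hj
        rw [smul_mul_assoc, ← e_mul_α, ← mul_assoc, e_mul_e n q hj, zero_mul, smul_zero]
      · simp
    have h₂ : ∀ i, α n q i * groupElement n q ζ = weight ζ (i + 1) • α n q i := fun i => by
      rw [groupElement, Finset.mul_sum, Finset.sum_eq_single (i + 1), mul_smul_comm, α_mul_e]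
      · intro j _ hj
        rw [mul_smul_comm, ← α_mul_e, mul_assoc, e_mul_e n q hj.symm, mul_zero, smul_zero]
      · simp
    simp only [generatorAction, ofPlane, QuantumPlane.lift_u, map_smul, smul_mul_assoc,
      Finset.mul_sum, Finset.sum_mul, h₁, h₂, Finset.smul_sum, smul_smul, ← weight_add_one hζ]
  | hv =>
    have h₁ : ∀ i, groupElement n q ζ * αbar n q i = weight ζ (i + 1) • αbar n q i := fun i => by
      rw [groupElement, Finset.sum_mul, Finset.sum_eq_single (i + 1), smul_mul_assoc, e_mul_αbar]
      · intro j _ hj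
        rw [smul_mul_assoc, ← e_mul_αbar, ← mul_assoc, e_mul_e n q hj, zero_mul, smul_zero]
      · simp
    have h₂ : ∀ i, αbar n q i * groupElement n q ζ = weight ζ i • αbar n q i := fun i => by
      rw [groupElement, Finset.mul_sum, Finset.sum_eq_single i, mul_smul_comm, αbar_mul_e]
      · intro j _ hj
        rw [mul_smul_comm, ← αbar_mul_e, mul_assoc, e_mul_e n q hj.symm, mul_zero, smul_zero]
      · simp
    have h₃ : ∀ i : ZMod (n + 1), ζ⁻¹ * weight ζ i = weight ζ (i + 1) := fun i => by
      rw [weight_add_one hζ i, inv_mul_cancel_left₀ hζ0]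
    simp only [generatorAction, ofPlane, QuantumPlane.lift_v, map_smul, smul_mul_assoc,
      Finset.mul_sum, Finset.sum_mul, h₁, h₂, Finset.smul_sum, smul_smul, h₃]
  | hadd a b ha hb => simp [mul_add, add_mul, ha, hb]
  | hmul a b ha hb =>
    simp only [map_mul]
    rw [← mul_assoc, ha, mul_assoc, hb, mul_assoc]

/-- The algebra homomorphism `B_q → Λ_q` obtained by restriction from `A_q`. Its image commutes
with `e_0` (see `e_zero_comm`), and `b ↦ e_0 b` is the identification of `B_q` with
`e_0 Λ_q e_0`. -/
def ofB (n : ℕ) (q ζ : k) : B q ζ →ₐ[k] Lambda n q :=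
  (ofPlane n q).comp (invariantSubalgebra q ζ).val

theorem e_zero_comm (hζ : IsPrimitiveRoot ζ (n + 1)) (b : B q ζ) :
    e n q 0 * ofB n q ζ b = ofB n q ζ b * e n q 0 := by
  have hb : generatorAction q ζ (b : QuantumPlane q) = b := b.2
  have hc : groupElement n q ζ * ofB n q ζ b = ofB n q ζ b * groupElement n q ζ := by
    have := groupElement_mul hζ (b : QuantumPlane q)
    rwa [hb] at this
  have hl : ∀ i, e n q i * groupElement n q ζ = weight ζ i • e n q i := fun i => by
    rw [groupElement, Finset.mul_sum, Finset.sum_eq_single i, mul_smul_comm, e_mul_self]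
    · intro j _ hj
      rw [mul_smul_comm, e_mul_e n q hj.symm, smul_zero]
    · simp
  have hr : ∀ i, groupElement n q ζ * e n q i = weight ζ i • e n q i := fun i => by
    rw [groupElement, Finset.sum_mul, Finset.sum_eq_single i, smul_mul_assoc, e_mul_self]
    · intro j _ hj
      rw [smul_mul_assoc, e_mul_e n q hj, smul_zero]
    · simp
  have hij : ∀ i j, i ≠ j → e n q i * ofB n q ζ b * e n q j = 0 := fun i j h => by
    have h₁ : weight ζ i • (e n q i * ofB n q ζ b * e n q j) =
        weight ζ j • (e n q i * ofB n q ζ b * e n q j) := by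
      rw [← smul_mul_assoc, ← smul_mul_assoc, ← hl, mul_assoc (e n q i), hc, ← mul_assoc,
        mul_assoc, hr, mul_smul_comm]
    rw [← sub_eq_zero, ← sub_smul, smul_eq_zero, sub_eq_zero] at h₁
    exact h₁.resolve_left fun h' => h (weight_injective hζ h')
  calc e n q 0 * ofB n q ζ b = e n q 0 * ofB n q ζ b * ∑ j, e n q j := by rw [sum_e, mul_one]
    _ = e n q 0 * ofB n q ζ b * e n q 0 := by
      rw [Finset.mul_sum]
      exact Finset.sum_eq_single 0 (fun j _ hj => hij 0 j hj.symm) (by simp)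
    _ = (∑ j, e n q j) * (ofB n q ζ b * e n q 0) := by
      rw [Finset.sum_mul, Finset.sum_eq_single 0, mul_assoc]
      · intro j _ hj
        rw [← mul_assoc, hij j 0 hj]
      · simp
    _ = ofB n q ζ b * e n q 0 := by rw [sum_e, one_mul]

end Lambda

/-! ### The bimodules `e_0 Λ` and `Λ e_0` -/

section Corner

variable {n : ℕ} {ζ : k}

/-- The right `Λ_q`-module `e_0 Λ_q`. -/
def rowSubmodule (n : ℕ) (q : k) : Submodule (Lambda n q)ᵐᵒᵖ (Lambda n q) where
  carrier := {x | Lambda.e n q 0 * x = x}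
  zero_mem' := by simp
  add_mem' {x y} hx hy := by
    change _ * (_ + _) = _
    rw [mul_add]
    exact congrArg₂ (· + ·) hx hy
  smul_mem' c x hx := by
    change _ * (x * c.unop) = x * c.unop
    rw [← mul_assoc]
    exact congrArg (· * c.unop) hx

/-- The left `Λ_q`-module `Λ_q e_0`. -/
def columnSubmodule (n : ℕ) (q : k) : Submodule (Lambda n q) (Lambda n q) where
  carrier := {x | x * Lambda.e n q 0 = x}
  zero_mem' := by simp
  add_mem' {x y} hx hy := by
    change (_ + _) * _ = _
    rw [add_mul]
    exact congrArg₂ (· + ·) hx hy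
  smul_mem' c x hx := by
    change c * x * _ = c * x
    rw [mul_assoc]
    exact congrArg (c * ·) hx

/-- The `(B_q, Λ_q)`-bimodule `e_0 Λ_q`. -/
def E0Lambda (q : k) (_ : IsPrimitiveRoot ζ (n + 1)) : Type u := rowSubmodule n q

/-- The `(Λ_q, B_q)`-bimodule `Λ_q e_0`. -/
def LambdaE0 (q : k) (_ : IsPrimitiveRoot ζ (n + 1)) : Type u := columnSubmodule n q

variable (q : k) (hζ : IsPrimitiveRoot ζ (n + 1))

instance : AddCommGroup (E0Lambda q hζ) := inferInstanceAs (AddCommGroup (rowSubmodule n q))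

instance : Module (Lambda n q)ᵐᵒᵖ (E0Lambda q hζ) :=
  inferInstanceAs (Module (Lambda n q)ᵐᵒᵖ (rowSubmodule n q))

/-- `B_q` acts on `e_0 Λ_q` by left multiplication through `B_q → Λ_q`. -/
instance : Module (B q ζ) (E0Lambda q hζ) where
  smul b x := ⟨Lambda.ofB n q ζ b * x.1, by
    change Lambda.e n q 0 * (Lambda.ofB n q ζ b * x.1) = Lambda.ofB n q ζ b * x.1
    rw [← mul_assoc, Lambda.e_zero_comm hζ, mul_assoc]
    exact congrArg _ x.2⟩
  one_smul x := Subtype.ext (by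
    change Lambda.ofB n q ζ 1 * x.1 = x.1
    rw [map_one, one_mul])
  mul_smul b c x := Subtype.ext (by
    change Lambda.ofB n q ζ (b * c) * x.1 = Lambda.ofB n q ζ b * (Lambda.ofB n q ζ c * x.1)
    rw [map_mul, mul_assoc])
  smul_zero b := Subtype.ext (mul_zero (Lambda.ofB n q ζ b))
  smul_add b x y := Subtype.ext (mul_add (Lambda.ofB n q ζ b) x.1 y.1)
  add_smul b c x := Subtype.ext (by
    change Lambda.ofB n q ζ (b + c) * x.1 = Lambda.ofB n q ζ b * x.1 + Lambda.ofB n q ζ c * x.1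
    rw [map_add, add_mul])
  zero_smul x := Subtype.ext (by
    change Lambda.ofB n q ζ 0 * x.1 = 0
    rw [map_zero, zero_mul])

instance : SMulCommClass (B q ζ) (Lambda n q)ᵐᵒᵖ (E0Lambda q hζ) where
  smul_comm b s x := Subtype.ext (mul_assoc (Lambda.ofB n q ζ b) x.1 s.unop).symm

instance : AddCommGroup (LambdaE0 q hζ) := inferInstanceAs (AddCommGroup (columnSubmodule n q))

instance : Module (Lambda n q) (LambdaE0 q hζ) :=
  inferInstanceAs (Module (Lambda n q) (columnSubmodule n q))

/-- `B_q` acts on `Λ_q e_0` by right multiplication through `B_q → Λ_q`. -/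
instance : Module (B q ζ)ᵐᵒᵖ (LambdaE0 q hζ) where
  smul b x := ⟨x.1 * Lambda.ofB n q ζ b.unop, by
    change x.1 * Lambda.ofB n q ζ b.unop * Lambda.e n q 0 = x.1 * Lambda.ofB n q ζ b.unop
    rw [mul_assoc, ← Lambda.e_zero_comm hζ, ← mul_assoc]
    exact congrArg (· * _) x.2⟩
  one_smul x := Subtype.ext (by
    change x.1 * Lambda.ofB n q ζ 1 = x.1
    rw [map_one, mul_one])
  mul_smul b c x := Subtype.ext (by
    change x.1 * Lambda.ofB n q ζ (c.unop * b.unop) =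
      x.1 * Lambda.ofB n q ζ c.unop * Lambda.ofB n q ζ b.unop
    rw [map_mul, mul_assoc])
  smul_zero b := Subtype.ext (zero_mul (Lambda.ofB n q ζ b.unop))
  smul_add b x y := Subtype.ext (add_mul x.1 y.1 (Lambda.ofB n q ζ b.unop))
  add_smul b c x := Subtype.ext (by
    change x.1 * Lambda.ofB n q ζ (b.unop + c.unop) =
      x.1 * Lambda.ofB n q ζ b.unop + x.1 * Lambda.ofB n q ζ c.unop
    rw [map_add, mul_add])
  zero_smul x := Subtype.ext (by
    change x.1 * Lambda.ofB n q ζ 0 = 0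
    rw [map_zero, mul_zero])

instance : SMulCommClass (Lambda n q) (B q ζ)ᵐᵒᵖ (LambdaE0 q hζ) where
  smul_comm s b x := Subtype.ext (mul_assoc s x.1 (Lambda.ofB n q ζ b.unop)).symm

/-- `e_0 Λ_q` is a direct summand of `Λ_q` as a right module. -/
instance : Module.Projective (Lambda n q)ᵐᵒᵖ (E0Lambda q hζ) := by
  refine Module.Projective.of_split
    ({ toFun := fun x => op x.1
       map_add' := fun _ _ => rfl
       map_smul' := fun _ _ => rfl } : E0Lambda q hζ →ₗ[(Lambda n q)ᵐᵒᵖ] (Lambda n q)ᵐᵒᵖ)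
    ({ toFun := fun y => ⟨Lambda.e n q 0 * y.unop, by
         change _ * (_ * _) = _
         rw [← mul_assoc, Lambda.e_mul_self]⟩
       map_add' := fun x y => Subtype.ext (mul_add _ _ _)
       map_smul' := fun c y => Subtype.ext (mul_assoc _ _ _).symm } :
      (Lambda n q)ᵐᵒᵖ →ₗ[(Lambda n q)ᵐᵒᵖ] E0Lambda q hζ) ?_
  ext x
  exact Subtype.ext x.2

end Corner

end Algebras

/-! ### Tensor and Hom functors of a bimodule over noncommutative rings

Right `R`-modules are modules over `Rᵐᵒᵖ`. -/

section Bimodule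

variable (R S : Type u) [Ring R] [Ring S]

/-- The relations `(m r) ⊗ x = m ⊗ (r x)`. -/
def balancedRelations (M X : Type u) [AddCommGroup M] [Module Rᵐᵒᵖ M] [AddCommGroup X]
    [Module R X] : AddSubgroup (M ⊗[ℤ] X) :=
  AddSubgroup.closure {t | ∃ (m : M) (r : R) (x : X), t = (op r • m) ⊗ₜ[ℤ] x - m ⊗ₜ[ℤ] (r • x)}

/-- The tensor product `M ⊗_R X` of a right `R`-module `M` and a left `R`-module `X`. -/
def BalancedTensor (M X : Type u) [AddCommGroup M] [Module Rᵐᵒᵖ M] [AddCommGroup X]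
    [Module R X] : Type u :=
  (M ⊗[ℤ] X) ⧸ balancedRelations R M X

variable (X : Type u) [AddCommGroup X] [Module R X] [Module Sᵐᵒᵖ X] [SMulCommClass R Sᵐᵒᵖ X]

section

variable (M M' M'' : Type u) [AddCommGroup M] [Module Rᵐᵒᵖ M] [AddCommGroup M'] [Module Rᵐᵒᵖ M']
  [AddCommGroup M''] [Module Rᵐᵒᵖ M'']

instance : AddCommGroup (BalancedTensor R M X) :=
  inferInstanceAs (AddCommGroup ((M ⊗[ℤ] X) ⧸ balancedRelations R M X))

variable {M X} in
/-- The pure tensor `m ⊗ x` in `M ⊗_R X`. -/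
def BalancedTensor.tmul (m : M) (x : X) : BalancedTensor R M X :=
  (QuotientAddGroup.mk' (balancedRelations R M X)) (m ⊗ₜ[ℤ] x)

variable {M M' X} in
/-- Additive maps out of `M ⊗_R X` agree if they agree on pure tensors. -/
theorem BalancedTensor.addHom_ext {N : Type u} [AddCommGroup N]
    {f g : BalancedTensor R M X →+ N}
    (h : ∀ m x, f (BalancedTensor.tmul R m x) = g (BalancedTensor.tmul R m x)) : f = g := by
  ext t
  obtain ⟨t, rfl⟩ := QuotientAddGroup.mk'_surjective (balancedRelations R M X) t
  induction t with
  | zero => exact (map_zero f).trans (map_zero g).symm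
  | tmul m x => exact h m x
  | add a b ha hb =>
    exact (map_add f _ _).trans ((congrArg₂ (· + ·) ha hb).trans (map_add g _ _).symm)

variable {M M' X} {X' : Type u} [AddCommGroup X'] [Module R X'] in
/-- The map `M ⊗_R X → M' ⊗_R X'` induced by `R`-linear maps `M → M'` and `X → X'`. -/
def BalancedTensor.map (f : M →ₗ[Rᵐᵒᵖ] M') (g : X →ₗ[R] X') :
    BalancedTensor R M X →+ BalancedTensor R M' X' :=
  QuotientAddGroup.map (balancedRelations R M X) (balancedRelations R M' X')
    (TensorProduct.map (f.restrictScalars ℤ) (g.restrictScalars ℤ)).toAddMonoidHom (by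
      refine (AddSubgroup.closure_le _).2 ?_
      rintro _ ⟨m, r, x, rfl⟩
      refine AddSubgroup.subset_closure ⟨f m, r, g x, ?_⟩
      rw [map_sub]
      exact congrArg₂ (fun a b => a ⊗ₜ[ℤ] g x - f m ⊗ₜ[ℤ] b) (f.map_smul (op r) m)
        (g.map_smul r x))

variable {M M' X} {X' : Type u} [AddCommGroup X'] [Module R X'] in
@[simp]
theorem BalancedTensor.map_tmul (f : M →ₗ[Rᵐᵒᵖ] M') (g : X →ₗ[R] X') (m : M) (x : X) :
    BalancedTensor.map R f g (BalancedTensor.tmul R m x) = BalancedTensor.tmul R (f m) (g x) :=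
  rfl

/-- Right multiplication by an element of `S` on the `(R, S)`-bimodule `X`. -/
def rightMulMap (s : Sᵐᵒᵖ) : X →ₗ[R] X where
  toFun x := s • x
  map_add' := smul_add s
  map_smul' r x := (smul_comm r s x).symm

theorem BalancedTensor.tmul_add (m : M) (x y : X) :
    BalancedTensor.tmul R m (x + y) = BalancedTensor.tmul R m x + BalancedTensor.tmul R m y :=
  congrArg (QuotientAddGroup.mk' (balancedRelations R M X)) (TensorProduct.tmul_add m x y)

theorem BalancedTensor.add_tmul (m m' : M) (x : X) :
    BalancedTensor.tmul R (m + m') x = BalancedTensor.tmul R m x + BalancedTensor.tmul R m' x :=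
  congrArg (QuotientAddGroup.mk' (balancedRelations R M X)) (TensorProduct.add_tmul m m' x)

theorem BalancedTensor.tmul_zero (m : M) :
    BalancedTensor.tmul R m (0 : X) = 0 :=
  congrArg (QuotientAddGroup.mk' (balancedRelations R M X)) (TensorProduct.tmul_zero X m)

/-- The right `S`-module structure on `M ⊗_R X`: `(m ⊗ x) s = m ⊗ (x s)`. -/
instance : Module Sᵐᵒᵖ (BalancedTensor R M X) where
  smul s := BalancedTensor.map R LinearMap.id (rightMulMap R S X s)
  one_smul t := DFunLike.congr_fun (BalancedTensor.addHom_ext R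
    (f := BalancedTensor.map R LinearMap.id (rightMulMap R S X 1)) (g := AddMonoidHom.id _)
    fun m x => by simp [rightMulMap]) t
  mul_smul s s' t := DFunLike.congr_fun (BalancedTensor.addHom_ext R
    (f := BalancedTensor.map R LinearMap.id (rightMulMap R S X (s * s')))
    (g := (BalancedTensor.map R LinearMap.id (rightMulMap R S X s)).comp
      (BalancedTensor.map R LinearMap.id (rightMulMap R S X s')))
    fun m x => by simp [rightMulMap, mul_smul]) t
  smul_zero s := map_zero (BalancedTensor.map R LinearMap.id (rightMulMap R S X s))
  smul_add s := map_add (BalancedTensor.map R LinearMap.id (rightMulMap R S X s))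
  add_smul s s' t := DFunLike.congr_fun (BalancedTensor.addHom_ext R
    (f := BalancedTensor.map R LinearMap.id (rightMulMap R S X (s + s')))
    (g := BalancedTensor.map R LinearMap.id (rightMulMap R S X s) +
      BalancedTensor.map R LinearMap.id (rightMulMap R S X s'))
    fun m x => by simp [rightMulMap, add_smul, BalancedTensor.tmul_add]) t
  zero_smul t := DFunLike.congr_fun (BalancedTensor.addHom_ext R
    (f := BalancedTensor.map R LinearMap.id (rightMulMap R S X 0)) (g := 0)
    fun m x => by simp [rightMulMap, BalancedTensor.tmul_zero]) t

variable {M M'} in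
/-- The map `f ⊗ id` as a map of right `S`-modules. -/
def BalancedTensor.mapRight (f : M →ₗ[Rᵐᵒᵖ] M') :
    BalancedTensor R M X →ₗ[Sᵐᵒᵖ] BalancedTensor R M' X where
  toFun := BalancedTensor.map R f LinearMap.id
  map_add' := map_add _
  map_smul' s t := DFunLike.congr_fun (BalancedTensor.addHom_ext R
    (f := (BalancedTensor.map R f LinearMap.id).comp
      (BalancedTensor.map R LinearMap.id (rightMulMap R S X s)))
    (g := (BalancedTensor.map R LinearMap.id (rightMulMap R S X s)).comp
      (BalancedTensor.map R f LinearMap.id))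
    fun m x => by simp) t

end

/-- The functor `- ⊗_R X` from right `R`-modules to right `S`-modules. -/
def tensorFunctor : ModuleCat.{u} Rᵐᵒᵖ ⥤ ModuleCat.{u} Sᵐᵒᵖ where
  obj M := ModuleCat.of Sᵐᵒᵖ (BalancedTensor R M X)
  map f := ModuleCat.ofHom (BalancedTensor.mapRight R S X f.hom)
  map_id M := by
    ext t
    exact DFunLike.congr_fun (BalancedTensor.addHom_ext R
      (f := BalancedTensor.map R (LinearMap.id (R := Rᵐᵒᵖ) (M := M)) (LinearMap.id (M := X)))
      (g := AddMonoidHom.id _) fun m x => by simp) t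
  map_comp {M M' M''} f g := by
    ext t
    exact DFunLike.congr_fun (BalancedTensor.addHom_ext R
      (f := BalancedTensor.map R (g.hom ∘ₗ f.hom) (LinearMap.id (M := X)))
      (g := (BalancedTensor.map R g.hom LinearMap.id).comp
        (BalancedTensor.map R f.hom LinearMap.id)) fun m x => by simp) t

instance : (tensorFunctor R S X).Additive where
  map_add {M M'} f g := by
    ext t
    exact DFunLike.congr_fun (BalancedTensor.addHom_ext R
      (f := BalancedTensor.map R (f.hom + g.hom) (LinearMap.id (M := X)))
      (g := BalancedTensor.map R f.hom LinearMap.id + BalancedTensor.map R g.hom LinearMap.id)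
      fun m x => by simp [BalancedTensor.add_tmul]) t

/-- The abelian group `Hom_S(X, N)` of maps of right `S`-modules. -/
def RightHom (N : Type u) [AddCommGroup N] [Module Sᵐᵒᵖ N] : Type u := X →ₗ[Sᵐᵒᵖ] N

section

variable (N : Type u) [AddCommGroup N] [Module Sᵐᵒᵖ N]

instance : AddCommGroup (RightHom S X N) := inferInstanceAs (AddCommGroup (X →ₗ[Sᵐᵒᵖ] N))

variable {X} in
/-- Left multiplication by an element of `R` on the `(R, S)`-bimodule `X`. -/
def leftMulMap (r : R) : X →ₗ[Sᵐᵒᵖ] X where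
  toFun x := r • x
  map_add' := smul_add r
  map_smul' s x := smul_comm r s x

/-- The right `R`-module structure on `Hom_S(X, N)`: `(f r)(x) = f (r x)`. -/
instance : Module Rᵐᵒᵖ (RightHom S X N) where
  smul r (f : X →ₗ[Sᵐᵒᵖ] N) := f.comp (leftMulMap R S r.unop)
  one_smul (f : X →ₗ[Sᵐᵒᵖ] N) := LinearMap.ext fun x => congrArg f (one_smul R x)
  mul_smul r r' (f : X →ₗ[Sᵐᵒᵖ] N) := LinearMap.ext fun x =>
    congrArg f (mul_smul r'.unop r.unop x)
  smul_zero _ := LinearMap.ext (M := X) (M₃ := N) fun _ => rfl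
  smul_add _ _ _ := LinearMap.ext (M := X) (M₃ := N) fun _ => rfl
  add_smul r r' (f : X →ₗ[Sᵐᵒᵖ] N) := LinearMap.ext fun x =>
    (congrArg f (add_smul r.unop r'.unop x)).trans (map_add f _ _)
  zero_smul (f : X →ₗ[Sᵐᵒᵖ] N) := LinearMap.ext fun x =>
    (congrArg f (zero_smul R x)).trans (map_zero f)

variable {N} {N' : Type u} [AddCommGroup N'] [Module Sᵐᵒᵖ N'] in
/-- Composition with `g : N → N'`, as a map `Hom_S(X, N) → Hom_S(X, N')` of right `R`-modules. -/
def RightHom.postcomp (g : N →ₗ[Sᵐᵒᵖ] N') : RightHom S X N →ₗ[Rᵐᵒᵖ] RightHom S X N' where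
  toFun (f : X →ₗ[Sᵐᵒᵖ] N) := g.comp f
  map_add' (f f' : X →ₗ[Sᵐᵒᵖ] N) := LinearMap.comp_add f f' g
  map_smul' _ _ := rfl

end

/-- The functor `Hom_S(X, -)` from right `S`-modules to right `R`-modules. -/
def homFunctor : ModuleCat.{u} Sᵐᵒᵖ ⥤ ModuleCat.{u} Rᵐᵒᵖ where
  obj N := ModuleCat.of Rᵐᵒᵖ (RightHom S X N)
  map g := ModuleCat.ofHom (RightHom.postcomp R S X g.hom)

instance : (homFunctor R S X).Additive where
  map_add {N N'} f g := by
    ext (h : X →ₗ[Sᵐᵒᵖ] N)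
    exact LinearMap.add_comp h g.hom f.hom

section

variable [Module.Projective Sᵐᵒᵖ X]

theorem homFunctor_map_shortExact (T : ShortComplex (ModuleCat.{u} Sᵐᵒᵖ)) (hT : T.ShortExact) :
    (T.map (homFunctor R S X)).ShortExact := by
  have hinj : Function.Injective T.f.hom := (ModuleCat.mono_iff_injective _).1 hT.mono_f
  have hsurj : Function.Surjective T.g.hom := (ModuleCat.epi_iff_surjective _).1 hT.epi_g
  have hex := (ShortComplex.moduleCat_exact_iff T).1 hT.exact
  refine ShortComplex.ShortExact.mk' ?_ ?_ ?_
  · rw [ShortComplex.moduleCat_exact_iff]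
    intro (f : X →ₗ[Sᵐᵒᵖ] T.X₂) hf
    have hf' : ∀ x, T.g.hom (f x) = 0 := fun x =>
      DFunLike.congr_fun (F := X →ₗ[Sᵐᵒᵖ] T.X₃) hf x
    have hr : ∀ x, f x ∈ LinearMap.range T.f.hom := fun x => hex _ (hf' x)
    refine ⟨((LinearEquiv.ofInjective T.f.hom hinj).symm.toLinearMap.comp
      (f.codRestrict _ hr) : X →ₗ[Sᵐᵒᵖ] T.X₁), ?_⟩
    refine LinearMap.ext (M := X) (M₃ := T.X₂) fun x => ?_
    exact congrArg Subtype.val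
      ((LinearEquiv.ofInjective T.f.hom hinj).apply_symm_apply (f.codRestrict _ hr x))
  · rw [ModuleCat.mono_iff_injective]
    intro f f' h
    exact LinearMap.ext (M := X) (M₃ := T.X₁) fun x =>
      hinj (DFunLike.congr_fun (F := X →ₗ[Sᵐᵒᵖ] T.X₂) h x)
  · rw [ModuleCat.epi_iff_surjective]
    intro f
    exact Module.projective_lifting_property T.g.hom (f : X →ₗ[Sᵐᵒᵖ] T.X₃) hsurj

instance : PreservesFiniteLimits (homFunctor R S X) :=
  have : PreservesFiniteLimits (homFunctor R S X) ∧ PreservesFiniteColimits (homFunctor R S X) :=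
    ((homFunctor R S X).exact_tfae.out 0 3).1 (homFunctor_map_shortExact R S X)
  this.1

instance : PreservesFiniteColimits (homFunctor R S X) :=
  have : PreservesFiniteLimits (homFunctor R S X) ∧ PreservesFiniteColimits (homFunctor R S X) :=
    ((homFunctor R S X).exact_tfae.out 0 3).1 (homFunctor_map_shortExact R S X)
  this.2

end

end Bimodule

/-! ### Perfect complexes and bounded complexes with noetherian cohomology -/

section DerivedCategories

variable (R : Type u) [Ring R] [HasDerivedCategory.{w₁} (ModuleCat.{u} R)]

/-- Bounded complexes of finitely generated projective modules. -/
structure IsStrictlyPerfect {R : Type u} [Ring R] (K : CochainComplex (ModuleCat.{u} R) ℤ) :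
    Prop where
  bounded : ∃ a b : ℤ, K.IsStrictlyGE a ∧ K.IsStrictlyLE b
  finite : ∀ i, Module.Finite R (K.X i)
  projective : ∀ i, Module.Projective R (K.X i)

/-- Perfect complexes: the objects of the derived category that are isomorphic to a bounded
complex of finitely generated projective modules. -/
def perfect : ObjectProperty (DerivedCategory (ModuleCat.{u} R)) :=
  fun X => ∃ K : CochainComplex (ModuleCat.{u} R) ℤ, IsStrictlyPerfect K ∧
    Nonempty (X ≅ DerivedCategory.Q.obj K)

/-- The objects of the derived category with bounded cohomology, all of whose cohomology modules
are noetherian. For noetherian `R`, the corresponding full subcategory is the bounded derived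
category of finitely generated modules. -/
def boundedCoherent : ObjectProperty (DerivedCategory (ModuleCat.{u} R)) :=
  fun X => (∃ a b : ℤ, ∀ i : ℤ, (i < a ∨ b < i) →
      IsZero ((DerivedCategory.homologyFunctor (ModuleCat.{u} R) i).obj X)) ∧
    ∀ i : ℤ, IsNoetherian R ((DerivedCategory.homologyFunctor (ModuleCat.{u} R) i).obj X)

instance : (perfect R).IsClosedUnderIsomorphisms where
  of_iso e := by
    rintro ⟨K, hK, ⟨f⟩⟩
    exact ⟨K, hK, ⟨e.symm ≪≫ f⟩⟩

instance : (boundedCoherent R).IsClosedUnderIsomorphisms where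
  of_iso {X Y} e := by
    rintro ⟨⟨a, b, h⟩, h'⟩
    refine ⟨⟨a, b, fun i hi => (h i hi).of_iso
      ((DerivedCategory.homologyFunctor _ i).mapIso e.symm)⟩, fun i => ?_⟩
    have := h' i
    exact isNoetherian_of_linearEquiv
      ((DerivedCategory.homologyFunctor _ i).mapIso e).toLinearEquiv

theorem isStrictlyPerfect_shift {R : Type u} [Ring R] {K : CochainComplex (ModuleCat.{u} R) ℤ}
    (hK : IsStrictlyPerfect K) (n : ℤ) : IsStrictlyPerfect (K⟦n⟧) := by
  obtain ⟨⟨a, b, ha, hb⟩, hf, hp⟩ := hK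
  exact ⟨⟨a - n, b - n, K.isStrictlyGE_shift a n _ (by lia),
    K.isStrictlyLE_shift b n _ (by lia)⟩, fun i => hf _, fun i => hp _⟩

theorem isStrictlyPerfect_mappingCone {R : Type u} [Ring R]
    {K L : CochainComplex (ModuleCat.{u} R) ℤ} (hK : IsStrictlyPerfect K)
    (hL : IsStrictlyPerfect L) (f : K ⟶ L) :
    IsStrictlyPerfect (CochainComplex.mappingCone f) := by
  obtain ⟨⟨a, b, ha, hb⟩, hf, hp⟩ := hK
  obtain ⟨⟨a', b', ha', hb'⟩, hf', hp'⟩ := hL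
  have e : ∀ i : ℤ, (CochainComplex.mappingCone f).X i ≃ₗ[R] K.X (i + 1) × L.X i := fun i =>
    (HomologicalComplex.homotopyCofiber.XIsoBiprod f i (i + 1) rfl ≪≫
      ModuleCat.biprodIsoProd _ _).toLinearEquiv
  refine ⟨⟨min (a - 1) a', max b b', ?_, ?_⟩, fun i => ?_, fun i => ?_⟩
  · exact CochainComplex.isStrictlyGE_mappingCone f a a' _ (by lia) (by lia)
  · rw [CochainComplex.isStrictlyLE_iff]
    intro i hi
    rw [CochainComplex.mappingCone.isZero_X_iff]
    exact ⟨K.isZero_of_isStrictlyLE b _ (by lia), L.isZero_of_isStrictlyLE b' _ (by lia)⟩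
  · have := hf (i + 1)
    have := hf' i
    exact Module.Finite.equiv (e i).symm
  · have := hp (i + 1)
    have := hp' i
    exact Module.Projective.of_equiv (e i).symm

theorem IsStrictlyPerfect.isKProjective {R : Type u} [Ring R]
    {K : CochainComplex (ModuleCat.{u} R) ℤ} (hK : IsStrictlyPerfect K) : K.IsKProjective := by
  obtain ⟨⟨a, b, ha, hb⟩, hf, hp⟩ := hK
  have : ∀ i, Projective (K.X i) := fun i => (IsProjective.iff_projective _).1 (hp i)
  exact CochainComplex.isKProjective_of_projective K b

/-- Morphisms in the derived category out of a strictly perfect complex come from morphisms of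
complexes. -/
theorem IsStrictlyPerfect.exists_Q_map_eq {K L : CochainComplex (ModuleCat.{u} R) ℤ}
    (hK : IsStrictlyPerfect K) (φ : DerivedCategory.Q.obj K ⟶ DerivedCategory.Q.obj L) :
    ∃ f : K ⟶ L, DerivedCategory.Q.map f = φ := by
  have := hK.isKProjective
  obtain ⟨g, hg⟩ := (CochainComplex.IsKProjective.Qh_map_bijective K
    ((HomotopyCategory.quotient _ _).obj L)).2
    ((DerivedCategory.quotientCompQhIso _).hom.app K ≫ φ ≫
      (DerivedCategory.quotientCompQhIso _).inv.app L)
  obtain ⟨f, rfl⟩ := (HomotopyCategory.quotient _ _).map_surjective g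
  refine ⟨f, ?_⟩
  have h := (DerivedCategory.quotientCompQhIso (ModuleCat.{u} R)).hom.naturality f
  have h' : (HomotopyCategory.quotient _ _ ⋙ DerivedCategory.Qh).map f =
    (DerivedCategory.quotientCompQhIso _).hom.app K ≫ φ ≫
      (DerivedCategory.quotientCompQhIso _).inv.app L := hg
  rw [h', Category.assoc, Category.assoc, Iso.inv_hom_id_app, Category.comp_id] at h
  exact ((cancel_epi _).1 h).symm

instance : (perfect R).IsStableUnderShift ℤ := ⟨fun n => ⟨fun X => by
  rintro ⟨K, hK, ⟨f⟩⟩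
  exact ⟨K⟦n⟧, isStrictlyPerfect_shift hK n,
    ⟨(shiftFunctor _ n).mapIso f ≪≫ ((DerivedCategory.Q.commShiftIso n).app K).symm⟩⟩⟩⟩

instance : (perfect R).IsTriangulatedClosed₃ := .mk' fun T hT h₁ h₂ => by
  obtain ⟨K, hK, ⟨e₁⟩⟩ := h₁
  obtain ⟨L, hL, ⟨e₂⟩⟩ := h₂
  obtain ⟨f, hf⟩ := hK.exists_Q_map_eq R (e₁.inv ≫ T.mor₁ ≫ e₂.hom)
  exact ⟨_, isStrictlyPerfect_mappingCone hK hL f,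
    ⟨Pretriangulated.Triangle.π₃.mapIso (Pretriangulated.isoTriangleOfIso₁₂ T _ hT
      (DerivedCategory.mappingCone_triangle_distinguished f) e₁ e₂ (by
        change T.mor₁ ≫ e₂.hom = e₁.hom ≫ DerivedCategory.Q.map f
        rw [hf, Iso.hom_inv_id_assoc]))⟩⟩

instance : (perfect R).IsTriangulated where
  exists_zero := by
    refine ⟨DerivedCategory.Q.obj 0, DerivedCategory.Q.map_isZero (isZero_zero _), 0,
      ⟨⟨0, 0, ?_, ?_⟩, fun i => ?_, fun i => ?_⟩, ⟨Iso.refl _⟩⟩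
    · rw [CochainComplex.isStrictlyGE_iff]
      exact fun i _ => (HomologicalComplex.eval _ _ i).map_isZero (isZero_zero _)
    · rw [CochainComplex.isStrictlyLE_iff]
      exact fun i _ => (HomologicalComplex.eval _ _ i).map_isZero (isZero_zero _)
    all_goals
      have := ModuleCat.subsingleton_of_isZero
        ((HomologicalComplex.eval (ModuleCat.{u} R) (.up ℤ) i).map_isZero (isZero_zero _))
      change Subsingleton ((0 : CochainComplex (ModuleCat.{u} R) ℤ).X i) at this
      infer_instance
  toIsTriangulatedClosed₂ := .of_isTriangulatedClosed₃

instance : (boundedCoherent R).IsTriangulated where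
  exists_zero := by
    have h : ∀ i, IsZero ((DerivedCategory.homologyFunctor (ModuleCat.{u} R) i).obj 0) :=
      fun i => Functor.map_isZero _ (isZero_zero _)
    refine ⟨0, isZero_zero _, ⟨0, 0, fun i _ => h i⟩, fun i => ?_⟩
    have := ModuleCat.subsingleton_of_isZero (h i)
    infer_instance
  toIsStableUnderShift := ⟨fun n => ⟨fun X => by
    rintro ⟨⟨a, b, h⟩, h'⟩
    have e : ∀ i : ℤ, (DerivedCategory.homologyFunctor (ModuleCat.{u} R) i).obj (X⟦n⟧) ≅
        (DerivedCategory.homologyFunctor (ModuleCat.{u} R) (n + i)).obj X := fun i =>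
      ((DerivedCategory.homologyFunctor (ModuleCat.{u} R) 0).shiftIso n i (n + i) rfl).app X
    refine ⟨⟨a - n, b - n, fun i hi => (h (n + i) (by lia)).of_iso (e i)⟩, fun i => ?_⟩
    have := h' (n + i)
    exact isNoetherian_of_linearEquiv (e i).symm.toLinearEquiv⟩⟩
  toIsTriangulatedClosed₂ := .mk' fun T hT h₁ h₃ => by
    obtain ⟨⟨a, b, h⟩, h'⟩ := h₁
    obtain ⟨⟨a', b', k⟩, k'⟩ := h₃
    refine ⟨⟨min a a', max b b', fun i hi => ?_⟩, fun i => ?_⟩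
    · exact (DerivedCategory.HomologySequence.exact₂ T hT i).isZero_of_both_zeros
        ((h i (by lia)).eq_of_src _ _) ((k i (by lia)).eq_of_tgt _ _)
    · have := h' i
      have := k' i
      exact isNoetherian_of_range_eq_ker _ _
        (DerivedCategory.HomologySequence.exact₂ T hT i).moduleCat_range_eq_ker

end DerivedCategories

/-! ### Derived functors on perfect complexes -/

section LeftDerived

variable (R S : Type u) [Ring R] [Ring S] [HasDerivedCategory.{w₁} (ModuleCat.{u} R)]
  [HasDerivedCategory.{w₂} (ModuleCat.{u} S)]

/-- The category `Perf(R)`, as a full subcategory of the derived category. -/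
abbrev Perf : Type _ := (perfect R).FullSubcategory

/-- The category `D^b(mod R)`, as a full subcategory of the derived category. -/
abbrev DbCoh : Type _ := (boundedCoherent R).FullSubcategory

/-- Complexes of modules (with no condition on the terms) whose image in the derived category is
perfect. -/
def perfectComplexes : ObjectProperty (CochainComplex (ModuleCat.{u} R) ℤ) :=
  (perfect R).inverseImage DerivedCategory.Q

/-- The localization functor from complexes with perfect image to `Perf(R)`. -/
def perfectQ : (perfectComplexes R).FullSubcategory ⥤ Perf R :=
  (perfect R).lift ((perfectComplexes R).ι ⋙ DerivedCategory.Q) fun K => K.property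

variable {R S}

/-- `L : Perf(R) ⥤ D(S)` is the left derived functor of `F`, that is, the right Kan extension
along the localization functor `perfectQ` of the functor that applies `F` termwise. -/
def IsLeftDerivedOnPerf (F : ModuleCat.{u} R ⥤ ModuleCat.{u} S) [F.Additive]
    (L : Perf R ⥤ DerivedCategory (ModuleCat.{u} S)) : Prop :=
  ∃ α : perfectQ R ⋙ L ⟶
      (perfectComplexes R).ι ⋙ F.mapHomologicalComplex (ComplexShape.up ℤ) ⋙ DerivedCategory.Q,
    L.IsRightKanExtension α

end LeftDerived

/-! ### Weakly crepant categorical resolutions -/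

section CategoricalResolution

universe v₁ v₂ v₃ u₁ u₂ u₃

variable {P : Type u₁} [Category.{v₁} P] {T : Type u₂} [Category.{v₂} T]
  {D : Type u₃} [Category.{v₃} D]

/-- `(F, G)` is an adjoint pair, where `F : P ⥤ D` is only defined on `P`, which is mapped to the
target `T` of `G` by `ι` (in practice a full subcategory): natural bijections
`Hom_D(F X, Y) ≃ Hom_T(X, G Y)`. -/
structure RelativeAdjunction (ι : P ⥤ T) (F : P ⥤ D) (G : D ⥤ T) where
  homEquiv (X : P) (Y : D) : (F.obj X ⟶ Y) ≃ (ι.obj X ⟶ G.obj Y)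
  naturality_left {X X' : P} {Y : D} (f : X' ⟶ X) (g : F.obj X ⟶ Y) :
    homEquiv X' Y (F.map f ≫ g) = ι.map f ≫ homEquiv X Y g
  naturality_right {X : P} {Y Y' : D} (g : F.obj X ⟶ Y) (h : Y ⟶ Y') :
    homEquiv X Y' (g ≫ h) = homEquiv X Y g ≫ G.map h

/-- The unit `X ⟶ G (F X)` of a relative adjunction. -/
def RelativeAdjunction.unit {ι : P ⥤ T} {F : P ⥤ D} {G : D ⥤ T} (a : RelativeAdjunction ι F G) :
    ι ⟶ F ⋙ G where
  app X := a.homEquiv X (F.obj X) (𝟙 _)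
  naturality X X' f := by
    have h₁ := a.naturality_left f (𝟙 (F.obj X'))
    have h₂ := a.naturality_right (𝟙 (F.obj X)) (F.map f)
    rw [Category.comp_id] at h₁
    rw [Category.id_comp] at h₂
    exact h₁.symm.trans h₂

/-- `(G, F)` is an adjoint pair, where `F : P ⥤ D` is only defined on `P`: natural bijections
`Hom_T(G Y, X) ≃ Hom_D(Y, F X)`. -/
structure RelativeCoadjunction (ι : P ⥤ T) (F : P ⥤ D) (G : D ⥤ T) where
  homEquiv (Y : D) (X : P) : (G.obj Y ⟶ ι.obj X) ≃ (Y ⟶ F.obj X)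
  naturality_left {Y Y' : D} {X : P} (h : Y' ⟶ Y) (g : G.obj Y ⟶ ι.obj X) :
    homEquiv Y' X (G.map h ≫ g) = h ≫ homEquiv Y X g
  naturality_right {Y : D} {X X' : P} (g : G.obj Y ⟶ ι.obj X) (f : X ⟶ X') :
    homEquiv Y X' (g ≫ ι.map f) = homEquiv Y X g ≫ F.map f

variable [HasZeroObject P] [HasShift P ℤ] [Preadditive P]
  [∀ n : ℤ, (shiftFunctor P n).Additive] [Pretriangulated P]
  [HasZeroObject T] [HasShift T ℤ] [Preadditive T]
  [∀ n : ℤ, (shiftFunctor T n).Additive] [Pretriangulated T]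
  [HasZeroObject D] [HasShift D ℤ] [Preadditive D]
  [∀ n : ℤ, (shiftFunctor D n).Additive] [Pretriangulated D]

/-- The conditions on a pair of functors `Ψup : P ⥤ D` and `Ψdown : D ⥤ T` to define a weakly
crepant categorical resolution of `T`, where `ι : P ⥤ T` is the inclusion of the perfect
objects. Smoothness of `D` is not part of this structure. -/
structure IsWeaklyCrepantResolution (ι : P ⥤ T) (Ψup : P ⥤ D) (Ψdown : D ⥤ T) : Prop where
  /-- `Ψ^*` is a triangulated functor. -/
  triangulated_up : ∃ _ : Ψup.CommShift ℤ, Ψup.IsTriangulated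
  /-- `Ψ_*` is a triangulated functor. -/
  triangulated_down : ∃ _ : Ψdown.CommShift ℤ, Ψdown.IsTriangulated
  /-- `(Ψ^*, Ψ_*)` is an adjoint pair whose unit `id → Ψ_* Ψ^*` is an isomorphism. -/
  adjoint : ∃ a : RelativeAdjunction ι Ψup Ψdown, IsIso a.unit
  /-- `(Ψ_*, Ψ^*)` is an adjoint pair as well. -/
  crepant : Nonempty (RelativeCoadjunction ι Ψup Ψdown)

end CategoricalResolution

/-! ### Homological smoothness -/

/-- A `k`-algebra `Γ` is homologically smooth if, as a bimodule over itself (that is, as a module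
over `Γ ⊗ Γᵐᵒᵖ`), it has a projective resolution of finite length with finitely generated
terms. -/
def HomologicallySmooth (k Γ : Type u) [Field k] [Ring Γ] [Algebra k Γ] : Prop :=
  letI : Module (Γ ⊗[k] Γᵐᵒᵖ) Γ := instModuleTensorProductMop k Γ
  ∃ Q : ProjectiveResolution (ModuleCat.of (Γ ⊗[k] Γᵐᵒᵖ) Γ),
    (∃ N : ℕ, ∀ i, N < i → IsZero (Q.complex.X i)) ∧
      ∀ i, Module.Finite (Γ ⊗[k] Γᵐᵒᵖ) (Q.complex.X i)

/-! ### The functors `ψ^*`, `ψ_*` and `ψ_!` -/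

section Psi

variable {k : Type u} [Field k] {n : ℕ} {ζ : k} (q : k) (hζ : IsPrimitiveRoot ζ (n + 1))

/-- `ψ^* = - ⊗_B e_0 Λ`, from right `B`-modules to right `Λ`-modules. -/
abbrev psiUpperStar : ModuleCat.{u} (B q ζ)ᵐᵒᵖ ⥤ ModuleCat.{u} (Lambda n q)ᵐᵒᵖ :=
  tensorFunctor (B q ζ) (Lambda n q) (E0Lambda q hζ)

/-- `ψ_* = Hom_Λ(e_0 Λ, -)`, from right `Λ`-modules to right `B`-modules. -/
abbrev psiLowerStar : ModuleCat.{u} (Lambda n q)ᵐᵒᵖ ⥤ ModuleCat.{u} (B q ζ)ᵐᵒᵖ :=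
  homFunctor (B q ζ) (Lambda n q) (E0Lambda q hζ)

/-- `ψ_! = - ⊗_Λ Λ e_0`, from right `Λ`-modules to right `B`-modules. -/
abbrev psiLowerShriek : ModuleCat.{u} (Lambda n q)ᵐᵒᵖ ⥤ ModuleCat.{u} (B q ζ)ᵐᵒᵖ :=
  tensorFunctor (Lambda n q) (B q ζ) (LambdaE0 q hζ)

variable [HasDerivedCategory.{w₁} (ModuleCat.{u} (B q ζ)ᵐᵒᵖ)]
  [HasDerivedCategory.{w₂} (ModuleCat.{u} (Lambda n q)ᵐᵒᵖ)]

/-- The derived functor `ψ_* : D(Λ) ⥤ D(B)` of the exact functor `ψ_*`. -/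
abbrev derivedPsiLowerStar :
    DerivedCategory (ModuleCat.{u} (Lambda n q)ᵐᵒᵖ) ⥤
      DerivedCategory (ModuleCat.{u} (B q ζ)ᵐᵒᵖ) :=
  (psiLowerStar q hζ).mapDerivedCategory

end Psi

end

end QuantumKleinian

/-! Write u and v for the sums of the arrows α_i and \bar α_i. The elements e_i u^a v^b form a basis
of Λ (`Lambda.basis`): they span by the commutation rules, and they are independent because Λ acts
on the space that has them as a basis. In this basis multiplication by u or v shifts coefficients,
up to powers of q. Comparing coefficients yields B ≅ e_0 Λ e_0 and all exactness statements below.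
Smoothness follows from the Koszul bimodule resolution of length two, whose maps are the
noncommutative derivatives of the relation vu = quv (`Lambda.homologicallySmooth`).

The functor ψ_* is M ↦ M e_0, in the form Hom_Λ(e_0 Λ, M) or M ⊗_Λ Λ e_0. Hence it has a left
adjoint ψ^* and a right adjoint ψ^! = Hom_B(Λ e_0, -). Since e_0 Λ e_0 = B, the unit of the first
adjunction and the counit of the second are isomorphisms. If P is strictly perfect, so is ψ^* P;
both are K-projective, and the first adjunction passes to derived categories: ψ_* is bijective on
morphisms out of ψ^* P (`bijectiveFrom_psiUpperStar`).

The heart is that ψ_* is also bijective on morphisms into ψ^* P (`bijectiveTo_psiUpperStar`). For an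
injective resolution P → E this holds for ψ^! E by the second adjunction, so it suffices that the
natural map ψ^* P → ψ^! E is a quasi-isomorphism (`quasiIso_to_psiUpperShriek`). Let C be its cone;
ψ_* C is acyclic. For a simple module S_i at a vertex i ≠ 0, RHom(S_i, M) is computed by the Koszul
complex M e_i → M e_{i+1} ⊕ M e_{i-1} → M e_i. This complex is exact for M = e_0 Λ, since e_0 Λ e_i
contains no path of length zero, and for M = ψ^! of an injective module, since S_i e_0 = 0. So it is
exact for all terms of C. The cohomology of C is killed by e_0, and long paths pass through the
vertex 0; hence the lowest nonzero cohomology would contain a nonzero element at some vertex i ≠ 0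
killed by u and v. The chase in `KoszulExact.exists_eq_of_exact` excludes this, and
`acyclic_of_koszulExact` concludes.

The rest is formal. By the first bijectivity ψ_* restricts to an equivalence from the objects ψ^* P
to Perf(B). The derived functor ψ^* is defined as its inverse, which makes it triangulated; it is
the Kan extension because it agrees with the termwise functor on strictly perfect complexes. The two
bijectivity statements are the two adjunctions. For the bounded categories one needs that Λ and B
are right noetherian (leading monomials in A_q, then finiteness and truncation by e_0) and that ψ_*
preserves noetherian modules. -/

namespace QuantumKleinian

noncomputable section

/-! ### The monomial basis of `Λ_q` -/

namespace Lambda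

variable {k : Type u} [Field k] (n : ℕ) (q : k)

/-- The image `∑ α_i` of `u` in `Λ_q`. -/
def u : Lambda n q := ofPlane n q (QuantumPlane.u q)

/-- The image `∑ \bar α_i` of `v` in `Λ_q`. -/
def v : Lambda n q := ofPlane n q (QuantumPlane.v q)

theorem u_eq : u n q = ∑ i, α n q i := QuantumPlane.lift_u _ _ _

theorem v_eq : v n q = ∑ i, αbar n q i := QuantumPlane.lift_v _ _ _

theorem v_mul_u : v n q * u n q = q • (u n q * v n q) := by
  rw [u, v, ← map_mul, QuantumPlane.v_mul_u, map_smul, map_mul]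

theorem e_mul_e_ite (i j : ZMod (n + 1)) :
    e n q i * e n q j = if i = j then e n q i else 0 := by
  split_ifs with h
  · rw [h, e_mul_self]
  · exact e_mul_e n q h

theorem e_mul_u (i : ZMod (n + 1)) : e n q i * u n q = α n q i := by
  rw [u_eq, Finset.mul_sum, Finset.sum_eq_single i, e_mul_α]
  · intro j _ hj
    rw [← e_mul_α, ← mul_assoc, e_mul_e n q hj.symm, zero_mul]
  · simp

theorem u_mul_e (i : ZMod (n + 1)) : u n q * e n q (i + 1) = α n q i := by
  rw [u_eq, Finset.sum_mul, Finset.sum_eq_single i, α_mul_e]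
  · intro j _ hj
    rw [← α_mul_e, mul_assoc, e_mul_e n q (fun h => hj (add_right_cancel h)), mul_zero]
  · simp

theorem e_mul_v (i : ZMod (n + 1)) : e n q (i + 1) * v n q = αbar n q i := by
  rw [v_eq, Finset.mul_sum, Finset.sum_eq_single i, e_mul_αbar]
  · intro j _ hj
    rw [← e_mul_αbar, ← mul_assoc, e_mul_e n q (fun h => hj (add_right_cancel h).symm), zero_mul]
  · simp

theorem v_mul_e (i : ZMod (n + 1)) : v n q * e n q i = αbar n q i := by
  rw [v_eq, Finset.sum_mul, Finset.sum_eq_single i, αbar_mul_e]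
  · intro j _ hj
    rw [← αbar_mul_e, mul_assoc, e_mul_e n q hj, mul_zero]
  · simp

theorem u_mul_e_eq (i : ZMod (n + 1)) : u n q * e n q i = e n q (i - 1) * u n q := by
  rw [e_mul_u, ← u_mul_e, sub_add_cancel]

theorem v_mul_e_eq (i : ZMod (n + 1)) : v n q * e n q i = e n q (i + 1) * v n q := by
  rw [v_mul_e, e_mul_v]

theorem u_pow_mul_e (a : ℕ) (i : ZMod (n + 1)) :
    u n q ^ a * e n q i = e n q (i - a) * u n q ^ a := by
  induction a generalizing i with
  | zero => simp
  | succ a ih =>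
    rw [pow_succ, mul_assoc, u_mul_e_eq, ← mul_assoc, ih, mul_assoc]
    congr 2
    push_cast
    ring

theorem v_pow_mul_e (b : ℕ) (i : ZMod (n + 1)) :
    v n q ^ b * e n q i = e n q (i + b) * v n q ^ b := by
  induction b generalizing i with
  | zero => simp
  | succ b ih =>
    rw [pow_succ, mul_assoc, v_mul_e_eq, ← mul_assoc, ih, mul_assoc]
    congr 2
    push_cast
    ring

theorem v_mul_u_pow (a : ℕ) : v n q * u n q ^ a = q ^ a • (u n q ^ a * v n q) := by
  induction a with
  | zero => simp
  | succ a ih =>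
    rw [pow_succ (u n q), ← mul_assoc, ih, smul_mul_assoc, mul_assoc, v_mul_u, mul_smul_comm,
      smul_smul, ← mul_assoc, pow_succ]

theorem v_pow_mul_u (b : ℕ) : v n q ^ b * u n q = q ^ b • (u n q * v n q ^ b) := by
  induction b with
  | zero => simp
  | succ b ih =>
    rw [pow_succ' (v n q), mul_assoc, ih, mul_smul_comm, ← mul_assoc, v_mul_u, smul_mul_assoc,
      smul_smul, mul_assoc, pow_succ]

/-- The element `e_i u^a v^b` of `Λ_q`. -/
def monomial (m : ZMod (n + 1) × ℕ × ℕ) : Lambda n q :=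
  e n q m.1 * u n q ^ m.2.1 * v n q ^ m.2.2

theorem e_mul_monomial (j i : ZMod (n + 1)) (a b : ℕ) :
    e n q j * monomial n q (i, a, b) = if j = i then monomial n q (i, a, b) else 0 := by
  simp only [monomial, ← mul_assoc, e_mul_e_ite]
  split_ifs with h
  · rw [h]
  · simp

theorem monomial_mul_e (i j : ZMod (n + 1)) (a b : ℕ) :
    monomial n q (i, a, b) * e n q j =
      if i = j + b - a then monomial n q (i, a, b) else 0 := by
  rw [monomial]
  dsimp only
  rw [mul_assoc, v_pow_mul_e, ← mul_assoc, mul_assoc (e n q i), u_pow_mul_e, ← mul_assoc,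
    e_mul_e_ite]
  split_ifs with h
  · rfl
  · simp

theorem u_mul_monomial (i : ZMod (n + 1)) (a b : ℕ) :
    u n q * monomial n q (i, a, b) = monomial n q (i - 1, a + 1, b) := by
  simp only [monomial, ← mul_assoc, u_mul_e_eq, pow_succ' (u n q)]

theorem v_mul_monomial (i : ZMod (n + 1)) (a b : ℕ) :
    v n q * monomial n q (i, a, b) = q ^ a • monomial n q (i + 1, a, b + 1) := by
  simp only [monomial]
  rw [← mul_assoc, ← mul_assoc, v_mul_e_eq, mul_assoc (e n q (i + 1)), v_mul_u_pow, pow_succ' (v n q)]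
  simp only [mul_smul_comm, smul_mul_assoc, mul_assoc]

theorem monomial_mul_v (i : ZMod (n + 1)) (a b : ℕ) :
    monomial n q (i, a, b) * v n q = monomial n q (i, a, b + 1) := by
  simp only [monomial, mul_assoc, pow_succ]

theorem monomial_mul_u (i : ZMod (n + 1)) (a b : ℕ) :
    monomial n q (i, a, b) * u n q = q ^ b • monomial n q (i, a + 1, b) := by
  simp only [monomial]
  rw [mul_assoc, v_pow_mul_u, mul_smul_comm, pow_succ (u n q)]
  simp only [mul_assoc]

variable {n q} in
theorem induction {p : Lambda n q → Prop}
    (halg : ∀ c : k, p (algebraMap k _ c)) (he : ∀ i, p (e n q i)) (hα : ∀ i, p (α n q i))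
    (hαbar : ∀ i, p (αbar n q i)) (hadd : ∀ a b, p a → p b → p (a + b))
    (hmul : ∀ a b, p a → p b → p (a * b)) (a : Lambda n q) : p a := by
  obtain ⟨a, rfl⟩ : ∃ x, Lambda.mk n q x = a := RingQuot.mkAlgHom_surjective k (QuiverRel n q) a
  induction a using FreeAlgebra.induction with
  | grade0 c => simpa using halg c
  | grade1 i =>
    cases i with
    | vertex i => exact he i
    | arrow i => exact hα i
    | coarrow i => exact hαbar i
  | mul a b ha hb => simpa using hmul _ _ ha hb
  | add a b ha hb => simpa using hadd _ _ ha hb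

theorem e_mul_mem_span_monomial (i : ZMod (n + 1)) {x : Lambda n q}
    (hx : x ∈ Submodule.span k (Set.range (monomial n q))) :
    e n q i * x ∈ Submodule.span k (Set.range (monomial n q)) := by
  induction hx using Submodule.span_induction with
  | mem x hx =>
    obtain ⟨⟨j, a, b⟩, rfl⟩ := hx
    rw [e_mul_monomial]
    split_ifs
    · exact Submodule.subset_span ⟨_, rfl⟩
    · exact zero_mem _
  | zero => simp
  | add x y _ _ hx hy => rw [mul_add]; exact add_mem hx hy
  | smul c x _ hx => rw [mul_smul_comm]; exact Submodule.smul_mem _ _ hx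

theorem u_mul_mem_span_monomial {x : Lambda n q}
    (hx : x ∈ Submodule.span k (Set.range (monomial n q))) :
    u n q * x ∈ Submodule.span k (Set.range (monomial n q)) := by
  induction hx using Submodule.span_induction with
  | mem x hx =>
    obtain ⟨⟨j, a, b⟩, rfl⟩ := hx
    rw [u_mul_monomial]
    exact Submodule.subset_span ⟨_, rfl⟩
  | zero => simp
  | add x y _ _ hx hy => rw [mul_add]; exact add_mem hx hy
  | smul c x _ hx => rw [mul_smul_comm]; exact Submodule.smul_mem _ _ hx

theorem v_mul_mem_span_monomial {x : Lambda n q}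
    (hx : x ∈ Submodule.span k (Set.range (monomial n q))) :
    v n q * x ∈ Submodule.span k (Set.range (monomial n q)) := by
  induction hx using Submodule.span_induction with
  | mem x hx =>
    obtain ⟨⟨j, a, b⟩, rfl⟩ := hx
    rw [v_mul_monomial]
    exact Submodule.smul_mem _ _ (Submodule.subset_span ⟨_, rfl⟩)
  | zero => simp
  | add x y _ _ hx hy => rw [mul_add]; exact add_mem hx hy
  | smul c x _ hx => rw [mul_smul_comm]; exact Submodule.smul_mem _ _ hx

/-- The span is stable under left multiplication by the generators, so it is a left ideal, and it
contains 1 = ∑ e_i. -/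
theorem span_monomial : Submodule.span k (Set.range (monomial n q)) = ⊤ := by
  refine Submodule.eq_top_iff'.2 fun x => ?_
  suffices h : ∀ y ∈ Submodule.span k (Set.range (monomial n q)),
      x * y ∈ Submodule.span k (Set.range (monomial n q)) by
    rw [← mul_one x]
    refine h 1 ?_
    rw [← sum_e n q]
    refine Submodule.sum_mem _ fun i _ => Submodule.subset_span ⟨(i, 0, 0), ?_⟩
    simp [monomial]
  induction x using Lambda.induction with
  | halg c =>
    intro y hy
    rw [← Algebra.smul_def]
    exact Submodule.smul_mem _ _ hy
  | he i => exact fun y hy => e_mul_mem_span_monomial n q i hy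
  | hα i =>
    intro y hy
    rw [← e_mul_u, mul_assoc]
    exact e_mul_mem_span_monomial n q i (u_mul_mem_span_monomial n q hy)
  | hαbar i =>
    intro y hy
    rw [← e_mul_v, mul_assoc]
    exact e_mul_mem_span_monomial n q _ (v_mul_mem_span_monomial n q hy)
  | hadd a b ha hb =>
    intro y hy
    rw [add_mul]
    exact add_mem (ha y hy) (hb y hy)
  | hmul a b ha hb =>
    intro y hy
    rw [mul_assoc]
    exact ha _ (hb y hy)

/-! ### Linear independence of the monomials -/

/-- The action of the generators of `Λ_q` on the space with basis the monomials. -/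
def genAction : QuiverGen n → Module.End k (ZMod (n + 1) × ℕ × ℕ →₀ k)
  | .vertex j => Finsupp.linearCombination k fun m => if m.1 = j then Finsupp.single m 1 else 0
  | .arrow j => Finsupp.linearCombination k fun m =>
      if m.1 = j + 1 then Finsupp.single (j, m.2.1 + 1, m.2.2) 1 else 0
  | .coarrow j => Finsupp.linearCombination k fun m =>
      if m.1 = j then Finsupp.single (j + 1, m.2.1, m.2.2 + 1) (q ^ m.2.1) else 0

theorem genAction_vertex (j i : ZMod (n + 1)) (a b : ℕ) (c : k) :
    genAction n q (.vertex j) (Finsupp.single (i, a, b) c) =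
      if i = j then Finsupp.single (i, a, b) c else 0 := by
  simp only [genAction, Finsupp.linearCombination_single]
  split_ifs <;> simp

theorem genAction_arrow (j i : ZMod (n + 1)) (a b : ℕ) (c : k) :
    genAction n q (.arrow j) (Finsupp.single (i, a, b) c) =
      if i = j + 1 then Finsupp.single (j, a + 1, b) c else 0 := by
  simp only [genAction, Finsupp.linearCombination_single]
  split_ifs <;> simp

theorem genAction_coarrow (j i : ZMod (n + 1)) (a b : ℕ) (c : k) :
    genAction n q (.coarrow j) (Finsupp.single (i, a, b) c) =
      if i = j then Finsupp.single (j + 1, a, b + 1) (c * q ^ a) else 0 := by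
  simp only [genAction, Finsupp.linearCombination_single]
  split_ifs <;> simp

/-- The representation of `Λ_q` on the space with basis the monomials. -/
def repr : Lambda n q →ₐ[k] Module.End k (ZMod (n + 1) × ℕ × ℕ →₀ k) :=
  RingQuot.liftAlgHom k ⟨FreeAlgebra.lift k (genAction n q), by
    intro x y h
    refine Finsupp.lhom_ext fun m c => ?_
    obtain ⟨i, a, b⟩ := m
    cases h with
    | vertex_mul_self j =>
      simp only [map_mul, FreeAlgebra.lift_ι_apply, Module.End.mul_apply, genAction_vertex]
      split_ifs with h <;> simp [genAction_vertex, h]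
    | vertex_mul_vertex j l hjl =>
      simp only [map_mul, FreeAlgebra.lift_ι_apply, Module.End.mul_apply, genAction_vertex]
      split_ifs with h
      · subst h
        simp [genAction_vertex, hjl.symm]
      · simp
    | sum_vertex =>
      simp [FreeAlgebra.lift_ι_apply, LinearMap.sum_apply, genAction_vertex]
    | vertex_mul_arrow j =>
      simp only [map_mul, FreeAlgebra.lift_ι_apply, Module.End.mul_apply, genAction_arrow]
      split_ifs with h <;> simp [genAction_vertex]
    | arrow_mul_vertex j =>
      simp only [map_mul, FreeAlgebra.lift_ι_apply, Module.End.mul_apply, genAction_vertex]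
      split_ifs with h <;> simp [genAction_arrow, h]
    | vertex_mul_coarrow j =>
      simp only [map_mul, FreeAlgebra.lift_ι_apply, Module.End.mul_apply, genAction_coarrow]
      split_ifs with h <;> simp only [genAction_vertex, if_true, map_zero]
    | coarrow_mul_vertex j =>
      simp only [map_mul, FreeAlgebra.lift_ι_apply, Module.End.mul_apply, genAction_vertex]
      split_ifs with h <;> simp [genAction_coarrow, h]
    | preprojective j =>
      simp only [map_mul, map_smul, FreeAlgebra.lift_ι_apply, Module.End.mul_apply,
        genAction_coarrow, genAction_arrow, LinearMap.smul_apply]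
      split_ifs with h
      · simp only [genAction_coarrow, genAction_arrow, if_true, Finsupp.smul_single, smul_eq_mul]
        congr 1
        ring
      · simp⟩

theorem repr_mk (x : FreeAlgebra k (QuiverGen n)) :
    repr n q (Lambda.mk n q x) = FreeAlgebra.lift k (genAction n q) x :=
  RingQuot.liftAlgHom_mkAlgHom_apply k _ _ _

theorem repr_e (i : ZMod (n + 1)) : repr n q (e n q i) = genAction n q (.vertex i) := by
  rw [e, repr_mk, FreeAlgebra.lift_ι_apply]

theorem repr_u_single (i : ZMod (n + 1)) (a b : ℕ) (c : k) :
    repr n q (u n q) (Finsupp.single (i, a, b) c) = Finsupp.single (i - 1, a + 1, b) c := by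
  simp only [u_eq, map_sum, LinearMap.sum_apply, α, repr_mk, FreeAlgebra.lift_ι_apply,
    genAction_arrow]
  rw [Finset.sum_eq_single (i - 1)] <;> simp +contextual [eq_sub_iff_add_eq, eq_comm]

theorem repr_v_single (i : ZMod (n + 1)) (a b : ℕ) (c : k) :
    repr n q (v n q) (Finsupp.single (i, a, b) c) =
      Finsupp.single (i + 1, a, b + 1) (c * q ^ a) := by
  simp [v_eq, map_sum, LinearMap.sum_apply, αbar, repr_mk, FreeAlgebra.lift_ι_apply,
    genAction_coarrow]

/-- The vector ∑ single (j, 0, 0) 1 plays the role of 1 = ∑ e_j. Evaluating the representation there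
turns a linear relation among monomials into one among basis vectors. -/
theorem repr_monomial (m : ZMod (n + 1) × ℕ × ℕ) :
    repr n q (monomial n q m) (∑ j, Finsupp.single (j, 0, 0) 1) = Finsupp.single m 1 := by
  obtain ⟨i, a, b⟩ := m
  have hv : ∀ b, repr n q (v n q ^ b) (∑ j, Finsupp.single (j, 0, 0) 1) =
      ∑ j : ZMod (n + 1), Finsupp.single (j, 0, b) (1 : k) := fun b => by
    induction b with
    | zero => simp
    | succ b ih =>
      rw [pow_succ', map_mul, Module.End.mul_apply, ih, map_sum]
      simp only [repr_v_single, pow_zero, mul_one]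
      exact Equiv.sum_comp (Equiv.addRight (1 : ZMod (n + 1)))
        (fun j => Finsupp.single (j, 0, b + 1) (1 : k))
  have hu : ∀ a, repr n q (u n q ^ a) (∑ j : ZMod (n + 1), Finsupp.single (j, 0, b) (1 : k)) =
      ∑ j : ZMod (n + 1), Finsupp.single (j, a, b) (1 : k) := fun a => by
    induction a with
    | zero => simp
    | succ a ih =>
      rw [pow_succ', map_mul, Module.End.mul_apply, ih, map_sum]
      simp only [repr_u_single]
      exact Equiv.sum_comp (Equiv.subRight (1 : ZMod (n + 1)))
        (fun j => Finsupp.single (j, a + 1, b) (1 : k))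
  rw [monomial, map_mul, map_mul, Module.End.mul_apply, Module.End.mul_apply, hv, hu, map_sum,
    repr_e]
  simp [genAction_vertex]

theorem linearIndependent_monomial : LinearIndependent k (monomial n q) := by
  refine LinearIndependent.of_comp (((LinearMap.applyₗ (R := k)
    (∑ j : ZMod (n + 1), Finsupp.single (j, 0, 0) (1 : k)))).comp (repr n q).toLinearMap) ?_
  have h := (Finsupp.basisSingleOne (R := k) (ι := ZMod (n + 1) × ℕ × ℕ)).linearIndependent
  rw [Finsupp.coe_basisSingleOne] at h
  convert h
  exact repr_monomial n q _

/-- The basis of `Λ_q` that consists of the elements `e_i u^a v^b`. -/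
def basis : Module.Basis (ZMod (n + 1) × ℕ × ℕ) k (Lambda n q) :=
  Module.Basis.mk (linearIndependent_monomial n q) (span_monomial n q).ge

@[simp]
theorem basis_apply (m : ZMod (n + 1) × ℕ × ℕ) : basis n q m = monomial n q m := by
  simp [basis]

end Lambda

end

end QuantumKleinian

namespace QuantumKleinian

noncomputable section

/-! ### Coordinates with respect to the monomial basis -/

namespace Lambda

variable {k : Type u} [Field k] {n : ℕ} {q : k}

theorem repr_basis_monomial (m m' : ZMod (n + 1) × ℕ × ℕ) :
    (basis n q).repr (monomial n q m) m' = if m = m' then 1 else 0 := by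
  rw [← basis_apply, Module.Basis.repr_self, Finsupp.single_apply]

/-- Two linear functionals on `Λ_q` that agree on monomials are equal. -/
theorem functional_ext {f g : Lambda n q →ₗ[k] k}
    (h : ∀ i a b, f (monomial n q (i, a, b)) = g (monomial n q (i, a, b))) (x : Lambda n q) :
    f x = g x := by
  refine DFunLike.congr_fun ((basis n q).ext fun m => ?_) x
  simpa using h m.1 m.2.1 m.2.2

/-- This and the next identities read the multiplication rules for monomials as shifts of
coefficients. Both sides are linear in `x`, so monomials suffice. -/
theorem coord_mul_v_succ (x : Lambda n q) (i : ZMod (n + 1)) (a b : ℕ) :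
    (basis n q).repr (x * v n q) (i, a, b + 1) = (basis n q).repr x (i, a, b) :=
  functional_ext (f := (basis n q).coord (i, a, b + 1) ∘ₗ LinearMap.mulRight k (v n q))
    (g := (basis n q).coord (i, a, b)) (fun j c d => by
      simp [monomial_mul_v, repr_basis_monomial]) x

theorem coord_mul_v_zero (x : Lambda n q) (i : ZMod (n + 1)) (a : ℕ) :
    (basis n q).repr (x * v n q) (i, a, 0) = 0 :=
  functional_ext (f := (basis n q).coord (i, a, 0) ∘ₗ LinearMap.mulRight k (v n q))
    (g := 0) (fun j c d => by
      simp [monomial_mul_v, repr_basis_monomial]) x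

theorem coord_mul_u_succ (x : Lambda n q) (i : ZMod (n + 1)) (a b : ℕ) :
    (basis n q).repr (x * u n q) (i, a + 1, b) = q ^ b * (basis n q).repr x (i, a, b) :=
  functional_ext (f := (basis n q).coord (i, a + 1, b) ∘ₗ LinearMap.mulRight k (u n q))
    (g := q ^ b • (basis n q).coord (i, a, b)) (fun j c d => by
      simp only [LinearMap.comp_apply, LinearMap.mulRight_apply, monomial_mul_u, map_smul,
        Module.Basis.coord_apply, repr_basis_monomial, LinearMap.smul_apply]
      by_cases h : d = b
      · simp [h]
      · simp [h]) x

theorem coord_mul_u_zero (x : Lambda n q) (i : ZMod (n + 1)) (b : ℕ) :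
    (basis n q).repr (x * u n q) (i, 0, b) = 0 :=
  functional_ext (f := (basis n q).coord (i, 0, b) ∘ₗ LinearMap.mulRight k (u n q))
    (g := 0) (fun j c d => by
      simp [monomial_mul_u, repr_basis_monomial]) x

theorem coord_u_mul_succ (x : Lambda n q) (i : ZMod (n + 1)) (a b : ℕ) :
    (basis n q).repr (u n q * x) (i, a + 1, b) = (basis n q).repr x (i + 1, a, b) :=
  functional_ext (f := (basis n q).coord (i, a + 1, b) ∘ₗ LinearMap.mulLeft k (u n q))
    (g := (basis n q).coord (i + 1, a, b)) (fun j c d => by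
      simp [u_mul_monomial, repr_basis_monomial, sub_eq_iff_eq_add]) x

theorem coord_u_mul_zero (x : Lambda n q) (i : ZMod (n + 1)) (b : ℕ) :
    (basis n q).repr (u n q * x) (i, 0, b) = 0 :=
  functional_ext (f := (basis n q).coord (i, 0, b) ∘ₗ LinearMap.mulLeft k (u n q))
    (g := 0) (fun j c d => by
      simp [u_mul_monomial, repr_basis_monomial]) x

theorem coord_v_mul_succ (x : Lambda n q) (i : ZMod (n + 1)) (a b : ℕ) :
    (basis n q).repr (v n q * x) (i, a, b + 1) = q ^ a * (basis n q).repr x (i - 1, a, b) :=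
  functional_ext (f := (basis n q).coord (i, a, b + 1) ∘ₗ LinearMap.mulLeft k (v n q))
    (g := q ^ a • (basis n q).coord (i - 1, a, b)) (fun j c d => by
      simp only [LinearMap.comp_apply, LinearMap.mulLeft_apply, v_mul_monomial, map_smul,
        Module.Basis.coord_apply, repr_basis_monomial, LinearMap.smul_apply]
      by_cases h : c = a
      · simp [h, eq_sub_iff_add_eq]
      · simp [h]) x

theorem coord_v_mul_zero (x : Lambda n q) (i : ZMod (n + 1)) (a : ℕ) :
    (basis n q).repr (v n q * x) (i, a, 0) = 0 :=
  functional_ext (f := (basis n q).coord (i, a, 0) ∘ₗ LinearMap.mulLeft k (v n q))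
    (g := 0) (fun j c d => by
      simp [v_mul_monomial, repr_basis_monomial]) x

theorem coord_e_mul (x : Lambda n q) (j i : ZMod (n + 1)) (a b : ℕ) :
    (basis n q).repr (e n q j * x) (i, a, b) =
      if i = j then (basis n q).repr x (i, a, b) else 0 :=
  functional_ext (f := (basis n q).coord (i, a, b) ∘ₗ LinearMap.mulLeft k (e n q j))
    (g := if i = j then (basis n q).coord (i, a, b) else 0) (fun l c d => by
      simp only [LinearMap.comp_apply, LinearMap.mulLeft_apply, e_mul_monomial,
        Module.Basis.coord_apply]
      split_ifs with h h' h' <;> simp_all [repr_basis_monomial]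
      all_goals
        rintro rfl
        simp_all) x |>.trans (by split_ifs <;> rfl)

/-- Right multiplication by e_j keeps or kills each monomial, and it kills e_i. -/
theorem coord_mul_e_of_ne (x : Lambda n q) {j i : ZMod (n + 1)} (h : i ≠ j) :
    (basis n q).repr (x * e n q j) (i, 0, 0) = 0 :=
  functional_ext (f := (basis n q).coord (i, 0, 0) ∘ₗ LinearMap.mulRight k (e n q j))
    (g := 0) (fun l c d => by
      simp only [LinearMap.comp_apply, LinearMap.mulRight_apply, monomial_mul_e,
        Module.Basis.coord_apply, LinearMap.zero_apply]
      split_ifs with h'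
      · rw [repr_basis_monomial, if_neg]
        rintro ⟨⟩
        simp_all
      · simp) x

theorem coord_ext {x y : Lambda n q}
    (h : ∀ i a b, (basis n q).repr x (i, a, b) = (basis n q).repr y (i, a, b)) : x = y :=
  (basis n q).repr.injective (Finsupp.ext fun m => h m.1 m.2.1 m.2.2)

/-- Pulling coefficients back along an injective map keeps the support finite. With shifts for `f`
this divides by u or v and drops the terms that are not divisible. -/
theorem exists_coord_eq (x : Lambda n q)
    {f : ZMod (n + 1) × ℕ × ℕ → ZMod (n + 1) × ℕ × ℕ} (hf : Function.Injective f) :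
    ∃ y : Lambda n q, ∀ m, (basis n q).repr y m = (basis n q).repr x (f m) :=
  ⟨(basis n q).repr.symm (Finsupp.comapDomain f ((basis n q).repr x) hf.injOn), fun m => by simp⟩

/-- Variant of `exists_coord_eq`, with only the coordinates in `s` kept. -/
theorem exists_coord_eq_ite (x : Lambda n q)
    {f : ZMod (n + 1) × ℕ × ℕ → ZMod (n + 1) × ℕ × ℕ} (hf : Function.Injective f)
    (s : ZMod (n + 1) × ℕ × ℕ → Prop) [DecidablePred s] :
    ∃ y : Lambda n q, ∀ m, (basis n q).repr y m = if s m then (basis n q).repr x (f m) else 0 :=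
  ⟨(basis n q).repr.symm
    ((Finsupp.comapDomain f ((basis n q).repr x) hf.injOn).filter s), fun m => by
      simp [Finsupp.filter_apply]⟩

/-! ### Exactness of the Koszul complexes -/

theorem eq_zero_of_mul_v_eq_zero {x : Lambda n q} (h : x * v n q = 0) : x = 0 :=
  coord_ext fun i a b => by
    rw [← coord_mul_v_succ, h]
    simp

theorem eq_zero_of_u_mul_eq_zero {x : Lambda n q} (h : u n q * x = 0) : x = 0 :=
  coord_ext fun i a b => by
    have := coord_u_mul_succ x (i - 1) a b
    rw [sub_add_cancel] at this
    rw [← this, h]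
    simp

/-- Take for t the quotient of y₂ by v. Terms of y₂ without v would give terms without v in y₂ u,
but y₁ v has none; so t v = y₂. Comparing the other coefficients gives t u = y₁. -/
theorem exists_eq_mul_of_mul_u_eq (hq : q ≠ 0) {y₁ y₂ : Lambda n q}
    (h : y₂ * u n q = q • (y₁ * v n q)) :
    ∃ t, t * u n q = y₁ ∧ t * v n q = y₂ := by
  have hc : ∀ m, (basis n q).repr (y₂ * u n q) m = q * (basis n q).repr (y₁ * v n q) m := fun m => by
    rw [h]
    simp
  obtain ⟨t, ht⟩ := exists_coord_eq y₂ (f := fun m => (m.1, m.2.1, m.2.2 + 1))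
    (by rintro ⟨i, a, b⟩ ⟨j, c, d⟩ h; simpa using h)
  refine ⟨t, coord_ext fun i a b => ?_, coord_ext fun i a b => ?_⟩
  · cases a with
    | zero =>
      have := hc (i, 0, b + 1)
      rw [coord_mul_u_zero, coord_mul_v_succ] at this
      rw [coord_mul_u_zero]
      exact ((mul_eq_zero.1 this.symm).resolve_left hq).symm
    | succ a =>
      have := hc (i, a + 1, b + 1)
      rw [coord_mul_u_succ, coord_mul_v_succ, pow_succ', mul_assoc] at this
      rw [coord_mul_u_succ, ht]
      exact mul_left_cancel₀ hq this
  · cases b with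
    | zero =>
      have := hc (i, a + 1, 0)
      rw [coord_mul_u_succ, coord_mul_v_zero] at this
      simpa [coord_mul_v_zero] using this.symm
    | succ b => rw [coord_mul_v_succ, ht]

/-- Mirror image of `exists_eq_mul_of_mul_u_eq`: now t is the quotient of y₁ by u from the left. -/
theorem exists_eq_mul_of_v_mul_eq (hq : q ≠ 0) {y₁ y₂ : Lambda n q}
    (h : v n q * y₁ = q • (u n q * y₂)) :
    ∃ t, u n q * t = y₁ ∧ v n q * t = y₂ := by
  have hc : ∀ m, (basis n q).repr (v n q * y₁) m = q * (basis n q).repr (u n q * y₂) m := fun m => by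
    rw [h]
    simp
  obtain ⟨t, ht⟩ := exists_coord_eq y₁ (f := fun m => (m.1 - 1, m.2.1 + 1, m.2.2))
    (by rintro ⟨i, a, b⟩ ⟨j, c, d⟩ h; simpa using h)
  refine ⟨t, coord_ext fun i a b => ?_, coord_ext fun i a b => ?_⟩
  · cases a with
    | zero =>
      have := hc (i + 1, 0, b + 1)
      rw [coord_u_mul_zero, coord_v_mul_succ] at this
      simpa [coord_u_mul_zero] using this.symm
    | succ a =>
      rw [coord_u_mul_succ, ht]
      simp
  · cases b with
    | zero =>
      have := hc (i - 1, a + 1, 0)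
      rw [coord_v_mul_zero, coord_u_mul_succ, sub_add_cancel] at this
      rw [coord_v_mul_zero]
      exact ((mul_eq_zero.1 this.symm).resolve_left hq).symm
    | succ b =>
      have := hc (i - 1, a + 1, b + 1)
      rw [coord_v_mul_succ, coord_u_mul_succ, sub_add_cancel, pow_succ', mul_assoc] at this
      rw [coord_v_mul_succ, ht]
      exact mul_left_cancel₀ hq this

/-- The terms of w that contain v go into y₁ v. The terms e_i u^a with a > 0 go into y₂ u, where no
power of q appears because y₂ contains no v. -/
theorem exists_eq_mul_u_add_mul_v {w : Lambda n q}
    (hw : ∀ i, (basis n q).repr w (i, 0, 0) = 0) :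
    ∃ y₁ y₂, w = y₂ * u n q + y₁ * v n q := by
  obtain ⟨y₁, h₁⟩ := exists_coord_eq w (f := fun m => (m.1, m.2.1, m.2.2 + 1))
    (by rintro ⟨i, a, b⟩ ⟨j, c, d⟩ h; simpa using h)
  obtain ⟨y₂, h₂⟩ := exists_coord_eq_ite w (f := fun m => (m.1, m.2.1 + 1, m.2.2))
    (by rintro ⟨i, a, b⟩ ⟨j, c, d⟩ h; simpa using h) (fun m => m.2.2 = 0)
  refine ⟨y₁, y₂, coord_ext fun i a b => ?_⟩
  rw [map_add, Finsupp.add_apply]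
  cases a with
  | zero =>
    rw [coord_mul_u_zero, zero_add]
    cases b with
    | zero => rw [coord_mul_v_zero, hw]
    | succ b => rw [coord_mul_v_succ, h₁]
  | succ a =>
    rw [coord_mul_u_succ, h₂]
    cases b with
    | zero => simp [coord_mul_v_zero]
    | succ b => simp [coord_mul_v_succ, h₁]

/-- Here the terms that contain u go into u y₁ and the terms e_i v^b with b > 0 into v y₂; since y₂
contains no u, again no power of q appears. -/
theorem exists_eq_u_mul_add_v_mul {w : Lambda n q}
    (hw : ∀ i, (basis n q).repr w (i, 0, 0) = 0) :
    ∃ y₁ y₂, w = u n q * y₁ + v n q * y₂ := by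
  obtain ⟨y₁, h₁⟩ := exists_coord_eq w (f := fun m => (m.1 - 1, m.2.1 + 1, m.2.2))
    (by rintro ⟨i, a, b⟩ ⟨j, c, d⟩ h; simpa using h)
  obtain ⟨y₂, h₂⟩ := exists_coord_eq_ite w (f := fun m => (m.1 + 1, m.2.1, m.2.2 + 1))
    (by rintro ⟨i, a, b⟩ ⟨j, c, d⟩ h; simpa using h) (fun m => m.2.1 = 0)
  refine ⟨y₁, y₂, coord_ext fun i a b => ?_⟩
  rw [map_add, Finsupp.add_apply]
  cases b with
  | zero =>
    rw [coord_v_mul_zero, add_zero]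
    cases a with
    | zero => rw [coord_u_mul_zero, hw]
    | succ a => simp [coord_u_mul_succ, h₁]
  | succ b =>
    rw [coord_v_mul_succ, h₂]
    cases a with
    | zero => simp [coord_u_mul_zero]
    | succ a => simp [coord_u_mul_succ, h₁]

/-- A path between different vertices has positive length. -/
theorem coord_zero_of_e_mul_of_mul_e {w : Lambda n q} {i j : ZMod (n + 1)} (hij : i ≠ j)
    (hi : e n q i * w = w) (hj : w * e n q j = w) (l : ZMod (n + 1)) :
    (basis n q).repr w (l, 0, 0) = 0 := by
  by_cases h : l = i
  · rw [← hj]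
    exact coord_mul_e_of_ne w (h ▸ hij)
  · rw [← hi, coord_e_mul, if_neg h]

end Lambda

/-! ### The identification of `B_q` with `e_0 Λ_q e_0` -/

variable {k : Type u} [Field k] {n : ℕ} {q ζ : k}

theorem QuantumPlane.v_mul_u_pow (a : ℕ) : QuantumPlane.v q * QuantumPlane.u q ^ a =
    q ^ a • (QuantumPlane.u q ^ a * QuantumPlane.v q) := by
  induction a with
  | zero => simp
  | succ a ih =>
    rw [pow_succ (QuantumPlane.u q), ← mul_assoc, ih, smul_mul_assoc, mul_assoc,
      QuantumPlane.v_mul_u, mul_smul_comm, smul_smul, ← mul_assoc, pow_succ]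

/-- The element `u^a v^b` of the quantum plane. -/
def QuantumPlane.monomial (q : k) (m : ℕ × ℕ) : QuantumPlane q :=
  QuantumPlane.u q ^ m.1 * QuantumPlane.v q ^ m.2

theorem QuantumPlane.u_mul_monomial (a b : ℕ) :
    QuantumPlane.u q * QuantumPlane.monomial q (a, b) = QuantumPlane.monomial q (a + 1, b) := by
  simp only [QuantumPlane.monomial, pow_succ' (QuantumPlane.u q), mul_assoc]

theorem QuantumPlane.v_mul_monomial (a b : ℕ) :
    QuantumPlane.v q * QuantumPlane.monomial q (a, b) =
      q ^ a • QuantumPlane.monomial q (a, b + 1) := by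
  simp only [QuantumPlane.monomial]
  rw [← mul_assoc, QuantumPlane.v_mul_u_pow, smul_mul_assoc, mul_assoc,
    pow_succ' (QuantumPlane.v q)]

theorem QuantumPlane.monomial_mul_monomial (m m' : ℕ × ℕ) :
    QuantumPlane.monomial q m * QuantumPlane.monomial q m' =
      q ^ (m.2 * m'.1) • QuantumPlane.monomial q (m + m') := by
  obtain ⟨a, b⟩ := m
  obtain ⟨c, d⟩ := m'
  have hv : ∀ b d, QuantumPlane.v q ^ b * QuantumPlane.monomial q (c, d) =
      q ^ (b * c) • QuantumPlane.monomial q (c, b + d) := fun b => by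
    induction b with
    | zero => simp
    | succ b ih =>
      intro d
      rw [pow_succ, mul_assoc, QuantumPlane.v_mul_monomial, mul_smul_comm, ih, smul_smul,
        ← pow_add]
      congr 2
      · ring
      · ext <;> simp; ring
  have hu : ∀ a c d, QuantumPlane.u q ^ a * QuantumPlane.monomial q (c, d) =
      QuantumPlane.monomial q (a + c, d) := fun a => by
    induction a with
    | zero => simp
    | succ a ih =>
      intro c d
      rw [pow_succ, mul_assoc, QuantumPlane.u_mul_monomial, ih]
      congr 2
      ring
  rw [QuantumPlane.monomial, mul_assoc, hv, mul_smul_comm, hu, Prod.mk_add_mk]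

theorem QuantumPlane.span_monomial :
    Submodule.span k (Set.range (QuantumPlane.monomial q)) = ⊤ := by
  refine Submodule.eq_top_iff'.2 fun x => ?_
  have hmul : ∀ m : ℕ × ℕ, ∀ y ∈ Submodule.span k (Set.range (QuantumPlane.monomial q)),
      QuantumPlane.monomial q m * y ∈ Submodule.span k (Set.range (QuantumPlane.monomial q)) := by
    intro m y hy
    induction hy using Submodule.span_induction with
    | mem y hy =>
      obtain ⟨m', rfl⟩ := hy
      rw [QuantumPlane.monomial_mul_monomial]
      exact Submodule.smul_mem _ _ (Submodule.subset_span ⟨_, rfl⟩)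
    | zero => simp
    | add x y _ _ hx hy => rw [mul_add]; exact add_mem hx hy
    | smul c x _ hx => rw [mul_smul_comm]; exact Submodule.smul_mem _ _ hx
  suffices h : ∀ y ∈ Submodule.span k (Set.range (QuantumPlane.monomial q)),
      x * y ∈ Submodule.span k (Set.range (QuantumPlane.monomial q)) by
    rw [← mul_one x]
    exact h 1 (Submodule.subset_span ⟨0, by simp [QuantumPlane.monomial]⟩)
  induction x using QuantumPlane.induction with
  | halg c =>
    intro y hy
    rw [← Algebra.smul_def]
    exact Submodule.smul_mem _ _ hy
  | hu => simpa [QuantumPlane.monomial] using hmul (1, 0)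
  | hv => simpa [QuantumPlane.monomial] using hmul (0, 1)
  | hadd a b ha hb =>
    intro y hy
    rw [add_mul]
    exact add_mem (ha y hy) (hb y hy)
  | hmul a b ha hb =>
    intro y hy
    rw [mul_assoc]
    exact ha _ (hb y hy)

theorem Lambda.e_mul_ofPlane_monomial (i : ZMod (n + 1)) (m : ℕ × ℕ) :
    Lambda.e n q i * Lambda.ofPlane n q (QuantumPlane.monomial q m) =
      Lambda.monomial n q (i, m) := by
  simp [QuantumPlane.monomial, Lambda.monomial, Lambda.u, Lambda.v, mul_assoc]

/-- Multiplication by e_i sends the monomials u^a v^b, which span A_q, to distinct basis elements of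
Λ, so no nonzero combination of them is killed. -/
theorem Lambda.eq_zero_of_e_mul_ofPlane {x : QuantumPlane q} (i : ZMod (n + 1))
    (h : Lambda.e n q i * Lambda.ofPlane n q x = 0) : x = 0 := by
  have hx : x ∈ Submodule.span k (Set.range (QuantumPlane.monomial q)) := by
    rw [QuantumPlane.span_monomial]
    trivial
  obtain ⟨c, rfl⟩ := Finsupp.mem_span_range_iff_exists_finsupp.1 hx
  have hli : LinearIndependent k (fun m : ℕ × ℕ => Lambda.monomial n q (i, m)) :=
    (Lambda.linearIndependent_monomial n q).comp _ (Prod.mk_right_injective i)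
  have h0 : Finsupp.linearCombination k (fun m : ℕ × ℕ => Lambda.monomial n q (i, m)) c = 0 := by
    rw [← h, Finsupp.sum, map_sum, Finset.mul_sum, Finsupp.linearCombination_apply, Finsupp.sum]
    refine Finset.sum_congr rfl fun m _ => ?_
    rw [map_smul, mul_smul_comm, Lambda.e_mul_ofPlane_monomial]
  rw [(linearIndependent_iff.1 hli) c h0]
  simp

theorem generatorAction_monomial (m : ℕ × ℕ) :
    generatorAction q ζ (QuantumPlane.monomial q m) =
      (ζ ^ m.1 * (ζ⁻¹) ^ m.2) • QuantumPlane.monomial q m := by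
  simp [generatorAction, QuantumPlane.monomial, smul_pow, smul_smul, mul_comm]

theorem monomial_mem_invariantSubalgebra (hζ : IsPrimitiveRoot ζ (n + 1)) {a b : ℕ}
    (h : (a : ZMod (n + 1)) = b) :
    QuantumPlane.monomial q (a, b) ∈ invariantSubalgebra q ζ := by
  change generatorAction q ζ _ = _
  have hζ0 : ζ ≠ 0 := hζ.ne_zero (Nat.succ_ne_zero n)
  have hab : ζ ^ a = ζ ^ b := by
    rw [ZMod.natCast_eq_natCast_iff'] at h
    rw [← pow_mod_orderOf, ← pow_mod_orderOf ζ b, ← hζ.eq_orderOf, h]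
  rw [generatorAction_monomial]
  dsimp only
  rw [hab, ← mul_pow, mul_inv_cancel₀ hζ0, one_pow, one_smul]
  rfl

/-- Every element of `e_0 Λ_q e_0` has the form `e_0 b` with `b ∈ B_q`. -/
theorem Lambda.exists_e_mul_ofB_eq (hζ : IsPrimitiveRoot ζ (n + 1)) (x : Lambda n q) :
    ∃ b : B q ζ, Lambda.e n q 0 * Lambda.ofB n q ζ b = Lambda.e n q 0 * x * Lambda.e n q 0 := by
  have hx : x ∈ Submodule.span k (Set.range (Lambda.monomial n q)) := by
    rw [Lambda.span_monomial]
    trivial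
  induction hx using Submodule.span_induction with
  | mem x hx =>
    obtain ⟨⟨i, a, b⟩, rfl⟩ := hx
    rw [Lambda.e_mul_monomial]
    split_ifs with hi
    · subst hi
      rw [Lambda.monomial_mul_e]
      -- The path e_0 u^a v^b ends at the vertex a - b. It is closed exactly if a ≡ b modulo n + 1,
      -- and then u^a v^b is invariant.
      split_ifs with hab
      · have hab' : (a : ZMod (n + 1)) = b := by
          rw [zero_add, eq_comm, sub_eq_zero] at hab
          exact hab.symm
        exact ⟨⟨_, monomial_mem_invariantSubalgebra hζ hab'⟩, Lambda.e_mul_ofPlane_monomial 0 (a, b)⟩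
      · exact ⟨0, by simp⟩
    · exact ⟨0, by simp⟩
  | zero => exact ⟨0, by simp⟩
  | add x y _ _ hx hy =>
    obtain ⟨b, hb⟩ := hx
    obtain ⟨c, hc⟩ := hy
    exact ⟨b + c, by rw [map_add, mul_add, hb, hc, mul_add, add_mul]⟩
  | smul c x _ hx =>
    obtain ⟨b, hb⟩ := hx
    exact ⟨c • b, by rw [map_smul, mul_smul_comm, hb, mul_smul_comm, smul_mul_assoc]⟩

theorem Lambda.ofB_injective_corner {b b' : B q ζ}
    (h : Lambda.e n q 0 * Lambda.ofB n q ζ b = Lambda.e n q 0 * Lambda.ofB n q ζ b') : b = b' := by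
  have hsub : Lambda.e n q 0 * Lambda.ofPlane n q ((b - b' : B q ζ) : QuantumPlane q) = 0 := by
    change Lambda.e n q 0 * Lambda.ofB n q ζ (b - b') = 0
    rw [map_sub, mul_sub, h, sub_self]
  exact sub_eq_zero.1 (Subtype.ext (Lambda.eq_zero_of_e_mul_ofPlane 0 hsub))

/-! ### Noetherianity -/

/-- The span of the monomials that are smaller than `m` in the lexicographic order. -/
def QuantumPlane.below (q : k) (m : ℕ ×ₗ ℕ) : Submodule k (QuantumPlane q) :=
  Submodule.span k ((fun m => QuantumPlane.monomial q (ofLex m)) '' Set.Iio m)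

theorem QuantumPlane.exists_leading (x : QuantumPlane q) (hx : x ≠ 0) :
    ∃ (m : ℕ ×ₗ ℕ) (c : k), c ≠ 0 ∧
      x - c • QuantumPlane.monomial q (ofLex m) ∈ QuantumPlane.below q m := by
  have h : x ∈ Submodule.span k (Set.range fun m : ℕ ×ₗ ℕ => QuantumPlane.monomial q (ofLex m)) := by
    have : Set.range (fun m : ℕ ×ₗ ℕ => QuantumPlane.monomial q (ofLex m)) =
        Set.range (QuantumPlane.monomial q) :=
      (ofLex (α := ℕ × ℕ)).surjective.range_comp (QuantumPlane.monomial q)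
    rw [this, QuantumPlane.span_monomial]
    trivial
  obtain ⟨l, rfl⟩ := Finsupp.mem_span_range_iff_exists_finsupp.1 h
  have hl : l.support.Nonempty := by
    rw [Finset.nonempty_iff_ne_empty]
    intro h0
    rw [Finsupp.support_eq_empty] at h0
    subst h0
    simp at hx
  refine ⟨l.support.max' hl, l (l.support.max' hl),
    Finsupp.mem_support_iff.1 (l.support.max'_mem hl), ?_⟩
  rw [Finsupp.sum, ← Finset.add_sum_erase _ _ (l.support.max'_mem hl), add_sub_cancel_left]
  refine Submodule.sum_mem _ fun m hm => Submodule.smul_mem _ _ (Submodule.subset_span ⟨m, ?_, rfl⟩)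
  exact lt_of_le_of_ne (l.support.le_max' m (Finset.mem_of_mem_erase hm)) (Finset.ne_of_mem_erase hm)

/-- The leading exponent is itself smaller than `m₀`; this is what makes the division in the proof
of noetherianity terminate. -/
theorem QuantumPlane.exists_leading_of_mem_below {x : QuantumPlane q} {m₀ : ℕ ×ₗ ℕ}
    (h : x ∈ QuantumPlane.below q m₀) (hx : x ≠ 0) :
    ∃ m < m₀, ∃ c : k, c ≠ 0 ∧
      x - c • QuantumPlane.monomial q (ofLex m) ∈ QuantumPlane.below q m := by
  obtain ⟨l, hls, rfl⟩ := (Finsupp.mem_span_image_iff_linearCombination k).1 h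
  rw [Finsupp.linearCombination_apply] at hx ⊢
  have hl : l.support.Nonempty := by
    rw [Finset.nonempty_iff_ne_empty]
    intro h0
    rw [Finsupp.support_eq_empty] at h0
    subst h0
    simp at hx
  refine ⟨l.support.max' hl, hls (l.support.max'_mem hl), l (l.support.max' hl),
    Finsupp.mem_support_iff.1 (l.support.max'_mem hl), ?_⟩
  rw [Finsupp.sum, ← Finset.add_sum_erase _ _ (l.support.max'_mem hl), add_sub_cancel_left]
  refine Submodule.sum_mem _ fun m hm => Submodule.smul_mem _ _ (Submodule.subset_span ⟨m, ?_, rfl⟩)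
  exact lt_of_le_of_ne (l.support.le_max' m (Finset.mem_of_mem_erase hm)) (Finset.ne_of_mem_erase hm)

/-- Exponents add under multiplication, up to a power of q, and the lexicographic order is
compatible with addition. -/
theorem QuantumPlane.mul_monomial_mem_below {x : QuantumPlane q} {m : ℕ ×ₗ ℕ}
    (h : x ∈ QuantumPlane.below q m) (m' : ℕ × ℕ) :
    x * QuantumPlane.monomial q m' ∈ QuantumPlane.below q (m + toLex m') := by
  induction h using Submodule.span_induction with
  | mem x hx =>
    obtain ⟨m₁, hm₁, rfl⟩ := hx
    rw [QuantumPlane.monomial_mul_monomial]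
    exact Submodule.smul_mem _ _ (Submodule.subset_span
      ⟨m₁ + toLex m', add_lt_add_left (α := ℕ ×ₗ ℕ) hm₁ _, rfl⟩)
  | zero => simp
  | add x y _ _ hx hy => rw [add_mul]; exact add_mem hx hy
  | smul c x _ hx => rw [smul_mul_assoc]; exact Submodule.smul_mem _ _ hx

/-- The quantum plane is right noetherian. -/
theorem QuantumPlane.isNoetherian (hq : q ≠ 0) :
    IsNoetherian (QuantumPlane q)ᵐᵒᵖ (QuantumPlane q) := by
  refine ⟨fun I => ?_⟩
  have hIsmul : ∀ (c : k) {x}, x ∈ I → c • x ∈ I := fun c x hx => by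
    have := I.smul_mem (op (algebraMap k _ c)) hx
    rwa [op_smul_eq_mul, ← Algebra.commutes, ← Algebra.smul_def] at this
  -- The exponents that occur as leading exponents of monic elements of the right ideal I.
  let S : Set (ℕ × ℕ) := {m | ∃ x ∈ I,
    x - QuantumPlane.monomial q m ∈ QuantumPlane.below q (toLex m)}
  -- Dickson's lemma: in the product order ℕ × ℕ is well-quasi-ordered, so S has finitely many
  -- minimal elements, each a leading exponent of some `f m`. These `f m` generate I.
  have hS : S.IsPWO := Set.isPWO_of_wellQuasiOrderedLE S
  have hfin : {m | Minimal (· ∈ S) m}.Finite :=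
    (setOfPred_minimal_antichain _).finite_of_partiallyWellOrderedOn (hS.mono fun m hm => hm.1)
  choose! f hfI hf using fun m (hm : m ∈ S) => hm
  let J : Submodule (QuantumPlane q)ᵐᵒᵖ (QuantumPlane q) :=
    Submodule.span _ (f '' {m | Minimal (· ∈ S) m})
  have hJI : J ≤ I := Submodule.span_le.2 (by rintro _ ⟨m, hm, rfl⟩; exact hfI m hm.1)
  -- Division by the chosen elements, by induction on the leading exponent in the lexicographic
  -- order, which is well founded.
  have key : ∀ m : ℕ ×ₗ ℕ, ∀ x ∈ I, ∀ c : k, c ≠ 0 →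
      x - c • QuantumPlane.monomial q (ofLex m) ∈ QuantumPlane.below q m → x ∈ J := by
    intro m
    induction m using WellFoundedLT.induction with
    | ind m ih =>
      intro x hx c hc hxm
      have hmS : ofLex m ∈ S := ⟨c⁻¹ • x, hIsmul _ hx, by
        have := Submodule.smul_mem _ c⁻¹ hxm
        rwa [smul_sub, smul_smul, inv_mul_cancel₀ hc, one_smul] at this⟩
      obtain ⟨m₀, hle, hmin⟩ := hS.exists_le_minimal hmS
      obtain ⟨d, hd⟩ := le_iff_exists_add.1 hle
      have h₀ := QuantumPlane.mul_monomial_mem_below (hf m₀ hmin.1) d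
      rw [sub_mul, QuantumPlane.monomial_mul_monomial, ← hd] at h₀
      -- The scalar that appears when v^{m₀.2} moves past u^{d.1}. It must be invertible to cancel
      -- the leading term of x.
      set p := q ^ (m₀.2 * d.1)
      have hp : p ≠ 0 := pow_ne_zero _ hq
      have hmd : toLex m₀ + toLex d = m := congrArg toLex hd.symm
      rw [hmd] at h₀
      have hgJ : f m₀ * QuantumPlane.monomial q d ∈ J :=
        J.smul_mem (op (QuantumPlane.monomial q d)) (Submodule.subset_span ⟨m₀, hmin, rfl⟩)
      have hJsmul : ∀ (c : k) {x}, x ∈ J → c • x ∈ J := fun c x hx => by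
        have := J.smul_mem (op (algebraMap k _ c)) hx
        rwa [op_smul_eq_mul, ← Algebra.commutes, ← Algebra.smul_def] at this
      have hr : x - (c * p⁻¹) • (f m₀ * QuantumPlane.monomial q d) ∈ QuantumPlane.below q m := by
        have := Submodule.sub_mem _ hxm (Submodule.smul_mem _ (c * p⁻¹) h₀)
        rw [smul_sub, smul_smul, mul_assoc, inv_mul_cancel₀ hp, mul_one] at this
        simpa using this
      have hrJ : x - (c * p⁻¹) • (f m₀ * QuantumPlane.monomial q d) ∈ J := by
        by_cases h0 : x - (c * p⁻¹) • (f m₀ * QuantumPlane.monomial q d) = 0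
        · rw [h0]
          exact zero_mem _
        · obtain ⟨m', hm', c', hc', h'⟩ := QuantumPlane.exists_leading_of_mem_below hr h0
          exact ih m' hm' _ (sub_mem hx (hIsmul _ (hJI hgJ))) c' hc' h'
      simpa using add_mem hrJ (hJsmul (c * p⁻¹) hgJ)
  have hIJ : I = J := le_antisymm (fun x hx => by
    by_cases h0 : x = 0
    · rw [h0]
      exact zero_mem _
    · obtain ⟨m, c, hc, h⟩ := QuantumPlane.exists_leading x h0
      exact key m x hx c hc h) hJI
  rw [hIJ]
  exact Submodule.fg_span (hfin.image f)

/-- The e_i generate Λ as a right A_q-module, which transports noetherianity from A_q to Λ. -/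
theorem Lambda.exists_eq_sum_e_mul_ofPlane (x : Lambda n q) :
    ∃ a : ZMod (n + 1) → QuantumPlane q, ∑ i, Lambda.e n q i * Lambda.ofPlane n q (a i) = x := by
  have hx : x ∈ Submodule.span k (Set.range (Lambda.monomial n q)) := by
    rw [Lambda.span_monomial]
    trivial
  induction hx using Submodule.span_induction with
  | mem x hx =>
    obtain ⟨⟨i, m⟩, rfl⟩ := hx
    refine ⟨Pi.single i (QuantumPlane.monomial q m), ?_⟩
    rw [Finset.sum_eq_single i, Pi.single_eq_same, Lambda.e_mul_ofPlane_monomial]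
    · intro j _ hj
      simp [Pi.single_eq_of_ne hj]
    · simp
  | zero => exact ⟨0, by simp⟩
  | add x y _ _ hx hy =>
    obtain ⟨b, hb⟩ := hx
    obtain ⟨c, hc⟩ := hy
    exact ⟨b + c, by simp [mul_add, Finset.sum_add_distrib, hb, hc]⟩
  | smul c x _ hx =>
    obtain ⟨b, hb⟩ := hx
    exact ⟨c • b, by simp [← Finset.smul_sum, hb]⟩

/-- `Λ_q` is right noetherian. -/
theorem Lambda.isNoetherianRing_op (hq : q ≠ 0) : IsNoetherianRing (Lambda n q)ᵐᵒᵖ := by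
  have := QuantumPlane.isNoetherian hq
  let : Module (QuantumPlane q)ᵐᵒᵖ (Lambda n q)ᵐᵒᵖ :=
    Module.compHom _ (Lambda.ofPlane n q).toRingHom.op
  have hsmul : ∀ (a : (QuantumPlane q)ᵐᵒᵖ) (x : (Lambda n q)ᵐᵒᵖ),
      a • x = op (Lambda.ofPlane n q a.unop) * x := fun _ _ => rfl
  have : IsScalarTower (QuantumPlane q)ᵐᵒᵖ (Lambda n q)ᵐᵒᵖ (Lambda n q)ᵐᵒᵖ :=
    ⟨fun a x y => by rw [hsmul, hsmul, smul_eq_mul, smul_eq_mul, mul_assoc]⟩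
  let φ : (ZMod (n + 1) → QuantumPlane q) →ₗ[(QuantumPlane q)ᵐᵒᵖ] (Lambda n q)ᵐᵒᵖ :=
    { toFun := fun a => op (∑ i, Lambda.e n q i * Lambda.ofPlane n q (a i))
      map_add' := fun a b => by simp [mul_add, Finset.sum_add_distrib]
      map_smul' := fun c a => by
        rw [RingHom.id_apply, hsmul, ← op_mul, Finset.sum_mul]
        simp [mul_assoc] }
  have hφ : Function.Surjective φ := fun x => by
    obtain ⟨a, ha⟩ := Lambda.exists_eq_sum_e_mul_ofPlane x.unop
    exact ⟨a, congrArg op ha⟩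
  have : IsNoetherian (QuantumPlane q)ᵐᵒᵖ (Lambda n q)ᵐᵒᵖ :=
    isNoetherian_of_surjective φ (LinearMap.range_eq_top.2 hφ)
  exact isNoetherian_of_tower (QuantumPlane q)ᵐᵒᵖ this

end

end QuantumKleinian

namespace QuantumKleinian

noncomputable section

/-! ### Projective resolutions of length two -/

section Resolution

variable {R : Type u} [Ring R] {M P₀ P₁ P₂ : Type u} [AddCommGroup M] [Module R M]
  [AddCommGroup P₀] [Module R P₀] [AddCommGroup P₁] [Module R P₁] [AddCommGroup P₂] [Module R P₂]

/-- The terms of the complex `P₂ ⟶ P₁ ⟶ P₀`, extended by zero. -/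
def threeTermX (R : Type u) [Ring R] (P₀ P₁ P₂ : Type u) [AddCommGroup P₀] [Module R P₀]
    [AddCommGroup P₁] [Module R P₁] [AddCommGroup P₂] [Module R P₂] : ℕ → ModuleCat.{u} R
  | 0 => ModuleCat.of R P₀
  | 1 => ModuleCat.of R P₁
  | 2 => ModuleCat.of R P₂
  | _ + 3 => ModuleCat.of R PUnit.{u + 1}

/-- The differentials of the complex `P₂ ⟶ P₁ ⟶ P₀`, extended by zero. -/
def threeTermD (d₁ : P₁ →ₗ[R] P₀) (d₂ : P₂ →ₗ[R] P₁) :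
    ∀ i : ℕ, threeTermX R P₀ P₁ P₂ (i + 1) ⟶ threeTermX R P₀ P₁ P₂ i
  | 0 => ModuleCat.ofHom d₁
  | 1 => ModuleCat.ofHom d₂
  | _ + 2 => 0

/-- The complex `P₂ ⟶ P₁ ⟶ P₀`, extended by zero. -/
def threeTermComplex (d₁ : P₁ →ₗ[R] P₀) (d₂ : P₂ →ₗ[R] P₁) (h : d₁ ∘ₗ d₂ = 0) :
    ChainComplex (ModuleCat.{u} R) ℕ :=
  ChainComplex.of (threeTermX R P₀ P₁ P₂) (threeTermD d₁ d₂) fun i => by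
    match i with
    | 0 =>
      ext x
      exact DFunLike.congr_fun h x
    | 1 => exact zero_comp
    | _ + 2 => exact zero_comp

theorem isZero_threeTermX (i : ℕ) : IsZero (threeTermX R P₀ P₁ P₂ (i + 3)) :=
  ModuleCat.isZero_of_subsingleton (ModuleCat.of R PUnit.{u + 1})

theorem threeTermComplex_d (d₁ : P₁ →ₗ[R] P₀) (d₂ : P₂ →ₗ[R] P₁) (h : d₁ ∘ₗ d₂ = 0) (i : ℕ) :
    (threeTermComplex d₁ d₂ h).d (i + 1) i = threeTermD d₁ d₂ i :=
  ChainComplex.of_d _ _ _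

theorem threeTermComplex_exactAt (d₁ : P₁ →ₗ[R] P₀) (d₂ : P₂ →ₗ[R] P₁) (h : d₁ ∘ₗ d₂ = 0)
    (h₂ : Function.Injective d₂) (h₁ : ∀ y, d₁ y = 0 → ∃ t, d₂ t = y) (i : ℕ) :
    (threeTermComplex d₁ d₂ h).ExactAt (i + 1) := by
  rw [HomologicalComplex.exactAt_iff' _ (i + 2) (i + 1) i (by simp) (by simp),
    ShortComplex.moduleCat_exact_iff]
  intro x hx
  change (threeTermComplex d₁ d₂ h).d (i + 1) i x = 0 at hx
  change ∃ y, (threeTermComplex d₁ d₂ h).d (i + 2) (i + 1) y = x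
  rw [threeTermComplex_d] at hx
  rw [threeTermComplex_d]
  match i with
  | 0 => exact h₁ x hx
  | 1 => exact ⟨0, (map_zero _).trans (h₂ (hx.trans (map_zero d₂).symm)).symm⟩
  | i + 2 =>
    have := ModuleCat.subsingleton_of_isZero (isZero_threeTermX (R := R) (P₀ := P₀) (P₁ := P₁)
      (P₂ := P₂) i)
    exact ⟨0, this.elim _ _⟩

theorem exists_projectiveResolution_of_exact [Module.Projective R P₀] [Module.Projective R P₁]
    [Module.Projective R P₂] [Module.Finite R P₀] [Module.Finite R P₁] [Module.Finite R P₂]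
    (π : P₀ →ₗ[R] M) (d₁ : P₁ →ₗ[R] P₀) (d₂ : P₂ →ₗ[R] P₁) (hπ : Function.Surjective π)
    (h : d₁ ∘ₗ d₂ = 0) (h' : π ∘ₗ d₁ = 0) (h₂ : Function.Injective d₂)
    (h₁ : ∀ y, d₁ y = 0 → ∃ t, d₂ t = y) (h₀ : ∀ y, π y = 0 → ∃ t, d₁ t = y) :
    ∃ Q : ProjectiveResolution (ModuleCat.of R M),
      (∃ N : ℕ, ∀ i, N < i → IsZero (Q.complex.X i)) ∧ ∀ i, Module.Finite R (Q.complex.X i) := by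
  have hproj : ∀ i, Module.Projective R (threeTermX R P₀ P₁ P₂ i)
    | 0 => ‹Module.Projective R P₀›
    | 1 => ‹Module.Projective R P₁›
    | 2 => ‹Module.Projective R P₂›
    | _ + 3 => inferInstanceAs (Module.Projective R PUnit.{u + 1})
  have hfin : ∀ i, Module.Finite R (threeTermX R P₀ P₁ P₂ i)
    | 0 => ‹Module.Finite R P₀›
    | 1 => ‹Module.Finite R P₁›
    | 2 => ‹Module.Finite R P₂›
    | _ + 3 => inferInstanceAs (Module.Finite R PUnit.{u + 1})
  refine ⟨{ complex := threeTermComplex d₁ d₂ h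
            projective := fun i => (IsProjective.iff_projective _).1 (hproj i)
            π := (ChainComplex.toSingle₀Equiv _ _).symm ⟨ModuleCat.ofHom π, ?_⟩
            quasiIso := ⟨fun i => ?_⟩ }, ⟨2, fun i hi => ?_⟩, hfin⟩
  · rw [threeTermComplex_d]
    ext x
    exact DFunLike.congr_fun h' x
  · cases i with
    | zero =>
      -- In degree 0 a quasi-isomorphism means exactness of P₁ → P₀ → M → 0.
      rw [ChainComplex.quasiIsoAt₀_iff, ShortComplex.quasiIso_iff_of_zeros']
      · refine ⟨?_, ?_⟩
        · rw [ShortComplex.moduleCat_exact_iff]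
          intro x hx
          obtain ⟨t, ht⟩ := h₀ x ((DFunLike.congr_fun (congrArg ModuleCat.Hom.hom
            (ChainComplex.toSingle₀Equiv_symm_apply_f_zero (C := threeTermComplex d₁ d₂ h)
              (X := ModuleCat.of R M) (ModuleCat.ofHom π) _)) x).symm.trans hx)
          refine ⟨t, ?_⟩
          change (threeTermComplex d₁ d₂ h).d 1 0 t = x
          rw [threeTermComplex_d]
          exact ht
        · rw [ModuleCat.epi_iff_surjective]
          intro m
          obtain ⟨x, hx⟩ := hπ m
          exact ⟨x, (DFunLike.congr_fun (congrArg ModuleCat.Hom.hom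
            (ChainComplex.toSingle₀Equiv_symm_apply_f_zero (C := threeTermComplex d₁ d₂ h)
              (X := ModuleCat.of R M) (ModuleCat.ofHom π) _)) x).trans hx⟩
      all_goals rfl
    | succ i =>
      rw [quasiIsoAt_iff_exactAt']
      · exact threeTermComplex_exactAt d₁ d₂ h h₂ h₁ i
      · apply ChainComplex.exactAt_succ_single_obj
  · obtain ⟨j, rfl⟩ := Nat.exists_eq_add_of_lt hi
    rw [show 2 + j + 1 = j + 3 by ring]
    exact isZero_threeTermX (R := R) (P₀ := P₀) (P₁ := P₁) (P₂ := P₂) j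

/-- The left ideal `R ε` for an idempotent `ε`. -/
def idempotentIdeal (ε : R) : Submodule R R where
  carrier := {x | x * ε = x}
  zero_mem' := by simp
  add_mem' {x y} hx hy := by
    change (_ + _) * _ = _
    rw [add_mul]
    exact congrArg₂ (· + ·) hx hy
  smul_mem' c x hx := by
    change c * x * _ = c * x
    rw [mul_assoc]
    exact congrArg (c * ·) hx

/-- The projection of `R` to `R ε`. -/
def toIdempotentIdeal {ε : R} (hε : ε * ε = ε) : R →ₗ[R] idempotentIdeal ε where
  toFun x := ⟨x * ε, show x * ε * ε = x * ε by rw [mul_assoc, hε]⟩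
  map_add' x y := Subtype.ext (add_mul x y ε)
  map_smul' c x := Subtype.ext (mul_assoc c x ε)

theorem toIdempotentIdeal_subtype {ε : R} (hε : ε * ε = ε) :
    toIdempotentIdeal hε ∘ₗ (idempotentIdeal ε).subtype = LinearMap.id :=
  LinearMap.ext fun x => Subtype.ext x.2

theorem projective_idempotentIdeal {ε : R} (hε : ε * ε = ε) :
    Module.Projective R (idempotentIdeal ε) :=
  Module.Projective.of_split _ _ (toIdempotentIdeal_subtype hε)

theorem finite_idempotentIdeal {ε : R} (hε : ε * ε = ε) :
    Module.Finite R (idempotentIdeal ε) :=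
  Module.Finite.of_surjective (toIdempotentIdeal hε) fun x =>
    ⟨x.1, DFunLike.congr_fun (toIdempotentIdeal_subtype hε) x⟩

/-- Right multiplication by `c` as a map `R ε → R ε'`. -/
def idempotentIdealMul {ε ε' : R} (c : R) (h : ε * c = c * ε') :
    idempotentIdeal ε →ₗ[R] idempotentIdeal ε' where
  toFun x := ⟨x.1 * c, show x.1 * c * ε' = x.1 * c by
    have hx : x.1 * ε = x.1 := x.2
    rw [mul_assoc, ← h, ← mul_assoc, hx]⟩
  map_add' x y := Subtype.ext (add_mul _ _ _)
  map_smul' a x := Subtype.ext (mul_assoc _ _ _)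

end Resolution

/-! ### The Koszul resolution of the bimodule `Λ_q` -/

namespace Lambda

variable {k : Type u} [Field k] (n : ℕ) (q : k)

/-- The enveloping algebra of `Λ_q`. -/
abbrev Env : Type u := Lambda n q ⊗[k] (Lambda n q)ᵐᵒᵖ

/-- `u ⊗ 1` in the enveloping algebra. -/
def uLeft : Env n q := u n q ⊗ₜ 1

/-- `v ⊗ 1` in the enveloping algebra. -/
def vLeft : Env n q := v n q ⊗ₜ 1

/-- `1 ⊗ u` in the enveloping algebra. -/
def uRight : Env n q := 1 ⊗ₜ op (u n q)

/-- `1 ⊗ v` in the enveloping algebra. -/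
def vRight : Env n q := 1 ⊗ₜ op (v n q)

/-- The idempotent `∑ e_i ⊗ e_{i + s}` in the enveloping algebra. -/
def diag (s : ZMod (n + 1)) : Env n q := ∑ i, e n q i ⊗ₜ op (e n q (i + s))

theorem diag_mul_self (s : ZMod (n + 1)) : diag n q s * diag n q s = diag n q s := by
  rw [diag, Finset.sum_mul_sum]
  refine Finset.sum_congr rfl fun i _ => ?_
  rw [Finset.sum_eq_single i]
  · rw [Algebra.TensorProduct.tmul_mul_tmul, e_mul_self, ← op_mul, e_mul_self]
  · intro j _ hj
    rw [Algebra.TensorProduct.tmul_mul_tmul, e_mul_e n q hj.symm, TensorProduct.zero_tmul]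
  · simp

theorem vLeft_mul_uLeft : vLeft n q * uLeft n q = q • (uLeft n q * vLeft n q) := by
  simp [vLeft, uLeft, v_mul_u, TensorProduct.smul_tmul']

theorem uRight_mul_vRight : uRight n q * vRight n q = q • (vRight n q * uRight n q) := by
  simp only [vRight, uRight, Algebra.TensorProduct.tmul_mul_tmul, ← op_mul, v_mul_u, op_smul,
    TensorProduct.tmul_smul]

theorem uLeft_mul_vRight : uLeft n q * vRight n q = vRight n q * uLeft n q := by
  simp [uLeft, vRight]

theorem vLeft_mul_uRight : vLeft n q * uRight n q = uRight n q * vLeft n q := by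
  simp [vLeft, uRight]

/-- The four commutation rules for `diag` make the Koszul maps well defined: right multiplication by
u on either side maps the left ideal of `diag n q (s + 1)` to that of `diag n q s`, and v does the
opposite. -/
theorem diag_mul_uLeft (s : ZMod (n + 1)) :
    diag n q (s + 1) * uLeft n q = uLeft n q * diag n q s := by
  rw [diag, diag, Finset.sum_mul, Finset.mul_sum,
    ← Equiv.sum_comp (Equiv.addRight (1 : ZMod (n + 1)))
      (fun i => uLeft n q * e n q i ⊗ₜ op (e n q (i + s)))]
  refine Finset.sum_congr rfl fun i _ => ?_
  simp only [uLeft, Algebra.TensorProduct.tmul_mul_tmul, mul_one, one_mul, Equiv.coe_addRight,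
    e_mul_u, u_mul_e]
  congr 3
  ring

theorem diag_mul_vLeft (s : ZMod (n + 1)) :
    diag n q s * vLeft n q = vLeft n q * diag n q (s + 1) := by
  rw [diag, diag, Finset.sum_mul, Finset.mul_sum,
    ← Equiv.sum_comp (Equiv.addRight (1 : ZMod (n + 1)))
      (fun i => e n q i ⊗ₜ op (e n q (i + s)) * vLeft n q)]
  refine Finset.sum_congr rfl fun i _ => ?_
  simp only [vLeft, Algebra.TensorProduct.tmul_mul_tmul, mul_one, one_mul, Equiv.coe_addRight,
    e_mul_v, v_mul_e]
  congr 3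
  ring

theorem diag_mul_uRight (s : ZMod (n + 1)) :
    diag n q (s + 1) * uRight n q = uRight n q * diag n q s := by
  rw [diag, diag, Finset.sum_mul, Finset.mul_sum]
  refine Finset.sum_congr rfl fun i _ => ?_
  simp only [uRight, Algebra.TensorProduct.tmul_mul_tmul, mul_one, one_mul, ← op_mul, ← add_assoc,
    e_mul_u, u_mul_e]

theorem diag_mul_vRight (s : ZMod (n + 1)) :
    diag n q s * vRight n q = vRight n q * diag n q (s + 1) := by
  rw [diag, diag, Finset.sum_mul, Finset.mul_sum]
  refine Finset.sum_congr rfl fun i _ => ?_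
  simp only [vRight, Algebra.TensorProduct.tmul_mul_tmul, mul_one, one_mul, ← op_mul, ← add_assoc,
    e_mul_v, v_mul_e]

/-! ### Division in the enveloping algebra -/

variable {n q}

/-- The coordinates of an element of the enveloping algebra with respect to the monomial basis of
the left factor. -/
def envCoord (z : Env n q) (m : ZMod (n + 1) × ℕ × ℕ) : (Lambda n q)ᵐᵒᵖ :=
  TensorProduct.equivFinsuppOfBasisLeft (basis n q) z m

theorem envCoord_add (z z' : Env n q) (m : ZMod (n + 1) × ℕ × ℕ) :
    envCoord (z + z') m = envCoord z m + envCoord z' m := by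
  simp [envCoord]

theorem envCoord_sub (z z' : Env n q) (m : ZMod (n + 1) × ℕ × ℕ) :
    envCoord (z - z') m = envCoord z m - envCoord z' m := by
  simp [envCoord]

theorem envCoord_smul (c : k) (z : Env n q) (m : ZMod (n + 1) × ℕ × ℕ) :
    envCoord (c • z) m = c • envCoord z m := by
  simp [envCoord]

theorem envCoord_zero (m : ZMod (n + 1) × ℕ × ℕ) : envCoord (0 : Env n q) m = 0 := by
  simp [envCoord]

theorem envCoord_tmul (x : Lambda n q) (y : (Lambda n q)ᵐᵒᵖ) (m : ZMod (n + 1) × ℕ × ℕ) :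
    envCoord (x ⊗ₜ y) m = (basis n q).repr x m • y :=
  TensorProduct.equivFinsuppOfBasisLeft_apply_tmul_apply _ _ _ _

theorem envCoord_ext {z z' : Env n q} (h : ∀ i a b, envCoord z (i, a, b) = envCoord z' (i, a, b)) :
    z = z' :=
  (TensorProduct.equivFinsuppOfBasisLeft (basis n q)).injective
    (Finsupp.ext fun m => h m.1 m.2.1 m.2.2)

theorem envCoord_mul_vLeft_succ (z : Env n q) (i : ZMod (n + 1)) (a b : ℕ) :
    envCoord (z * vLeft n q) (i, a, b + 1) = envCoord z (i, a, b) := by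
  induction z using TensorProduct.induction_on with
  | zero => simp [envCoord_zero]
  | add x y hx hy => rw [add_mul, envCoord_add, hx, hy, envCoord_add]
  | tmul x y =>
    rw [vLeft, Algebra.TensorProduct.tmul_mul_tmul, envCoord_tmul, coord_mul_v_succ, mul_one,
      envCoord_tmul]

theorem envCoord_mul_uLeft_succ (z : Env n q) (i : ZMod (n + 1)) (a b : ℕ) :
    envCoord (z * uLeft n q) (i, a + 1, b) = q ^ b • envCoord z (i, a, b) := by
  induction z using TensorProduct.induction_on with
  | zero => simp [envCoord_zero]
  | add x y hx hy => rw [add_mul, envCoord_add, hx, hy, envCoord_add, smul_add]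
  | tmul x y =>
    rw [uLeft, Algebra.TensorProduct.tmul_mul_tmul, envCoord_tmul, coord_mul_u_succ, mul_one,
      envCoord_tmul, smul_smul]

theorem envCoord_mul_uLeft_zero (z : Env n q) (i : ZMod (n + 1)) (b : ℕ) :
    envCoord (z * uLeft n q) (i, 0, b) = 0 := by
  induction z using TensorProduct.induction_on with
  | zero => simp [envCoord_zero]
  | add x y hx hy => rw [add_mul, envCoord_add, hx, hy, add_zero]
  | tmul x y =>
    rw [uLeft, Algebra.TensorProduct.tmul_mul_tmul, envCoord_tmul, coord_mul_u_zero, zero_smul]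

theorem envCoord_mul_one_tmul (z : Env n q) (w : (Lambda n q)ᵐᵒᵖ) (m : ZMod (n + 1) × ℕ × ℕ) :
    envCoord (z * (1 : Lambda n q) ⊗ₜ w) m = envCoord z m * w := by
  induction z using TensorProduct.induction_on with
  | zero => simp [envCoord_zero]
  | add x y hx hy => rw [add_mul, envCoord_add, hx, hy, envCoord_add, add_mul]
  | tmul x y =>
    rw [Algebra.TensorProduct.tmul_mul_tmul, envCoord_tmul, mul_one, envCoord_tmul, smul_mul_assoc]

/-- The leading coefficient argument in the form used below: a recursion that expresses each
coefficient through the next one has no nonzero solution of finite support. -/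
theorem eq_zero_of_descending {M : Type*} [Zero M] (f : ℕ → M) (N : ℕ) (hN : ∀ b, N ≤ b → f b = 0)
    (h : ∀ b, f (b + 1) = 0 → f b = 0) (b : ℕ) : f b = 0 := by
  have : ∀ c b, N ≤ b + c → f b = 0 := fun c => by
    induction c with
    | zero => exact fun b hb => hN b hb
    | succ c ih => exact fun b hb => h b (ih (b + 1) (by lia))
  exact this N b (by lia)

theorem exists_envCoord_eq_zero (z : Env n q) :
    ∃ N : ℕ, ∀ i a b, N ≤ a ∨ N ≤ b → envCoord z (i, a, b) = 0 := by
  refine ⟨(TensorProduct.equivFinsuppOfBasisLeft (basis n q) z).support.sup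
    (fun m => max m.2.1 m.2.2) + 1, fun i a b hab => ?_⟩
  by_contra h
  have := Finset.le_sup (f := fun m : ZMod (n + 1) × ℕ × ℕ => max m.2.1 m.2.2)
    (Finsupp.mem_support_iff.2 h)
  dsimp only at this
  have h₁ := le_max_left a b
  have h₂ := le_max_right a b
  lia

/-- If t_b is the coefficient of t at e_i u^a v^b in the left factor, then t (v ⊗ 1 - q (1 ⊗ v)) has
the coefficient t_b - q t_{b+1} v at exponent b + 1, the product being that of the opposite algebra.
So t_{b+1} = 0 forces t_b = 0. -/
theorem env_eq_zero_of_mul_eq_zero {t : Env n q}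
    (h : t * (vLeft n q - q • vRight n q) = 0) : t = 0 := by
  obtain ⟨N, hN⟩ := exists_envCoord_eq_zero t
  refine envCoord_ext fun i a b => ?_
  rw [envCoord_zero]
  refine eq_zero_of_descending (fun b => envCoord t (i, a, b)) N (fun b hb => hN i a b (.inr hb))
    (fun b hb => ?_) b
  have := congrArg (fun z => envCoord z (i, a, b + 1)) h
  simp only [mul_sub, mul_smul_comm, envCoord_sub, envCoord_smul, envCoord_mul_vLeft_succ,
    vRight, envCoord_mul_one_tmul, envCoord_zero] at this
  rwa [show envCoord _ _ = 0 from hb, zero_mul, smul_zero, sub_zero] at this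

/-- Division with remainder by v ⊗ 1 - q (1 ⊗ v), which is monic of degree one in v ⊗ 1. The
remainder contains no v in the left factor. -/
theorem exists_envCoord_sub_eq_zero (y : Env n q) :
    ∃ t : Env n q, ∀ i a b, envCoord (y - t * (vLeft n q - q • vRight n q)) (i, a, b + 1) = 0 := by
  have hmon : ∀ (b : ℕ) (i : ZMod (n + 1)) (a : ℕ) (w : (Lambda n q)ᵐᵒᵖ), ∃ t : Env n q, ∀ j c d,
      envCoord (monomial n q (i, a, b) ⊗ₜ w - t * (vLeft n q - q • vRight n q)) (j, c, d + 1) =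
        0 := by
    intro b
    induction b with
    | zero =>
      refine fun i a w => ⟨0, fun j c d => ?_⟩
      rw [zero_mul, sub_zero, envCoord_tmul, repr_basis_monomial, if_neg (by simp), zero_smul]
    | succ b ih =>
      intro i a w
      -- Subtracting (e_i u^a v^b ⊗ w)(v ⊗ 1 - q (1 ⊗ v)) from e_i u^a v^{b+1} ⊗ w leaves q e_i u^a
      -- v^b ⊗ w v, of lower degree.
      obtain ⟨t, ht⟩ := ih i a (q • (w * op (v n q)))
      refine ⟨t + monomial n q (i, a, b) ⊗ₜ w, fun j c d => ?_⟩
      rw [← ht j c d]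
      congr 1
      rw [add_mul, mul_sub (_ ⊗ₜ _), vLeft, vRight, mul_smul_comm,
        Algebra.TensorProduct.tmul_mul_tmul, Algebra.TensorProduct.tmul_mul_tmul, monomial_mul_v,
        mul_one, mul_one, TensorProduct.tmul_smul]
      abel
  obtain ⟨f, rfl⟩ := (TensorProduct.equivFinsuppOfBasisLeft (basis n q)).symm.surjective y
  rw [TensorProduct.equivFinsuppOfBasisLeft_symm_apply]
  choose t ht using fun m : ZMod (n + 1) × ℕ × ℕ => hmon m.2.2 m.1 m.2.1 (f m)
  refine ⟨∑ m ∈ f.support, t m, fun i a b => ?_⟩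
  rw [Finsupp.sum, Finset.sum_mul, ← Finset.sum_sub_distrib]
  simp only [basis_apply]
  rw [envCoord, map_sum, Finsupp.finsetSum_apply]
  exact Finset.sum_eq_zero fun m _ => ht m i a b

/-- The left factors are the noncommutative partial derivatives of r = vu - quv. By the Leibniz rule
the sum is r ⊗ 1 - 1 ⊗ r, and r = 0 in Λ. -/
theorem env_koszul_comp :
    (vLeft n q - q • vRight n q) * (uLeft n q - uRight n q) +
      (uRight n q - q • uLeft n q) * (vLeft n q - vRight n q) = 0 := by
  simp only [sub_mul, mul_sub, smul_mul_assoc, vLeft_mul_uLeft, uRight_mul_vRight,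
    vLeft_mul_uRight, uLeft_mul_vRight]
  abel

/-- Subtract the boundary of t, where t divides y, so that y' has no v on the left. In degrees b + 1
of the equation for (y', z') only z' contributes, and descent in b gives z' = 0. Then y' (u ⊗ 1 - 1
⊗ u) = 0, and descent in the exponent of u gives y' = 0. -/
theorem exists_eq_of_env_koszul {y z : Env n q}
    (h : y * (uLeft n q - uRight n q) + z * (vLeft n q - vRight n q) = 0) :
    ∃ t : Env n q, t * (vLeft n q - q • vRight n q) = y ∧ t * (uRight n q - q • uLeft n q) = z := by
  obtain ⟨t, ht⟩ := exists_envCoord_sub_eq_zero y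
  set y' := y - t * (vLeft n q - q • vRight n q) with hy'
  set z' := z - t * (uRight n q - q • uLeft n q) with hz'
  have h' : y' * (uLeft n q - uRight n q) + z' * (vLeft n q - vRight n q) = 0 := by
    rw [hy', hz', sub_mul, sub_mul, sub_add_sub_comm, h, mul_assoc, mul_assoc, ← mul_add,
      env_koszul_comp, mul_zero, sub_zero]
  have hz0 : z' = 0 := by
    obtain ⟨N, hN⟩ := exists_envCoord_eq_zero z'
    refine envCoord_ext fun i a b => ?_
    rw [envCoord_zero]
    refine eq_zero_of_descending (fun b => envCoord z' (i, a, b)) N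
      (fun b hb => hN i a b (.inr hb)) (fun b hb => ?_) b
    have := congrArg (fun z => envCoord z (i, a, b + 1)) h'
    have hu : envCoord (y' * uLeft n q) (i, a, b + 1) = 0 := by
      cases a with
      | zero => exact envCoord_mul_uLeft_zero _ _ _
      | succ a => rw [envCoord_mul_uLeft_succ, ht, smul_zero]
    simp only [mul_sub, envCoord_add, envCoord_sub, envCoord_mul_vLeft_succ, hu,
      vRight, uRight, envCoord_mul_one_tmul, envCoord_zero, ht, zero_mul, sub_zero, zero_add]
      at this
    rwa [show envCoord _ _ = 0 from hb, zero_mul, sub_zero] at this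
  have hy0 : y' = 0 := by
    obtain ⟨N, hN⟩ := exists_envCoord_eq_zero y'
    refine envCoord_ext fun i a b => ?_
    rw [envCoord_zero]
    cases b with
    | succ b => exact ht i a b
    | zero =>
      refine eq_zero_of_descending (fun a => envCoord y' (i, a, 0)) N
        (fun a ha => hN i a 0 (.inl ha)) (fun a ha => ?_) a
      rw [hz0, zero_mul, add_zero] at h'
      have := congrArg (fun z => envCoord z (i, a + 1, 0)) h'
      simp only [mul_sub, envCoord_sub, envCoord_mul_uLeft_succ, pow_zero,
        one_smul, uRight, envCoord_mul_one_tmul, envCoord_zero] at this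
      rwa [show envCoord _ _ = 0 from ha, zero_mul, sub_zero] at this
  exact ⟨t, (sub_eq_zero.1 hy0).symm, (sub_eq_zero.1 hz0).symm⟩

-- The maps of the Koszul resolution and their exactness

attribute [local instance] instModuleTensorProductMop

theorem env_smul_def (x : Lambda n q) (y : (Lambda n q)ᵐᵒᵖ) (z : Lambda n q) :
    (x ⊗ₜ[k] y : Env n q) • z = x * (z * y.unop) :=
  TensorProduct.Algebra.smul_def x y z

theorem diag_zero_smul_one : diag n q 0 • (1 : Lambda n q) = 1 := by
  rw [diag, Finset.sum_smul]
  simp only [env_smul_def, add_zero, unop_op, one_mul, e_mul_self, sum_e]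

/-- The augmentation `Λ ⊗ Λ → Λ` on the bimodule `⊕ Λ e_i ⊗ e_i Λ`. -/
def augmentation (n : ℕ) (q : k) : idempotentIdeal (diag n q 0) →ₗ[Env n q] Lambda n q :=
  (LinearMap.toSpanSingleton (Env n q) (Lambda n q) 1).comp (idempotentIdeal (diag n q 0)).subtype

theorem augmentation_apply (x : idempotentIdeal (diag n q 0)) :
    augmentation n q x = x.1 • (1 : Lambda n q) := rfl

/-- The map `⊕ Λ e_i ⊗ e_{i+1} Λ ⊕ ⊕ Λ e_{i+1} ⊗ e_i Λ → ⊕ Λ e_i ⊗ e_i Λ` of the Koszul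
resolution. -/
def koszulOne (n : ℕ) (q : k) :
    (idempotentIdeal (diag n q 1) × idempotentIdeal (diag n q (-1))) →ₗ[Env n q]
      idempotentIdeal (diag n q 0) :=
  LinearMap.coprod
    (idempotentIdealMul (uLeft n q - uRight n q) (by
      have h₁ := diag_mul_uLeft n q 0
      have h₂ := diag_mul_uRight n q 0
      rw [zero_add] at h₁ h₂
      rw [mul_sub, sub_mul, h₁, h₂]))
    (idempotentIdealMul (vLeft n q - vRight n q) (by
      have h₁ := diag_mul_vLeft n q (-1)
      have h₂ := diag_mul_vRight n q (-1)
      rw [neg_add_cancel] at h₁ h₂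
      rw [mul_sub, sub_mul, h₁, h₂]))

/-- The map `⊕ Λ e_i ⊗ e_i Λ → ⊕ Λ e_i ⊗ e_{i+1} Λ ⊕ ⊕ Λ e_{i+1} ⊗ e_i Λ` of the Koszul
resolution. -/
def koszulTwo (n : ℕ) (q : k) : idempotentIdeal (diag n q 0) →ₗ[Env n q]
    (idempotentIdeal (diag n q 1) × idempotentIdeal (diag n q (-1))) :=
  LinearMap.prod
    (idempotentIdealMul (vLeft n q - q • vRight n q) (by
      have h₁ := diag_mul_vLeft n q 0
      have h₂ := diag_mul_vRight n q 0
      rw [zero_add] at h₁ h₂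
      rw [mul_sub, sub_mul, h₁, mul_smul_comm, h₂, smul_mul_assoc]))
    (idempotentIdealMul (uRight n q - q • uLeft n q) (by
      have h₁ := diag_mul_uLeft n q (-1)
      have h₂ := diag_mul_uRight n q (-1)
      rw [neg_add_cancel] at h₁ h₂
      rw [mul_sub, sub_mul, h₂, mul_smul_comm, h₁, smul_mul_assoc]))

theorem koszulOne_apply (y : idempotentIdeal (diag n q 1) × idempotentIdeal (diag n q (-1))) :
    (koszulOne n q y).1 = y.1.1 * (uLeft n q - uRight n q) + y.2.1 * (vLeft n q - vRight n q) := rfl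

theorem koszulTwo_fst (t : idempotentIdeal (diag n q 0)) :
    (koszulTwo n q t).1.1 = t.1 * (vLeft n q - q • vRight n q) := rfl

theorem koszulTwo_snd (t : idempotentIdeal (diag n q 0)) :
    (koszulTwo n q t).2.1 = t.1 * (uRight n q - q • uLeft n q) := rfl

/-- Modulo the image of `koszulOne`, `p ⊗ m` is congruent to `1 ⊗ p m`. -/
theorem tmul_mul_diag_sub_mem (p : Lambda n q) (m : (Lambda n q)ᵐᵒᵖ) :
    (p ⊗ₜ[k] m - 1 ⊗ₜ (m * op p)) * diag n q 0 ∈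
      (LinearMap.range (koszulOne n q)).map (idempotentIdeal (diag n q 0)).subtype := by
  have hu : ∀ z : Env n q, z * (uLeft n q - uRight n q) * diag n q 0 ∈
      (LinearMap.range (koszulOne n q)).map (idempotentIdeal (diag n q 0)).subtype := fun z => by
    refine ⟨_, ⟨(toIdempotentIdeal (diag_mul_self n q 1) z, 0), rfl⟩, ?_⟩
    have h₁ := diag_mul_uLeft n q 0
    have h₂ := diag_mul_uRight n q 0
    rw [zero_add] at h₁ h₂
    rw [Submodule.subtype_apply, koszulOne_apply]
    change z * diag n q 1 * _ + 0 * _ = _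
    rw [zero_mul, add_zero, mul_assoc, mul_assoc, mul_sub, sub_mul, h₁, h₂]
  have hv : ∀ z : Env n q, z * (vLeft n q - vRight n q) * diag n q 0 ∈
      (LinearMap.range (koszulOne n q)).map (idempotentIdeal (diag n q 0)).subtype := fun z => by
    refine ⟨_, ⟨(0, toIdempotentIdeal (diag_mul_self n q (-1)) z), rfl⟩, ?_⟩
    have h₁ := diag_mul_vLeft n q (-1)
    have h₂ := diag_mul_vRight n q (-1)
    rw [neg_add_cancel] at h₁ h₂
    rw [Submodule.subtype_apply, koszulOne_apply]
    change 0 * _ + z * diag n q (-1) * _ = _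
    rw [zero_mul, zero_add, mul_assoc, mul_assoc, mul_sub, sub_mul, h₁, h₂]
  -- For idempotents no boundary is needed: e_i ⊗ 1 and 1 ⊗ e_i have the same product with `diag n q
  -- 0`.
  have he : ∀ (i : ZMod (n + 1)) (m : (Lambda n q)ᵐᵒᵖ),
      (e n q i ⊗ₜ[k] m - 1 ⊗ₜ (m * op (e n q i))) * diag n q 0 = 0 := fun i m => by
    rw [diag, Finset.mul_sum]
    refine Finset.sum_eq_zero fun j _ => ?_
    rw [sub_mul, Algebra.TensorProduct.tmul_mul_tmul, Algebra.TensorProduct.tmul_mul_tmul, add_zero,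
      mul_assoc m, ← op_mul, one_mul, e_mul_e_ite, e_mul_e_ite]
    by_cases h : i = j
    · subst h
      simp
    · rw [if_neg h, if_neg (Ne.symm h)]
      simp
  -- Telescoping: p p' ⊗ m - 1 ⊗ p p' m is the sum of (p ⊗ 1)(p' ⊗ m - 1 ⊗ p' m) and p ⊗ p' m - 1 ⊗
  -- p p' m. So it suffices to treat e_i, u and v.
  have hmul : ∀ p p' : Lambda n q,
      (∀ m, (p ⊗ₜ[k] m - 1 ⊗ₜ (m * op p)) * diag n q 0 ∈
        (LinearMap.range (koszulOne n q)).map (idempotentIdeal (diag n q 0)).subtype) →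
      (∀ m, (p' ⊗ₜ[k] m - 1 ⊗ₜ (m * op p')) * diag n q 0 ∈
        (LinearMap.range (koszulOne n q)).map (idempotentIdeal (diag n q 0)).subtype) →
      ∀ m, ((p * p') ⊗ₜ[k] m - 1 ⊗ₜ (m * op (p * p'))) * diag n q 0 ∈
        (LinearMap.range (koszulOne n q)).map (idempotentIdeal (diag n q 0)).subtype := by
    intro p p' hp hp' m
    have h₁ := Submodule.smul_mem _ (p ⊗ₜ[k] (1 : (Lambda n q)ᵐᵒᵖ) : Env n q) (hp' m)
    have h₂ := add_mem h₁ (hp (m * op p'))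
    rw [smul_eq_mul, ← mul_assoc, ← add_mul, mul_sub, Algebra.TensorProduct.tmul_mul_tmul,
      Algebra.TensorProduct.tmul_mul_tmul, one_mul, one_mul, mul_one, sub_add_sub_cancel] at h₂
    rwa [op_mul, ← mul_assoc]
  have hgu : ∀ m, (u n q ⊗ₜ[k] m - 1 ⊗ₜ (m * op (u n q))) * diag n q 0 ∈
      (LinearMap.range (koszulOne n q)).map (idempotentIdeal (diag n q 0)).subtype := fun m => by
    have := hu (1 ⊗ₜ m)
    rwa [uLeft, uRight, mul_sub, Algebra.TensorProduct.tmul_mul_tmul,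
      Algebra.TensorProduct.tmul_mul_tmul, one_mul, one_mul, mul_one] at this
  have hgv : ∀ m, (v n q ⊗ₜ[k] m - 1 ⊗ₜ (m * op (v n q))) * diag n q 0 ∈
      (LinearMap.range (koszulOne n q)).map (idempotentIdeal (diag n q 0)).subtype := fun m => by
    have := hv (1 ⊗ₜ m)
    rwa [vLeft, vRight, mul_sub, Algebra.TensorProduct.tmul_mul_tmul,
      Algebra.TensorProduct.tmul_mul_tmul, one_mul, one_mul, mul_one] at this
  have hge : ∀ i m, (e n q i ⊗ₜ[k] m - 1 ⊗ₜ (m * op (e n q i))) * diag n q 0 ∈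
      (LinearMap.range (koszulOne n q)).map (idempotentIdeal (diag n q 0)).subtype := fun i m => by
    rw [he]
    exact zero_mem _
  revert m
  induction p using Lambda.induction with
  | halg c =>
    intro m
    rw [Algebra.algebraMap_eq_smul_one, op_smul, op_one, mul_smul_comm, mul_one,
      TensorProduct.tmul_smul, TensorProduct.smul_tmul', sub_self, zero_mul]
    exact zero_mem _
  | he i => exact hge i
  | hα i =>
    rw [← e_mul_u]
    exact hmul _ _ (hge i) hgu
  | hαbar i =>
    rw [← e_mul_v]
    exact hmul _ _ (hge _) hgv
  | hadd a b ha hb =>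
    intro m
    have := add_mem (ha m) (hb m)
    rwa [← add_mul, sub_add_sub_comm, ← TensorProduct.add_tmul, ← TensorProduct.tmul_add, ← mul_add,
      ← MulOpposite.op_add] at this
  | hmul a b ha hb => exact hmul a b ha hb

/-- Modulo boundaries z · `diag n q 0` depends only on `z • 1`, its image under the augmentation.
This is exactness in degree 0. -/
theorem mul_diag_sub_mem (z : Env n q) :
    (z - 1 ⊗ₜ op (z • (1 : Lambda n q))) * diag n q 0 ∈
      (LinearMap.range (koszulOne n q)).map (idempotentIdeal (diag n q 0)).subtype := by
  induction z using TensorProduct.induction_on with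
  | zero =>
    have h0 : (0 : Env n q) • (1 : Lambda n q) = 0 :=
      map_zero (LinearMap.toSpanSingleton (Env n q) (Lambda n q) 1)
    rw [h0, MulOpposite.op_zero, TensorProduct.tmul_zero, sub_zero, zero_mul]
    exact zero_mem _
  | tmul x y =>
    have := tmul_mul_diag_sub_mem x y
    rwa [env_smul_def, one_mul, op_mul, op_unop]
  | add x y hx hy =>
    have := add_mem hx hy
    rwa [← add_mul, sub_add_sub_comm, ← TensorProduct.tmul_add, ← MulOpposite.op_add, ← add_smul] at this

variable (n q) in
theorem homologicallySmooth : HomologicallySmooth k (Lambda n q) := by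
  have := projective_idempotentIdeal (diag_mul_self n q 0)
  have := projective_idempotentIdeal (diag_mul_self n q 1)
  have := projective_idempotentIdeal (diag_mul_self n q (-1))
  have := finite_idempotentIdeal (diag_mul_self n q 0)
  have := finite_idempotentIdeal (diag_mul_self n q 1)
  have := finite_idempotentIdeal (diag_mul_self n q (-1))
  refine exists_projectiveResolution_of_exact (augmentation n q) (koszulOne n q) (koszulTwo n q)
    ?_ ?_ ?_ ?_ ?_ ?_
  · intro x
    refine ⟨(x ⊗ₜ[k] (1 : (Lambda n q)ᵐᵒᵖ) : Env n q) • ⟨diag n q 0, diag_mul_self n q 0⟩, ?_⟩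
    rw [map_smul, augmentation_apply, diag_zero_smul_one, env_smul_def]
    simp
  · refine LinearMap.ext fun t => Subtype.ext ?_
    rw [LinearMap.comp_apply, koszulOne_apply, koszulTwo_fst, koszulTwo_snd, mul_assoc, mul_assoc,
      ← mul_add, env_koszul_comp, mul_zero]
    rfl
  · refine LinearMap.ext fun y => ?_
    rw [LinearMap.comp_apply, augmentation_apply, koszulOne_apply, add_smul, mul_smul, mul_smul,
      sub_smul, sub_smul, uLeft, uRight, vLeft, vRight]
    simp [env_smul_def]
  · rw [injective_iff_map_eq_zero]
    intro t ht
    refine Subtype.ext (env_eq_zero_of_mul_eq_zero ?_)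
    rw [← koszulTwo_fst, ht]
    rfl
  · rintro ⟨y, z⟩ h
    obtain ⟨t, hty, htz⟩ := exists_eq_of_env_koszul
      (show y.1 * _ + z.1 * _ = 0 from congrArg Subtype.val h)
    have h₁ := diag_mul_vLeft n q 0
    have h₂ := diag_mul_vRight n q 0
    have h₃ := diag_mul_uLeft n q (-1)
    have h₄ := diag_mul_uRight n q (-1)
    rw [zero_add] at h₁ h₂
    rw [neg_add_cancel] at h₃ h₄
    -- The division yields t in the whole enveloping algebra. Its projection t · `diag n q 0` has
    -- the same image, because y and z lie in their left ideals.
    refine ⟨toIdempotentIdeal (diag_mul_self n q 0) t, Prod.ext (Subtype.ext ?_) (Subtype.ext ?_)⟩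
    · rw [koszulTwo_fst]
      change t * diag n q 0 * _ = y.1
      have hy : y.1 * diag n q 1 = y.1 := y.2
      rw [mul_assoc, mul_sub, mul_smul_comm, h₁, h₂, ← smul_mul_assoc, ← sub_mul, ← mul_assoc, hty,
        hy]
    · rw [koszulTwo_snd]
      change t * diag n q 0 * _ = z.1
      have hz : z.1 * diag n q (-1) = z.1 := z.2
      rw [mul_assoc, mul_sub, mul_smul_comm, h₃, h₄, ← smul_mul_assoc, ← sub_mul, ← mul_assoc, htz,
        hz]
  · intro x hx
    have h := mul_diag_sub_mem x.1
    rw [← augmentation_apply, hx, MulOpposite.op_zero, TensorProduct.tmul_zero, sub_zero] at h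
    have hx' : x.1 * diag n q 0 = x.1 := x.2
    rw [hx'] at h
    obtain ⟨_, ⟨t, rfl⟩, ht⟩ := h
    exact ⟨t, Subtype.ext ht⟩

end Lambda

end

end QuantumKleinian

namespace QuantumKleinian

noncomputable section

/-! ### The adjunction between tensor and Hom functors -/

section Bimodule

variable (R S : Type u) [Ring R] [Ring S] {M X N : Type u} [AddCommGroup M] [Module Rᵐᵒᵖ M]
  [AddCommGroup X] [Module R X] [Module Sᵐᵒᵖ X] [SMulCommClass R Sᵐᵒᵖ X] [AddCommGroup N]

/-- The universal property of `M ⊗_R X`. -/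
def BalancedTensor.lift (φ : M →+ X →+ N) (h : ∀ m (r : R) x, φ (op r • m) x = φ m (r • x)) :
    BalancedTensor R M X →+ N :=
  QuotientAddGroup.lift (balancedRelations R M X)
    (TensorProduct.liftAddHom φ fun c m x => by simp) (by
      refine (AddSubgroup.closure_le _).2 ?_
      rintro _ ⟨m, r, x, rfl⟩
      change TensorProduct.liftAddHom φ _ _ = 0
      rw [map_sub, TensorProduct.liftAddHom_tmul, TensorProduct.liftAddHom_tmul, h, sub_self])

theorem BalancedTensor.smul_tmul (m : M) (r : R) (x : X) :
    BalancedTensor.tmul R (op r • m) x = BalancedTensor.tmul R m (r • x) :=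
  (QuotientAddGroup.eq_iff_sub_mem (N := balancedRelations R M X)).2
    (AddSubgroup.subset_closure ⟨m, r, x, rfl⟩)

theorem BalancedTensor.smul_right_tmul (s : Sᵐᵒᵖ) (m : M) (x : X) :
    s • BalancedTensor.tmul R m x = BalancedTensor.tmul R m (s • x) := rfl

theorem BalancedTensor.induction_on {p : BalancedTensor R M X → Prop} (t : BalancedTensor R M X)
    (zero : p 0) (tmul : ∀ m x, p (BalancedTensor.tmul R m x))
    (add : ∀ a b, p a → p b → p (a + b)) : p t := by
  obtain ⟨t, rfl⟩ := QuotientAddGroup.mk'_surjective (balancedRelations R M X) t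
  induction t using TensorProduct.induction_on with
  | zero => exact zero
  | tmul m x => exact tmul m x
  | add a b ha hb => exact add _ _ ha hb

theorem BalancedTensor.zero_tmul (x : X) : BalancedTensor.tmul R (0 : M) x = 0 :=
  congrArg (QuotientAddGroup.mk' (balancedRelations R M X)) (TensorProduct.zero_tmul M x)

variable (X)

/-- The unit `M → Hom_S(X, M ⊗_R X)` of the tensor-Hom adjunction. -/
def tensorHomUnit (M : Type u) [AddCommGroup M] [Module Rᵐᵒᵖ M] :
    M →ₗ[Rᵐᵒᵖ] RightHom S X (BalancedTensor R M X) where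
  toFun m := show X →ₗ[Sᵐᵒᵖ] BalancedTensor R M X from
    { toFun := fun x => BalancedTensor.tmul R m x
      map_add' := BalancedTensor.tmul_add R X M m
      map_smul' := fun _ _ => rfl }
  map_add' m m' := LinearMap.ext fun x => BalancedTensor.add_tmul R X M m m' x
  map_smul' r m := LinearMap.ext fun x => BalancedTensor.smul_tmul R m r.unop x

/-- The counit `Hom_S(X, N) ⊗_R X → N` of the tensor-Hom adjunction. -/
def tensorHomCounit (N : Type u) [AddCommGroup N] [Module Sᵐᵒᵖ N] :
    BalancedTensor R (RightHom S X N) X →ₗ[Sᵐᵒᵖ] N :=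
  let φ : BalancedTensor R (RightHom S X N) X →+ N :=
    BalancedTensor.lift R
      { toFun := fun f : X →ₗ[Sᵐᵒᵖ] N => f.toAddMonoidHom
        map_zero' := rfl
        map_add' := fun _ _ => rfl } (fun _ _ _ => rfl)
  { toFun := φ
    map_add' := map_add φ
    map_smul' := fun s t => DFunLike.congr_fun (BalancedTensor.addHom_ext R
      (f := φ.comp (BalancedTensor.map R LinearMap.id (rightMulMap R S X s)))
      (g := (DistribSMul.toAddMonoidHom N s).comp φ)
      fun (f : X →ₗ[Sᵐᵒᵖ] N) x => f.map_smul s x) t }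

/-- The tensor-Hom adjunction. -/
def tensorHomAdjunction : tensorFunctor R S X ⊣ homFunctor R S X :=
  Adjunction.mkOfUnitCounit
    { unit :=
        { app := fun M => ModuleCat.ofHom (tensorHomUnit R S X M)
          naturality := fun _ _ _ => rfl }
      counit :=
        { app := fun N => ModuleCat.ofHom (tensorHomCounit R S X N)
          naturality := fun N N' g => by
            ext t
            exact DFunLike.congr_fun (BalancedTensor.addHom_ext R
              (f := (tensorHomCounit R S X N').toAddMonoidHom.comp
                (BalancedTensor.map R (RightHom.postcomp R S X g.hom) LinearMap.id))
              (g := g.hom.toAddMonoidHom.comp (tensorHomCounit R S X N).toAddMonoidHom)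
              fun f x => rfl) t }
      left_triangle := by
        ext M t
        exact DFunLike.congr_fun (BalancedTensor.addHom_ext R
          (f := (tensorHomCounit R S X (BalancedTensor R M X)).toAddMonoidHom.comp
            (BalancedTensor.map R (tensorHomUnit R S X M) LinearMap.id))
          (g := AddMonoidHom.id _) fun m x => rfl) t
      right_triangle := rfl }

/-! ### The regular module and finite generation -/

/-- The map `X → R ⊗_R X` is surjective. -/
theorem BalancedTensor.exists_eq_one_tmul (t : BalancedTensor R Rᵐᵒᵖ X) :
    ∃ x, BalancedTensor.tmul R 1 x = t := by
  induction t using BalancedTensor.induction_on with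
  | zero => exact ⟨0, BalancedTensor.tmul_zero R X _ 1⟩
  | tmul m x => exact ⟨m.unop • x, by rw [← BalancedTensor.smul_tmul, op_unop, smul_eq_mul, mul_one]⟩
  | add a b ha hb =>
    obtain ⟨x, rfl⟩ := ha
    obtain ⟨y, rfl⟩ := hb
    exact ⟨x + y, BalancedTensor.tmul_add R X _ 1 x y⟩

/-- The isomorphism `X ≃ R ⊗_R X`. -/
def oneTmulEquiv : X ≃ₗ[Sᵐᵒᵖ] BalancedTensor R Rᵐᵒᵖ X :=
  LinearEquiv.ofBijective
    ({ toFun := fun x => BalancedTensor.tmul R 1 x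
       map_add' := BalancedTensor.tmul_add R X _ 1
       map_smul' := fun _ _ => rfl } : X →ₗ[Sᵐᵒᵖ] BalancedTensor R Rᵐᵒᵖ X)
    ⟨Function.LeftInverse.injective (g := BalancedTensor.lift R
        (M := Rᵐᵒᵖ) (X := X) (N := X)
        { toFun := fun r => DistribSMul.toAddMonoidHom X r.unop
          map_zero' := by ext; simp
          map_add' := fun r r' => by ext; simp [add_smul] }
        (fun m r x => by simp [mul_smul])) fun x => one_smul R x,
      BalancedTensor.exists_eq_one_tmul R X⟩

instance finite_balancedTensor [Module.Finite Rᵐᵒᵖ M] [Module.Finite Sᵐᵒᵖ X] :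
    Module.Finite Sᵐᵒᵖ (BalancedTensor R M X) := by
  obtain ⟨s, hs⟩ := Module.Finite.fg_top (R := Rᵐᵒᵖ) (M := M)
  obtain ⟨s', hs'⟩ := Module.Finite.fg_top (R := Sᵐᵒᵖ) (M := X)
  classical
  refine ⟨⟨(s ×ˢ s').image fun p => BalancedTensor.tmul R p.1 p.2, ?_⟩⟩
  refine Submodule.eq_top_iff'.2 fun t => ?_
  set W := Submodule.span Sᵐᵒᵖ
    (((s ×ˢ s').image fun p => BalancedTensor.tmul R p.1 p.2 : Finset _) :
      Set (BalancedTensor R M X))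
  have h₁ : ∀ m ∈ s, ∀ x : X, BalancedTensor.tmul R m x ∈ W := fun m hm x => by
    have hx : x ∈ Submodule.span Sᵐᵒᵖ (s' : Set X) := hs' ▸ Submodule.mem_top
    induction hx using Submodule.span_induction with
    | mem x hx =>
      exact Submodule.subset_span (Finset.mem_coe.2 (Finset.mem_image.2
        ⟨(m, x), Finset.mem_product.2 ⟨hm, hx⟩, rfl⟩))
    | zero => rw [BalancedTensor.tmul_zero]; exact zero_mem _
    | add x y _ _ hx hy => rw [BalancedTensor.tmul_add]; exact add_mem hx hy
    | smul c x _ hx => exact W.smul_mem c hx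
  have h₂ : ∀ (m : M) (x : X), BalancedTensor.tmul R m x ∈ W := fun m => by
    have hm : m ∈ Submodule.span Rᵐᵒᵖ (s : Set M) := hs ▸ Submodule.mem_top
    induction hm using Submodule.span_induction with
    | mem m hm => exact h₁ m hm
    | zero => exact fun x => by rw [BalancedTensor.zero_tmul]; exact zero_mem _
    | add m m' _ _ h h' => exact fun x => by rw [BalancedTensor.add_tmul]; exact add_mem (h x) (h' x)
    | smul c m _ h => exact fun x => by rw [← op_unop c, BalancedTensor.smul_tmul]; exact h _
  induction t using BalancedTensor.induction_on with
  | zero => exact zero_mem _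
  | tmul m x => exact h₂ m x
  | add a b ha hb => exact add_mem ha hb

end Bimodule

/-! ### The functors `ψ^*`, `ψ_*` and `ψ_!` -/

section Psi

variable {k : Type u} [Field k] {n : ℕ} {ζ : k} (q : k) (hζ : IsPrimitiveRoot ζ (n + 1))

/-- The element `e_0` of `e_0 Λ_q`. -/
def rowGen : E0Lambda q hζ := ⟨Lambda.e n q 0, Lambda.e_mul_self n q 0⟩

/-- The element `e_0` of `Λ_q e_0`. -/
def colGen : LambdaE0 q hζ := ⟨Lambda.e n q 0, Lambda.e_mul_self n q 0⟩

variable {q hζ}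

theorem op_smul_rowGen (x : E0Lambda q hζ) : op x.1 • rowGen q hζ = x := Subtype.ext x.2

theorem smul_colGen (x : LambdaE0 q hζ) : x.1 • colGen q hζ = x := Subtype.ext x.2

theorem smul_rowGen (b : B q ζ) : b • rowGen q hζ = op (Lambda.ofB n q ζ b) • rowGen q hζ :=
  Subtype.ext (Lambda.e_zero_comm hζ b).symm

theorem op_smul_colGen (b : B q ζ) : op b • colGen q hζ = Lambda.ofB n q ζ b • colGen q hζ :=
  Subtype.ext (Lambda.e_zero_comm hζ b)

/-- Every element `x e_0` with `x ∈ e_0 Λ_q` has the form `b e_0` with `b ∈ B_q`. -/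
theorem exists_smul_rowGen_eq (x : E0Lambda q hζ) :
    ∃ b : B q ζ, b • rowGen q hζ = op (Lambda.e n q 0) • x := by
  obtain ⟨b, hb⟩ := Lambda.exists_e_mul_ofB_eq hζ x.1
  refine ⟨b, Subtype.ext ?_⟩
  have hx : Lambda.e n q 0 * x.1 = x.1 := x.2
  rw [hx, Lambda.e_zero_comm hζ] at hb
  exact hb

theorem smul_rowGen_injective : Function.Injective fun b : B q ζ => b • rowGen q hζ := by
  intro b b' h
  have h' : Lambda.ofB n q ζ b * Lambda.e n q 0 = Lambda.ofB n q ζ b' * Lambda.e n q 0 :=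
    congrArg Subtype.val h
  rw [← Lambda.e_zero_comm hζ, ← Lambda.e_zero_comm hζ] at h'
  exact Lambda.ofB_injective_corner h'

theorem op_e_smul_rowGen : op (Lambda.e n q 0) • rowGen q hζ = rowGen q hζ :=
  op_smul_rowGen (rowGen q hζ)

/-- Since e_0 generates e_0 Λ, a map out of it is determined by its value at e_0; this is how
Hom_Λ(e_0 Λ, M) becomes M e_0. -/
theorem linearMap_apply_eq {M : Type u} [AddCommGroup M] [Module (Lambda n q)ᵐᵒᵖ M]
    (f : E0Lambda q hζ →ₗ[(Lambda n q)ᵐᵒᵖ] M) (x : E0Lambda q hζ) :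
    f x = op x.1 • f (rowGen q hζ) := by
  rw [← map_smul, op_smul_rowGen]

instance finite_E0Lambda : Module.Finite (Lambda n q)ᵐᵒᵖ (E0Lambda q hζ) :=
  ⟨⟨{rowGen q hζ}, Submodule.eq_top_iff'.2 fun x => by
    rw [Finset.coe_singleton, ← op_smul_rowGen x]
    exact Submodule.smul_mem _ _ (Submodule.mem_span_singleton_self _)⟩⟩

/-- The additive map `e_0 Λ → B` that sends `x` to the element `b` with `e_0 b = x e_0`. -/
def corner (q : k) (hζ : IsPrimitiveRoot ζ (n + 1)) : E0Lambda q hζ →+ B q ζ where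
  -- The choice is unique by `smul_rowGen_injective`, and this is why the map is additive.
  toFun x := (exists_smul_rowGen_eq x).choose
  map_zero' := smul_rowGen_injective (hζ := hζ) (by
    dsimp only
    rw [(exists_smul_rowGen_eq 0).choose_spec, smul_zero, zero_smul])
  map_add' x y := smul_rowGen_injective (hζ := hζ) (by
    dsimp only
    rw [add_smul, (exists_smul_rowGen_eq _).choose_spec, (exists_smul_rowGen_eq _).choose_spec,
      (exists_smul_rowGen_eq _).choose_spec, smul_add])

theorem corner_smul_rowGen (x : E0Lambda q hζ) :
    corner q hζ x • rowGen q hζ = op (Lambda.e n q 0) • x :=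
  (exists_smul_rowGen_eq x).choose_spec

theorem corner_smul (b : B q ζ) (x : E0Lambda q hζ) : corner q hζ (b • x) = b * corner q hζ x :=
  smul_rowGen_injective (hζ := hζ) (by
    dsimp only
    rw [mul_smul, corner_smul_rowGen, corner_smul_rowGen]
    exact (smul_comm b _ x).symm)

theorem corner_rowGen : corner q hζ (rowGen q hζ) = 1 :=
  smul_rowGen_injective (hζ := hζ) (by
    dsimp only
    rw [corner_smul_rowGen, op_e_smul_rowGen, one_smul])

/-- The unit `M → ψ_* ψ^* M` is bijective. -/
theorem tensorHomUnit_bijective (M : Type u) [AddCommGroup M] [Module (B q ζ)ᵐᵒᵖ M] :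
    Function.Bijective (tensorHomUnit (B q ζ) (Lambda n q) (E0Lambda q hζ) M) := by
  constructor
  -- The map m ⊗ x ↦ m · `corner` x, composed with evaluation at e_0, is a retraction of the unit.
  · let θ : BalancedTensor (B q ζ) M (E0Lambda q hζ) →+ M := BalancedTensor.lift (B q ζ)
      { toFun := fun m =>
          { toFun := fun x => op (corner q hζ x) • m
            map_zero' := by simp
            map_add' := fun x y => by simp [add_smul] }
        map_zero' := by ext; simp
        map_add' := fun m m' => by ext; simp }
      (fun m b x => by simp [corner_smul, mul_smul])
    refine Function.LeftInverse.injective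
      (g := fun f : E0Lambda q hζ →ₗ[(Lambda n q)ᵐᵒᵖ] _ => θ (f (rowGen q hζ))) fun m => ?_
    change op (corner q hζ (rowGen q hζ)) • m = m
    rw [corner_rowGen, op_one, one_smul]
  · intro (f : E0Lambda q hζ →ₗ[(Lambda n q)ᵐᵒᵖ] BalancedTensor (B q ζ) M (E0Lambda q hζ))
    -- Because e_0 Λ e_0 = B e_0, everything in (M ⊗ e_0 Λ) e_0 is a pure tensor m ⊗ e_0. This
    -- applies to f(e_0), which e_0 fixes.
    have h : ∀ t : BalancedTensor (B q ζ) M (E0Lambda q hζ), ∃ m,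
        op (Lambda.e n q 0) • t = BalancedTensor.tmul (B q ζ) m (rowGen q hζ) := fun t => by
      induction t using BalancedTensor.induction_on with
      | zero => exact ⟨0, by rw [smul_zero, BalancedTensor.zero_tmul]⟩
      | tmul m x =>
        exact ⟨op (corner q hζ x) • m, by
          rw [BalancedTensor.smul_tmul, corner_smul_rowGen, BalancedTensor.smul_right_tmul]⟩
      | add a b ha hb =>
        obtain ⟨m, hm⟩ := ha
        obtain ⟨m', hm'⟩ := hb
        exact ⟨m + m', by rw [smul_add, hm, hm', BalancedTensor.add_tmul]⟩
    obtain ⟨m, hm⟩ := h (f (rowGen q hζ))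
    rw [← map_smul, op_e_smul_rowGen] at hm
    refine ⟨m, LinearMap.ext fun x => ?_⟩
    rw [linearMap_apply_eq f, hm, BalancedTensor.smul_right_tmul, op_smul_rowGen]
    rfl

variable (q hζ)

instance isIso_unit : IsIso (tensorHomAdjunction (B q ζ) (Lambda n q) (E0Lambda q hζ)).unit := by
  have : ∀ M, IsIso ((tensorHomAdjunction (B q ζ) (Lambda n q) (E0Lambda q hζ)).unit.app M) :=
    fun M => (ConcreteCategory.isIso_iff_bijective _).2 (tensorHomUnit_bijective M)
  exact NatIso.isIso_of_isIso_app _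

/-- The map `Hom_Λ(e_0 Λ, M) → M ⊗_Λ Λ e_0` that sends `f` to `f(e_0) ⊗ e_0`. -/
def starToShriek (M : Type u) [AddCommGroup M] [Module (Lambda n q)ᵐᵒᵖ M] :
    RightHom (Lambda n q) (E0Lambda q hζ) M →ₗ[(B q ζ)ᵐᵒᵖ]
      BalancedTensor (Lambda n q) M (LambdaE0 q hζ) where
  toFun (f : E0Lambda q hζ →ₗ[(Lambda n q)ᵐᵒᵖ] M) :=
    BalancedTensor.tmul (Lambda n q) (f (rowGen q hζ)) (colGen q hζ)
  map_add' (f f' : E0Lambda q hζ →ₗ[(Lambda n q)ᵐᵒᵖ] M) := BalancedTensor.add_tmul _ _ _ _ _ _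
  map_smul' b (f : E0Lambda q hζ →ₗ[(Lambda n q)ᵐᵒᵖ] M) := by
    change BalancedTensor.tmul _ (f (b.unop • rowGen q hζ)) _ = _
    rw [RingHom.id_apply, BalancedTensor.smul_right_tmul, smul_rowGen, map_smul,
      BalancedTensor.smul_tmul, ← op_smul_colGen, op_unop]

/-- Both sides are M e_0. The map m ⊗ x ↦ m x recovers f(e_0) and hence f; conversely m ⊗ x is the
image of y ↦ m x y. -/
theorem starToShriek_bijective (M : Type u) [AddCommGroup M] [Module (Lambda n q)ᵐᵒᵖ M] :
    Function.Bijective (starToShriek q hζ M) := by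
  constructor
  · let θ : BalancedTensor (Lambda n q) M (LambdaE0 q hζ) →+ M := BalancedTensor.lift (Lambda n q)
      { toFun := fun m =>
          { toFun := fun x => op x.1 • m
            map_zero' := zero_smul _ m
            map_add' := fun x y => add_smul (op x.1) (op y.1) m }
        map_zero' := by ext; simp
        map_add' := fun m m' => by ext x; exact smul_add (op x.1) m m' }
      (fun m r x => (mul_smul (op x.1) (op r) m).symm)
    intro (f : E0Lambda q hζ →ₗ[(Lambda n q)ᵐᵒᵖ] M) (f' : E0Lambda q hζ →ₗ[(Lambda n q)ᵐᵒᵖ] M) h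
    have h' : op (Lambda.e n q 0) • f (rowGen q hζ) = op (Lambda.e n q 0) • f' (rowGen q hζ) :=
      congrArg θ h
    rw [← map_smul, ← map_smul, op_e_smul_rowGen] at h'
    exact LinearMap.ext fun x => by rw [linearMap_apply_eq f, linearMap_apply_eq f', h']
  · intro t
    induction t using BalancedTensor.induction_on with
    | zero => exact ⟨0, map_zero _⟩
    | tmul m x =>
      let f : E0Lambda q hζ →ₗ[(Lambda n q)ᵐᵒᵖ] M :=
        { toFun := fun y => op (x.1 * y.1) • m
          map_add' := fun y z => by
            change op (x.1 * (y.1 + z.1)) • m = _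
            rw [mul_add, MulOpposite.op_add, add_smul]
          map_smul' := fun c y => by
            change op (x.1 * (y.1 * c.unop)) • m = _
            rw [RingHom.id_apply, ← mul_assoc, op_mul, op_unop, mul_smul] }
      refine ⟨f, ?_⟩
      change BalancedTensor.tmul _ (op (x.1 * Lambda.e n q 0) • m) _ = _
      rw [BalancedTensor.smul_tmul, show x.1 * Lambda.e n q 0 = x.1 from x.2, smul_colGen]
    | add a b ha hb =>
      obtain ⟨f, rfl⟩ := ha
      obtain ⟨g, rfl⟩ := hb
      exact ⟨f + g, map_add _ _ _⟩

/-- The isomorphism `ψ_* ≅ ψ_!`. -/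
def psiLowerStarIso : psiLowerStar q hζ ≅ psiLowerShriek q hζ :=
  NatIso.ofComponents (fun M => (LinearEquiv.ofBijective _
    (starToShriek_bijective q hζ M)).toModuleIso) (fun _ => rfl)

/-- The right adjoint `ψ^! = Hom_B(Λ e_0, -)` of `ψ_*`. -/
abbrev psiUpperShriek : ModuleCat.{u} (B q ζ)ᵐᵒᵖ ⥤ ModuleCat.{u} (Lambda n q)ᵐᵒᵖ :=
  homFunctor (Lambda n q) (B q ζ) (LambdaE0 q hζ)

/-- The adjunction between `ψ^*` and `ψ_*`. -/
abbrev psiUpperStarAdjunction : psiUpperStar q hζ ⊣ psiLowerStar q hζ :=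
  tensorHomAdjunction (B q ζ) (Lambda n q) (E0Lambda q hζ)

/-- The adjunction between `ψ_*` and `ψ^!`. -/
def psiUpperShriekAdjunction : psiLowerStar q hζ ⊣ psiUpperShriek q hζ :=
  (tensorHomAdjunction (Lambda n q) (B q ζ) (LambdaE0 q hζ)).ofNatIsoLeft
    (psiLowerStarIso q hζ).symm

/-- In the adjoint triple ψ^* ⊣ ψ_* ⊣ ψ^! the unit of the first pair is invertible if and only if
the counit of the second is. -/
instance isIso_counit : IsIso (psiUpperShriekAdjunction q hζ).counit :=
  (Adjunction.Triple.mk (psiUpperStarAdjunction q hζ)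
    (psiUpperShriekAdjunction q hζ)).isIso_unit_iff_isIso_counit.1 (isIso_unit q hζ)

/-! ### Noetherianity of `ψ_* M` -/

variable {q hζ} in
/-- `ψ_*` preserves noetherian modules. -/
theorem isNoetherian_rightHom (M : Type u) [AddCommGroup M] [Module (Lambda n q)ᵐᵒᵖ M]
    [IsNoetherian (Lambda n q)ᵐᵒᵖ M] :
    IsNoetherian (B q ζ)ᵐᵒᵖ (RightHom (Lambda n q) (E0Lambda q hζ) M) := by
  let ev : RightHom (Lambda n q) (E0Lambda q hζ) M → M :=
    fun f : E0Lambda q hζ →ₗ[(Lambda n q)ᵐᵒᵖ] M => f (rowGen q hζ)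
  have ev_inj : Function.Injective ev := fun (f : E0Lambda q hζ →ₗ[(Lambda n q)ᵐᵒᵖ] M)
    (f' : E0Lambda q hζ →ₗ[(Lambda n q)ᵐᵒᵖ] M) (h : f (rowGen q hζ) = f' (rowGen q hζ)) =>
    LinearMap.ext fun x => by rw [linearMap_apply_eq f, linearMap_apply_eq f', h]
  -- For N ⊆ M e_0 the submodule N Λ of M determines N, because N Λ e_0 = N e_0 Λ e_0 = N. So
  -- ascending chains of B-submodules give ascending chains in M.
  let Φ : Submodule (B q ζ)ᵐᵒᵖ (RightHom (Lambda n q) (E0Lambda q hζ) M) →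
      Submodule (Lambda n q)ᵐᵒᵖ M := fun N => Submodule.span _ (ev '' N)
  have hmem : ∀ (N) (f : RightHom (Lambda n q) (E0Lambda q hζ) M), ev f ∈ Φ N → f ∈ N := by
    intro N f hf
    -- The extra factor y makes the statement stable under scalars from Λ; only y = 1 is needed
    -- afterwards.
    have key : ∀ m ∈ Φ N, ∀ y : Lambda n q, ∃ g ∈ N,
        ev g = op (Lambda.e n q 0) • op y • m := by
      intro m hm
      induction hm using Submodule.span_induction with
      | mem m hm =>
        obtain ⟨(g : E0Lambda q hζ →ₗ[(Lambda n q)ᵐᵒᵖ] M), hg, rfl⟩ := hm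
        intro y
        refine ⟨_, N.smul_mem (op (corner q hζ (op y • rowGen q hζ))) hg, ?_⟩
        change g (corner q hζ (op y • rowGen q hζ) • rowGen q hζ) = _ • _ • g (rowGen q hζ)
        rw [corner_smul_rowGen, map_smul, map_smul]
      | zero => exact fun y => ⟨0, zero_mem _, by simp [ev]; rfl⟩
      | add m m' _ _ h h' =>
        intro y
        obtain ⟨g, hg, hg'⟩ := h y
        obtain ⟨g₁, hg₁, hg₁'⟩ := h' y
        exact ⟨g + g₁, add_mem hg hg₁, by rw [smul_add, smul_add, ← hg', ← hg₁']; rfl⟩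
      | smul c m _ h =>
        intro y
        obtain ⟨g, hg, hg'⟩ := h (c.unop * y)
        exact ⟨g, hg, by rw [hg', op_mul, mul_smul, op_unop]⟩
    obtain ⟨g, hg, hgf⟩ := key _ hf 1
    have : op (Lambda.e n q 0) • ev f = ev f := by
      change op (Lambda.e n q 0) • (show E0Lambda q hζ →ₗ[(Lambda n q)ᵐᵒᵖ] M from f) _ =
        (show E0Lambda q hζ →ₗ[(Lambda n q)ᵐᵒᵖ] M from f) _
      rw [← map_smul, op_e_smul_rowGen]
    rw [op_one, one_smul, this] at hgf
    exact ev_inj hgf ▸ hg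
  have hmono : StrictMono Φ := by
    refine Monotone.strictMono_of_injective
      (fun N N' h => Submodule.span_mono (Set.image_mono h)) ?_
    intro N N' h
    ext f
    exact ⟨fun hf => hmem N' f (h ▸ Submodule.subset_span ⟨f, hf, rfl⟩),
      fun hf => hmem N f (h ▸ Submodule.subset_span ⟨f, hf, rfl⟩)⟩
  rw [isNoetherian_iff']
  exact hmono.wellFoundedGT

variable {q}

/-- `B_q` is right noetherian. -/
theorem isNoetherianRing_B_op (hζ : IsPrimitiveRoot ζ (n + 1)) (hq : q ≠ 0) : IsNoetherianRing (B q ζ)ᵐᵒᵖ := by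
  have := Lambda.isNoetherianRing_op (n := n) hq
  have : IsNoetherian (Lambda n q)ᵐᵒᵖ (E0Lambda q hζ) :=
    isNoetherian_of_isNoetherianRing_of_finite _ _
  have := isNoetherian_rightHom (q := q) (hζ := hζ) (E0Lambda q hζ)
  -- B acts faithfully on e_0 Λ, so it embeds in ψ_* (e_0 Λ), which is noetherian.
  let φ : (B q ζ)ᵐᵒᵖ →ₗ[(B q ζ)ᵐᵒᵖ] RightHom (Lambda n q) (E0Lambda q hζ) (E0Lambda q hζ) :=
    { toFun := fun b => leftMulMap (B q ζ) (Lambda n q) b.unop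
      map_add' := fun b c => LinearMap.ext fun x => add_smul b.unop c.unop x
      map_smul' := fun b c => LinearMap.ext fun x => mul_smul c.unop b.unop x }
  refine isNoetherian_of_injective φ fun b c h => ?_
  exact unop_injective (smul_rowGen_injective (hζ := hζ)
    (DFunLike.congr_fun (F := E0Lambda q hζ →ₗ[(Lambda n q)ᵐᵒᵖ] E0Lambda q hζ) h (rowGen q hζ)))

end Psi

end

end QuantumKleinian

namespace QuantumKleinian

noncomputable section

/-! ### Modules with exact Koszul complexes away from the vertex `0` -/

section Koszul

variable {k : Type u} [Field k] {n : ℕ} {q ζ : k}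

/-- The right `Λ_q`-module `M` is Koszul exact if the complexes
`0 → M e_i → M e_{i+1} ⊕ M e_{i-1} → M e_i → 0` given by right multiplication by `u` and `v` are
exact for `i ≠ 0` (and exact in the middle for `i = 0`). -/
structure KoszulExact (n : ℕ) (q : k) (M : Type u) [AddCommGroup M] [Module (Lambda n q)ᵐᵒᵖ M] :
    Prop where
  eq_zero (i : ZMod (n + 1)) (hi : i ≠ 0) (x : M) (hx : op (Lambda.e n q i) • x = x)
    (hu : op (Lambda.u n q) • x = 0) (hv : op (Lambda.v n q) • x = 0) : x = 0
  exists_eq (y₁ y₂ : M) (h : op (Lambda.u n q) • y₂ = op (q • Lambda.v n q) • y₁) :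
    ∃ t : M, op (Lambda.u n q) • t = y₁ ∧ op (Lambda.v n q) • t = y₂
  exists_add (i : ZMod (n + 1)) (hi : i ≠ 0) (w : M) (hw : op (Lambda.e n q i) • w = w) :
    ∃ y₁ y₂ : M, w = op (Lambda.u n q) • y₂ + op (Lambda.v n q) • y₁

variable {M N : Type u} [AddCommGroup M] [Module (Lambda n q)ᵐᵒᵖ M] [AddCommGroup N]
  [Module (Lambda n q)ᵐᵒᵖ N]

theorem KoszulExact.of_retract (hN : KoszulExact n q N) (f : M →ₗ[(Lambda n q)ᵐᵒᵖ] N)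
    (g : N →ₗ[(Lambda n q)ᵐᵒᵖ] M) (h : g ∘ₗ f = LinearMap.id) : KoszulExact n q M := by
  have hgf : ∀ x, g (f x) = x := fun x => DFunLike.congr_fun h x
  refine ⟨fun i hi x hx hu hv => ?_, fun y₁ y₂ h => ?_, fun i hi w hw => ?_⟩
  · rw [← hgf x, hN.eq_zero i hi (f x) (by rw [← map_smul, hx]) (by rw [← map_smul, hu, map_zero])
      (by rw [← map_smul, hv, map_zero]), map_zero]
  · obtain ⟨t, h₁, h₂⟩ := hN.exists_eq (f y₁) (f y₂) (by rw [← map_smul, ← map_smul, h])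
    exact ⟨g t, by rw [← map_smul, h₁, hgf], by rw [← map_smul, h₂, hgf]⟩
  · obtain ⟨y₁, y₂, h⟩ := hN.exists_add i hi (f w) (by rw [← map_smul, hw])
    exact ⟨g y₁, g y₂, by rw [← map_smul, ← map_smul, ← map_add, ← h, hgf]⟩

theorem KoszulExact.prod (hM : KoszulExact n q M) (hN : KoszulExact n q N) :
    KoszulExact n q (M × N) := by
  refine ⟨fun i hi x hx hu hv => ?_, fun y₁ y₂ h => ?_, fun i hi w hw => ?_⟩
  · exact Prod.ext
      (hM.eq_zero i hi x.1 (congrArg Prod.fst hx) (congrArg Prod.fst hu) (congrArg Prod.fst hv))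
      (hN.eq_zero i hi x.2 (congrArg Prod.snd hx) (congrArg Prod.snd hu) (congrArg Prod.snd hv))
  · obtain ⟨t, ht₁, ht₂⟩ := hM.exists_eq y₁.1 y₂.1 (congrArg Prod.fst h)
    obtain ⟨s, hs₁, hs₂⟩ := hN.exists_eq y₁.2 y₂.2 (congrArg Prod.snd h)
    exact ⟨(t, s), Prod.ext ht₁ hs₁, Prod.ext ht₂ hs₂⟩
  · obtain ⟨y₁, y₂, hy⟩ := hM.exists_add i hi w.1 (congrArg Prod.fst hw)
    obtain ⟨z₁, z₂, hz⟩ := hN.exists_add i hi w.2 (congrArg Prod.snd hw)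
    exact ⟨(y₁, z₁), (y₂, z₂), Prod.ext hy hz⟩

theorem KoszulExact.pi {ι : Type} (hM : KoszulExact n q M) : KoszulExact n q (ι → M) := by
  refine ⟨fun i hi x hx hu hv => ?_, fun y₁ y₂ h => ?_, fun i hi w hw => ?_⟩
  · exact funext fun j => hM.eq_zero i hi (x j) (congrFun hx j) (congrFun hu j) (congrFun hv j)
  · choose t ht₁ ht₂ using fun j => hM.exists_eq (y₁ j) (y₂ j) (congrFun h j)
    exact ⟨t, funext ht₁, funext ht₂⟩
  · choose y₁ y₂ hy using fun j => hM.exists_add i hi (w j) (congrFun hw j)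
    exact ⟨y₁, y₂, funext hy⟩

/-- Left multiplication by e_0 projects solutions in Λ to solutions in e_0 Λ. The last condition
holds for i ≠ 0 because e_0 Λ e_i contains no path of length zero. -/
theorem koszulExact_E0Lambda (hq : q ≠ 0) (hζ : IsPrimitiveRoot ζ (n + 1)) :
    KoszulExact n q (E0Lambda q hζ) := by
  refine ⟨fun i hi x hx hu hv => ?_, fun y₁ y₂ h => ?_, fun i hi w hw => ?_⟩
  · exact Subtype.ext (Lambda.eq_zero_of_mul_v_eq_zero (congrArg Subtype.val hv))
  · have h' : y₂.1 * Lambda.u n q = y₁.1 * (q • Lambda.v n q) := congrArg Subtype.val h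
    obtain ⟨t, h₁, h₂⟩ := Lambda.exists_eq_mul_of_mul_u_eq hq (h'.trans (mul_smul_comm _ _ _))
    refine ⟨⟨Lambda.e n q 0 * t, ?_⟩, Subtype.ext ?_, Subtype.ext ?_⟩
    · change _ * (_ * _) = _
      rw [← mul_assoc, Lambda.e_mul_self]
    · change Lambda.e n q 0 * t * Lambda.u n q = y₁.1
      rw [mul_assoc, h₁]
      exact y₁.2
    · change Lambda.e n q 0 * t * Lambda.v n q = y₂.1
      rw [mul_assoc, h₂]
      exact y₂.2
  · obtain ⟨y₁, y₂, h⟩ := Lambda.exists_eq_mul_u_add_mul_v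
      (Lambda.coord_zero_of_e_mul_of_mul_e hi.symm w.2 (congrArg Subtype.val hw))
    refine ⟨⟨Lambda.e n q 0 * y₁, ?_⟩, ⟨Lambda.e n q 0 * y₂, ?_⟩, Subtype.ext ?_⟩
    · change _ * (_ * _) = _
      rw [← mul_assoc, Lambda.e_mul_self]
    · change _ * (_ * _) = _
      rw [← mul_assoc, Lambda.e_mul_self]
    · change w.1 = Lambda.e n q 0 * y₂ * Lambda.u n q + Lambda.e n q 0 * y₁ * Lambda.v n q
      rw [mul_assoc, mul_assoc, ← mul_add, ← h]
      exact w.2.symm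

/-- `ψ^*` maps finitely generated projective modules to Koszul exact modules. -/
theorem koszulExact_balancedTensor (hq : q ≠ 0) (hζ : IsPrimitiveRoot ζ (n + 1)) (P : Type u)
    [AddCommGroup P] [Module (B q ζ)ᵐᵒᵖ P] [Module.Finite (B q ζ)ᵐᵒᵖ P]
    [Module.Projective (B q ζ)ᵐᵒᵖ P] :
    KoszulExact n q (BalancedTensor (B q ζ) P (E0Lambda q hζ)) := by
  -- P is a direct summand of B^m, so P ⊗ e_0 Λ is a direct summand of (e_0 Λ)^m, and Koszul
  -- exactness passes to retracts.
  obtain ⟨m, r, s, -, -, hrs⟩ := Module.Finite.exists_comp_eq_id_of_projective (B q ζ)ᵐᵒᵖ P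
  have hB : KoszulExact n q (BalancedTensor (B q ζ) (B q ζ)ᵐᵒᵖ (E0Lambda q hζ)) :=
    (koszulExact_E0Lambda hq hζ).of_retract
      (oneTmulEquiv (B q ζ) (Lambda n q) (E0Lambda q hζ)).symm.toLinearMap
      (oneTmulEquiv (B q ζ) (Lambda n q) (E0Lambda q hζ)).toLinearMap
      (LinearMap.ext fun x => by simp)
  let f : BalancedTensor (B q ζ) P (E0Lambda q hζ) →ₗ[(Lambda n q)ᵐᵒᵖ]
      (Fin m → BalancedTensor (B q ζ) (B q ζ)ᵐᵒᵖ (E0Lambda q hζ)) :=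
    LinearMap.pi fun j => BalancedTensor.mapRight _ _ _ (LinearMap.proj j ∘ₗ s)
  let g : (Fin m → BalancedTensor (B q ζ) (B q ζ)ᵐᵒᵖ (E0Lambda q hζ)) →ₗ[(Lambda n q)ᵐᵒᵖ]
      BalancedTensor (B q ζ) P (E0Lambda q hζ) :=
    ∑ j, BalancedTensor.mapRight _ _ _ (r ∘ₗ LinearMap.single _ _ j) ∘ₗ LinearMap.proj j
  refine (hB.pi (ι := Fin m)).of_retract f g (LinearMap.ext fun t => ?_)
  refine DFunLike.congr_fun (BalancedTensor.addHom_ext (B q ζ) (f := (g ∘ₗ f).toAddMonoidHom)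
    (g := AddMonoidHom.id _) fun p x => ?_) t
  change g (f _) = BalancedTensor.tmul (B q ζ) p x
  have hp : ∑ j, r (Pi.single j (s p j)) = p := by
    rw [← map_sum, Finset.univ_sum_single]
    exact DFunLike.congr_fun hrs p
  have hsum : ∀ F : Fin m → P, BalancedTensor.tmul (B q ζ) (∑ j, F j) x =
      ∑ j, BalancedTensor.tmul (B q ζ) (F j) x := fun F => by
    let φ : P →+ BalancedTensor (B q ζ) P (E0Lambda q hζ) :=
      { toFun := fun p => BalancedTensor.tmul (B q ζ) p x
        map_zero' := BalancedTensor.zero_tmul _ _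
        map_add' := fun p p' => BalancedTensor.add_tmul _ _ _ p p' x }
    exact map_sum φ F _
  conv_rhs => rw [← hp, hsum]
  rw [LinearMap.sum_apply]
  rfl

variable {hζ : IsPrimitiveRoot ζ (n + 1)}

/-- Left multiplication by an element of `Λ` on `Λ e_0`. -/
abbrev colMul (hζ : IsPrimitiveRoot ζ (n + 1)) (x : Lambda n q) :
    LambdaE0 q hζ →ₗ[(B q ζ)ᵐᵒᵖ] LambdaE0 q hζ :=
  leftMulMap (Lambda n q) (B q ζ) x

/-- The element `x e_0` of `Λ e_0`. -/
def toCol (hζ : IsPrimitiveRoot ζ (n + 1)) (x : Lambda n q) : LambdaE0 q hζ := x • colGen q hζ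

/-- `ψ^!` maps injective modules to Koszul exact modules. -/
theorem koszulExact_psiUpperShriek (hq : q ≠ 0) (hζ : IsPrimitiveRoot ζ (n + 1))
    (E : ModuleCat.{u} (B q ζ)ᵐᵒᵖ) [Injective E] :
    KoszulExact n q (RightHom (B q ζ) (LambdaE0 q hζ) E) := by
  refine ⟨fun i hi (f : LambdaE0 q hζ →ₗ[(B q ζ)ᵐᵒᵖ] E) hf hu hv => ?_,
    fun (y₁ : LambdaE0 q hζ →ₗ[(B q ζ)ᵐᵒᵖ] E) (y₂ : LambdaE0 q hζ →ₗ[(B q ζ)ᵐᵒᵖ] E) h => ?_,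
    fun i hi (w : LambdaE0 q hζ →ₗ[(B q ζ)ᵐᵒᵖ] E) hw => ?_⟩
  -- Dual to the fact that e_i Λ e_0 lies in uΛ + vΛ for i ≠ 0: f vanishes on uΛe_0 and vΛe_0.
  · refine LinearMap.ext fun x => ?_
    have hfx : f (colMul hζ (Lambda.e n q i) x) = f x :=
      DFunLike.congr_fun (F := LambdaE0 q hζ →ₗ[(B q ζ)ᵐᵒᵖ] E) hf x
    have hu' : ∀ y, f (colMul hζ (Lambda.u n q) y) = 0 := fun y =>
      DFunLike.congr_fun (F := LambdaE0 q hζ →ₗ[(B q ζ)ᵐᵒᵖ] E) hu y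
    have hv' : ∀ y, f (colMul hζ (Lambda.v n q) y) = 0 := fun y =>
      DFunLike.congr_fun (F := LambdaE0 q hζ →ₗ[(B q ζ)ᵐᵒᵖ] E) hv y
    have hx : x.1 * Lambda.e n q 0 = x.1 := x.2
    obtain ⟨y₁, y₂, h⟩ := Lambda.exists_eq_u_mul_add_v_mul
      (w := Lambda.e n q i * x.1) (Lambda.coord_zero_of_e_mul_of_mul_e hi
        (by rw [← mul_assoc, Lambda.e_mul_self]) (by rw [mul_assoc, hx]))
    have hxy : colMul hζ (Lambda.e n q i) x = colMul hζ (Lambda.u n q) (toCol hζ y₁) +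
        colMul hζ (Lambda.v n q) (toCol hζ y₂) := Subtype.ext (by
      change Lambda.e n q i * x.1 = Lambda.u n q * (y₁ * Lambda.e n q 0) +
        Lambda.v n q * (y₂ * Lambda.e n q 0)
      rw [← mul_assoc, ← mul_assoc, ← add_mul, ← h, mul_assoc, hx])
    rw [← hfx, hxy, map_add, hu', hv', add_zero]
    rfl
  -- Dual to the middle exactness of Λe_0 → Λe_0 ⊕ Λe_0 → Λe_0 for left multiplication: (y₁, y₂)
  -- kills the image of the first map, so it factors through the second by injectivity of E.
  · have hq' : ∀ x y : Lambda n q, Lambda.u n q * x + Lambda.v n q * y = 0 →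
        ∃ t, q • (Lambda.v n q * t) = x ∧ -(Lambda.u n q * t) = y := fun x y hxy => by
      obtain ⟨t, h₁, h₂⟩ := Lambda.exists_eq_mul_of_v_mul_eq hq (y₁ := -y) (y₂ := q⁻¹ • x) (by
        rw [mul_smul_comm, smul_smul, mul_inv_cancel₀ hq, one_smul, mul_neg, neg_eq_iff_add_eq_zero,
          add_comm, hxy])
      exact ⟨t, by rw [h₂, smul_smul, mul_inv_cancel₀ hq, one_smul], by rw [h₁, neg_neg]⟩
    let X := ModuleCat.of (B q ζ)ᵐᵒᵖ (LambdaE0 q hζ)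
    let φ₁ : LambdaE0 q hζ →ₗ[(B q ζ)ᵐᵒᵖ] (LambdaE0 q hζ × LambdaE0 q hζ) :=
      LinearMap.prod (colMul hζ (q • Lambda.v n q)) (-colMul hζ (Lambda.u n q))
    let φ₂ : (LambdaE0 q hζ × LambdaE0 q hζ) →ₗ[(B q ζ)ᵐᵒᵖ] LambdaE0 q hζ :=
      LinearMap.coprod (colMul hζ (Lambda.u n q)) (colMul hζ (Lambda.v n q))
    let S : ShortComplex (ModuleCat.{u} (B q ζ)ᵐᵒᵖ) :=
      ShortComplex.mk (ModuleCat.ofHom φ₁) (ModuleCat.ofHom φ₂) (by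
        ext x
        refine Subtype.ext ?_
        change Lambda.u n q * (q • Lambda.v n q * x.1) + Lambda.v n q * -(Lambda.u n q * x.1) = 0
        rw [mul_neg, ← mul_assoc, ← mul_assoc, Lambda.v_mul_u, mul_smul_comm, add_neg_cancel])
    have hS : S.Exact := by
      rw [ShortComplex.moduleCat_exact_iff]
      rintro ⟨x, y⟩ hxy
      obtain ⟨t, h₁, h₂⟩ := hq' x.1 y.1 (congrArg Subtype.val hxy)
      have hx : x.1 * Lambda.e n q 0 = x.1 := x.2
      have hy : y.1 * Lambda.e n q 0 = y.1 := y.2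
      refine ⟨toCol hζ t, Prod.ext (Subtype.ext ?_) (Subtype.ext ?_)⟩
      · change q • Lambda.v n q * (t * Lambda.e n q 0) = x.1
        rw [← mul_assoc, smul_mul_assoc, h₁, hx]
      · change -(Lambda.u n q * (t * Lambda.e n q 0)) = y.1
        rw [← mul_assoc, ← neg_mul, h₂, hy]
    let y : S.X₂ ⟶ E := ModuleCat.ofHom (LinearMap.coprod y₁ y₂)
    have hy : S.f ≫ y = 0 := by
      ext x
      change y₁ (colMul hζ (q • Lambda.v n q) x) + y₂ (-colMul hζ (Lambda.u n q) x) = 0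
      rw [map_neg, add_neg_eq_zero]
      exact (DFunLike.congr_fun (F := LambdaE0 q hζ →ₗ[(B q ζ)ᵐᵒᵖ] E) h x).symm
    have ht := hS.comp_descToInjective y hy
    refine ⟨(hS.descToInjective y hy).hom, LinearMap.ext fun x => ?_, LinearMap.ext fun x => ?_⟩
    · have := congrArg (fun g => g.hom ((x, 0) : LambdaE0 q hζ × LambdaE0 q hζ)) ht
      change (hS.descToInjective y hy).hom (colMul hζ (Lambda.u n q) x + colMul hζ (Lambda.v n q) 0) =
        y₁ x + y₂ 0 at this
      rw [map_zero, add_zero, map_zero, add_zero] at this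
      exact this
    · have := congrArg (fun g => g.hom ((0, x) : LambdaE0 q hζ × LambdaE0 q hζ)) ht
      change (hS.descToInjective y hy).hom (colMul hζ (Lambda.u n q) 0 + colMul hζ (Lambda.v n q) x) =
        y₁ 0 + y₂ x at this
      rw [map_zero, zero_add, map_zero, zero_add] at this
      exact this
  -- Dual to the injectivity of x ↦ (u x, v x): extend w along this map and take the two components.
  · let φ : ModuleCat.of (B q ζ)ᵐᵒᵖ (LambdaE0 q hζ) ⟶
        ModuleCat.of (B q ζ)ᵐᵒᵖ (LambdaE0 q hζ × LambdaE0 q hζ) :=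
      ModuleCat.ofHom (LinearMap.prod (colMul hζ (Lambda.u n q)) (colMul hζ (Lambda.v n q)))
    have : Mono φ := by
      rw [ModuleCat.mono_iff_injective, injective_iff_map_eq_zero]
      intro x hx
      exact Subtype.ext (Lambda.eq_zero_of_u_mul_eq_zero
        (congrArg (fun p : LambdaE0 q hζ × LambdaE0 q hζ => p.1.1) hx))
    let g := (Injective.factorThru (ModuleCat.ofHom w : ModuleCat.of _ (LambdaE0 q hζ) ⟶ E) φ).hom
    have hg : ∀ x, g (colMul hζ (Lambda.u n q) x, colMul hζ (Lambda.v n q) x) = w x := fun x =>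
      congrArg (fun g => g.hom x)
        (Injective.comp_factorThru (ModuleCat.ofHom w : ModuleCat.of _ (LambdaE0 q hζ) ⟶ E) φ)
    refine ⟨g ∘ₗ LinearMap.inr _ _ _, g ∘ₗ LinearMap.inl _ _ _, LinearMap.ext fun x => ?_⟩
    change w x = g (colMul hζ (Lambda.u n q) x, 0) + g (0, colMul hζ (Lambda.v n q) x)
    rw [← map_add, Prod.mk_add_mk, add_zero, zero_add, hg]

/-! ### An acyclicity criterion -/

theorem op_smul_eq_op_algebraMap_smul (c : k) (w : Lambda n q) (x : M) :
    op (c • w) • x = op (algebraMap k (Lambda n q) c) • op w • x := by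
  rw [← mul_smul, ← op_mul, Algebra.smul_def, Algebra.commutes]

theorem sum_op_e_smul (x : M) : ∑ i, op (Lambda.e n q i) • x = x := by
  have h : ∑ i, op (Lambda.e n q i) = 1 := by
    rw [← op_one, ← Lambda.sum_e n q]
    exact (map_sum MulOpposite.opAddEquiv _ _).symm
  rw [← Finset.sum_smul, h, one_smul]

theorem op_e_smul_monomial_smul {i : ZMod (n + 1)} {x : M} (hx : op (Lambda.e n q i) • x = x)
    {j : ZMod (n + 1)} (a b : ℕ) (hj : j + b - a = i) :
    op (Lambda.e n q j) • op (Lambda.u n q ^ a * Lambda.v n q ^ b) • x =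
      op (Lambda.u n q ^ a * Lambda.v n q ^ b) • x := by
  rw [← mul_smul, ← op_mul, mul_assoc, Lambda.v_pow_mul_e, ← mul_assoc, Lambda.u_pow_mul_e, hj,
    mul_assoc, op_mul, mul_smul, hx]

/-- A submodule criterion that uses that `Λ_q / Λ_q e_0 Λ_q` is killed by all long monomials. -/
theorem submodule_le_of_koszul (N Z : Submodule (Lambda n q)ᵐᵒᵖ M)
    (h₀ : ∀ x ∈ Z, op (Lambda.e n q 0) • x = x → x ∈ N)
    (h : ∀ i ≠ 0, ∀ x ∈ Z, op (Lambda.e n q i) • x = x → op (Lambda.u n q) • x ∈ N →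
      op (Lambda.v n q) • x ∈ N → x ∈ N) : Z ≤ N := by
  -- Descending induction on the length a + b, where c bounds the distance to 2 (n + 1). From that
  -- length on one exponent is at least n + 1, so that part of the path goes around the whole cycle
  -- and meets the vertex 0.
  have key : ∀ (i : ZMod (n + 1)), ∀ x ∈ Z, op (Lambda.e n q i) • x = x → ∀ c a b : ℕ,
      2 * (n + 1) ≤ a + b + c → op (Lambda.u n q ^ a * Lambda.v n q ^ b) • x ∈ N := by
    intro i x hxZ hx c
    induction c with
    | zero =>
      intro a b hab
      by_cases ha : n + 1 ≤ a
      -- The initial segment u^{(-i).val} leads from i to 0. In the other case u^a v^{(i + a).val}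
      -- does.
      · have hle : (-i).val ≤ a := (ZMod.val_lt (-i)).le.trans ha
        have h₁ := h₀ _ (Z.smul_mem (op (Lambda.u n q ^ (-i).val * Lambda.v n q ^ 0)) hxZ)
          (op_e_smul_monomial_smul hx _ _ (by simp))
        rw [pow_zero, mul_one] at h₁
        have h₂ := N.smul_mem (op (Lambda.u n q ^ (a - (-i).val) * Lambda.v n q ^ b)) h₁
        rwa [← mul_smul, ← op_mul, ← mul_assoc, ← pow_add, Nat.add_sub_cancel' hle] at h₂
      · have hb : n + 1 ≤ b := by lia
        have hle : (i + (a : ZMod (n + 1))).val ≤ b := (ZMod.val_lt (i + (a : ZMod (n + 1)))).le.trans hb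
        have h₁ := h₀ _ (Z.smul_mem (op (Lambda.u n q ^ a * Lambda.v n q ^ (i + (a : ZMod (n + 1))).val)) hxZ)
          (op_e_smul_monomial_smul hx _ _ (by simp))
        have h₂ := N.smul_mem (op (Lambda.v n q ^ (b - (i + (a : ZMod (n + 1))).val))) h₁
        rwa [← mul_smul, ← op_mul, mul_assoc, ← pow_add, Nat.add_sub_cancel' hle] at h₂
    | succ c ih =>
      intro a b hab
      have hy := op_e_smul_monomial_smul hx (j := i + a - b) a b (by ring)
      have hyZ := Z.smul_mem (op (Lambda.u n q ^ a * Lambda.v n q ^ b)) hxZ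
      -- The vertex where the path ends. If it is not 0, the two paths longer by one arrow are
      -- covered by the induction hypothesis.
      by_cases hr : i + a - b = 0
      · rw [hr] at hy
        exact h₀ _ hyZ hy
      · refine h _ hr _ hyZ hy ?_ ?_
        · rw [← mul_smul, ← op_mul, mul_assoc, Lambda.v_pow_mul_u, mul_smul_comm, ← mul_assoc,
            ← pow_succ, op_smul_eq_op_algebraMap_smul]
          exact N.smul_mem _ (ih (a + 1) b (by lia))
        · rw [← mul_smul, ← op_mul, mul_assoc, ← pow_succ]
          exact ih a (b + 1) (by lia)
  intro x hx
  rw [← sum_op_e_smul (n := n) (q := q) x]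
  refine sum_mem fun i _ => ?_
  have := key i _ (Z.smul_mem (op (Lambda.e n q i)) hx)
    (by rw [← mul_smul, ← op_mul, Lambda.e_mul_self]) (2 * (n + 1)) 0 0 (by lia)
  simpa using this

variable {M₀ M₁ M₂ : Type u} [AddCommGroup M₀] [Module (Lambda n q)ᵐᵒᵖ M₀] [AddCommGroup M₁]
  [Module (Lambda n q)ᵐᵒᵖ M₁] [AddCommGroup M₂] [Module (Lambda n q)ᵐᵒᵖ M₂]

/-- The main step in the proof of acyclicity: a diagram chase with Koszul complexes. -/
theorem KoszulExact.exists_eq_of_exact (hq : q ≠ 0) (h₀ : KoszulExact n q M₀)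
    (h₁ : KoszulExact n q M₁) (h₂ : KoszulExact n q M₂) (d : M₀ →ₗ[(Lambda n q)ᵐᵒᵖ] M₁)
    (d' : M₁ →ₗ[(Lambda n q)ᵐᵒᵖ] M₂) (hd : ∀ x, d' (d x) = 0)
    (hex : ∀ y, d' y = 0 → ∃ z, d z = y) {i : ZMod (n + 1)} (hi : i ≠ 0) (x : M₂)
    (hx : op (Lambda.e n q i) • x = x) (hu : ∃ y, d' y = op (Lambda.u n q) • x)
    (hv : ∃ y, d' y = op (Lambda.v n q) • x) : ∃ t, d' t = x := by
  obtain ⟨y₁, hy₁⟩ := hu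
  obtain ⟨y₂, hy₂⟩ := hv
  have hue : Lambda.u n q * Lambda.e n q (i + 1) = Lambda.e n q i * Lambda.u n q := by
    rw [Lambda.u_mul_e_eq, add_sub_cancel_right]
  have hve : Lambda.v n q * Lambda.e n q (i - 1) = Lambda.e n q i * Lambda.v n q := by
    rw [Lambda.v_mul_e_eq, sub_add_cancel]
  have hue' : Lambda.u n q * Lambda.e n q i = Lambda.e n q (i - 1) * Lambda.u n q :=
    Lambda.u_mul_e_eq n q i
  have hve' : Lambda.v n q * Lambda.e n q i = Lambda.e n q (i + 1) * Lambda.v n q :=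
    Lambda.v_mul_e_eq n q i
  -- Only the components of y₁ and y₂ at the vertices i + 1 and i - 1 matter.
  replace hy₁ : d' (op (Lambda.e n q (i + 1)) • y₁) = op (Lambda.u n q) • x := by
    rw [map_smul, hy₁, ← mul_smul, ← op_mul, hue, op_mul, mul_smul, hx]
  replace hy₂ : d' (op (Lambda.e n q (i - 1)) • y₂) = op (Lambda.v n q) • x := by
    rw [map_smul, hy₂, ← mul_smul, ← op_mul, hve, op_mul, mul_smul, hx]
  -- The defect w = y₂ u - q y₁ v of (y₁, y₂) from being a Koszul cycle. Its image under d' is x (vu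
  -- - quv) = 0, so w = d z for some z.
  set w := op (Lambda.u n q) • op (Lambda.e n q (i - 1)) • y₂ -
    op (q • Lambda.v n q) • op (Lambda.e n q (i + 1)) • y₁ with hw
  have hwe : op (Lambda.e n q i) • w = w := by
    rw [hw, smul_sub]
    simp only [← mul_smul, ← op_mul]
    rw [mul_assoc, hue', ← mul_assoc, Lambda.e_mul_self, mul_assoc, smul_mul_assoc, hve',
      mul_smul_comm, ← mul_assoc, Lambda.e_mul_self, mul_smul_comm]
  have hdw : d' w = 0 := by
    rw [hw, map_sub, map_smul d' (op (Lambda.u n q)), map_smul d' (op (q • Lambda.v n q)), hy₁, hy₂,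
      ← mul_smul, ← mul_smul, ← op_mul, ← op_mul, Lambda.v_mul_u, mul_smul_comm, sub_self]
  obtain ⟨z, hz⟩ := hex w hdw
  obtain ⟨z₁, z₂, hz'⟩ := h₀.exists_add i hi (op (Lambda.e n q i) • z)
    (by rw [← mul_smul, ← op_mul, Lambda.e_mul_self])
  replace hz : d (op (Lambda.e n q i) • z) = w := by rw [map_smul, hz, hwe]
  rw [hz', map_add, map_smul, map_smul, hw] at hz
  -- With z = z₂ u + z₁ v the corrected pair y₁ + q⁻¹ d z₁, y₂ - d z₂ is a cycle, with unchanged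
  -- images under d'. Middle exactness gives t with t u and t v equal to this pair.
  obtain ⟨t, ht₁, ht₂⟩ := h₁.exists_eq
    (op (Lambda.e n q (i + 1)) • y₁ + op (algebraMap k (Lambda n q) q⁻¹) • d z₁)
    (op (Lambda.e n q (i - 1)) • y₂ - d z₂) (by
      rw [smul_sub, smul_add, ← mul_smul (op (q • Lambda.v n q)) (op (algebraMap _ _ _)), ← op_mul,
        ← Algebra.smul_def, inv_smul_smul₀ hq, sub_eq_iff_eq_add, add_assoc,
        ← sub_eq_iff_eq_add', ← hz, add_comm])
  refine ⟨op (Lambda.e n q i) • t, ?_⟩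
  rw [← sub_eq_zero]
  -- The element d' (t e_i) - x lies at the vertex i and is killed by u and v.
  refine h₂.eq_zero i hi _ ?_ ?_ ?_
  · rw [smul_sub, hx, ← map_smul, ← mul_smul, ← op_mul, Lambda.e_mul_self]
  · rw [smul_sub, ← hy₁, ← map_smul, ← mul_smul, ← op_mul, ← hue, op_mul, mul_smul, ht₁, smul_add,
      map_add, map_smul _ _ (op (algebraMap _ _ _) • _), map_smul _ _ (d z₁), hd, smul_zero,
      smul_zero, add_zero, ← mul_smul, ← op_mul, Lambda.e_mul_self, sub_self]
  · rw [smul_sub, ← hy₂, ← map_smul, ← mul_smul, ← op_mul, ← hve, op_mul, mul_smul, ht₂, smul_sub,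
      map_sub, map_smul _ _ (d z₂), hd, smul_zero, sub_zero, ← mul_smul, ← op_mul,
      Lambda.e_mul_self, sub_self]

theorem exactAt_iff_forall_exists {R : Type u} [Ring R] (C : CochainComplex (ModuleCat.{u} R) ℤ)
    (i j l : ℤ) (hij : i + 1 = j) (hjl : j + 1 = l) :
    C.ExactAt j ↔ ∀ x : C.X j, C.d j l x = 0 → ∃ y : C.X i, C.d i j y = x := by
  rw [C.exactAt_iff' i j l (by simp; lia) (by simp; lia), ShortComplex.moduleCat_exact_iff]
  rfl

/-- A bounded below complex of Koszul exact modules is acyclic if it is acyclic at the vertex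
`0`. -/
theorem acyclic_of_koszulExact (hq : q ≠ 0) (C : CochainComplex (ModuleCat.{u} (Lambda n q)ᵐᵒᵖ) ℤ)
    (a : ℤ) [C.IsStrictlyGE a] (hC : ∀ i, KoszulExact n q (C.X i))
    (h₀ : ∀ i j l : ℤ, i + 1 = j → j + 1 = l → ∀ x : C.X j, op (Lambda.e n q 0) • x = x →
      C.d j l x = 0 → ∃ y : C.X i, C.d i j y = x) : C.Acyclic := by
  have hlow : ∀ i < a, C.ExactAt i := fun i hi =>
    HomologicalComplex.ExactAt.of_isZero (C.isZero_of_isStrictlyGE a i hi)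
  -- Exactness propagates upwards one degree at a time: `submodule_le_of_koszul` is applied to the
  -- boundaries and cycles in degree l, and the chase uses exactness in degree l - 1 only. Below a
  -- the complex is zero, which starts the induction.
  have step : ∀ i j l m : ℤ, i + 1 = j → j + 1 = l → l + 1 = m → C.ExactAt j → C.ExactAt l := by
    intro i j l m hij hjl hlm hj
    rw [exactAt_iff_forall_exists C i j l hij hjl] at hj
    rw [exactAt_iff_forall_exists C j l m hjl hlm]
    have := submodule_le_of_koszul (LinearMap.range (C.d j l).hom) (LinearMap.ker (C.d l m).hom)
      (fun x hx hx0 => h₀ j l m hjl hlm x hx0 hx)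
      (fun r hr x _ hxr hu hv => KoszulExact.exists_eq_of_exact hq (hC i) (hC j) (hC l)
        (C.d i j).hom (C.d j l).hom
        (fun z => congrArg (fun f => f.hom z) (C.d_comp_d i j l)) hj hr x hxr hu hv)
    exact fun x hx => this hx
  intro i
  by_cases hi : i < a
  · exact hlow i hi
  · obtain ⟨c, rfl⟩ := Int.le.dest (not_lt.1 hi)
    induction c with
    | zero => exact step (a - 2) (a - 1) _ (a + 1) (by lia) (by lia) (by lia) (hlow _ (by lia))
    | succ c ih =>
      exact step (a + c - 1) (a + c) _ (a + c + 2) (by lia) (by push_cast; lia) (by push_cast; lia)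
        (ih (by lia))

end Koszul

end

end QuantumKleinian

namespace QuantumKleinian

noncomputable section

/-! ### Adjunctions on complexes and on homotopy categories -/

section AdjunctionComplexes

universe v₁ v₂ u₁ u₂

variable {C : Type u₁} [Category.{v₁} C] [Preadditive C] {D : Type u₂} [Category.{v₂} D]
  [Preadditive D] {F : C ⥤ D} {G : D ⥤ C} [F.Additive] [G.Additive] (adj : F ⊣ G)
  {ι : Type*} (c : ComplexShape ι)

/-- The adjunction between categories of complexes induced by an adjunction of additive
functors. -/
def mapComplexAdjunction : F.mapHomologicalComplex c ⊣ G.mapHomologicalComplex c :=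
  Adjunction.mkOfUnitCounit
    { unit :=
        { app := fun K =>
            { f := fun i => adj.unit.app (K.X i)
              comm' := fun i j _ => (adj.unit.naturality (K.d i j)).symm }
          naturality := fun K L f => by
            ext i
            exact adj.unit.naturality (f.f i) }
      counit :=
        { app := fun K =>
            { f := fun i => adj.counit.app (K.X i)
              comm' := fun i j _ => (adj.counit.naturality (K.d i j)).symm }
          naturality := fun K L f => by
            ext i
            exact adj.counit.naturality (f.f i) }
      left_triangle := by
        ext K i
        change _ ≫ 𝟙 _ ≫ _ = 𝟙 _
        rw [Category.id_comp]
        exact adj.left_triangle_components (K.X i)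
      right_triangle := by
        ext K i
        change _ ≫ 𝟙 _ ≫ _ = 𝟙 _
        rw [Category.id_comp]
        exact adj.right_triangle_components (K.X i) }

instance isIso_mapComplexAdjunction_unit [IsIso adj.unit] (K : HomologicalComplex C c) :
    IsIso ((mapComplexAdjunction adj c).unit.app K) := by
  have : ∀ i, IsIso (((mapComplexAdjunction adj c).unit.app K).f i) := fun i =>
    inferInstanceAs (IsIso (adj.unit.app (K.X i)))
  exact HomologicalComplex.Hom.isIso_of_components _

instance isIso_mapComplexAdjunction_counit [IsIso adj.counit] (K : HomologicalComplex D c) :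
    IsIso ((mapComplexAdjunction adj c).counit.app K) := by
  have : ∀ i, IsIso (((mapComplexAdjunction adj c).counit.app K).f i) := fun i =>
    inferInstanceAs (IsIso (adj.counit.app (K.X i)))
  exact HomologicalComplex.Hom.isIso_of_components _

/-- The adjunction between homotopy categories induced by an adjunction of additive functors. -/
def mapHomotopyCategoryAdjunction : F.mapHomotopyCategory c ⊣ G.mapHomotopyCategory c :=
  Adjunction.mkOfUnitCounit
    { unit :=
        { app := fun K =>
            (HomotopyCategory.quotient C c).map ((mapComplexAdjunction adj c).unit.app K.as)
          naturality := by
            rintro ⟨K⟩ ⟨L⟩ ⟨f : K ⟶ L⟩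
            exact congrArg (HomotopyCategory.quotient C c).map
              ((mapComplexAdjunction adj c).unit.naturality f) }
      counit :=
        { app := fun K =>
            (HomotopyCategory.quotient D c).map ((mapComplexAdjunction adj c).counit.app K.as)
          naturality := by
            rintro ⟨K⟩ ⟨L⟩ ⟨f : K ⟶ L⟩
            exact congrArg (HomotopyCategory.quotient D c).map
              ((mapComplexAdjunction adj c).counit.naturality f) }
      left_triangle := by
        ext ⟨K⟩
        have h := congrArg (HomotopyCategory.quotient D c).map
          ((mapComplexAdjunction adj c).left_triangle_components K)
        rw [Functor.map_comp, CategoryTheory.Functor.map_id] at h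
        change _ ≫ 𝟙 _ ≫ _ = 𝟙 _
        rw [Category.id_comp]
        exact h
      right_triangle := by
        ext ⟨K⟩
        have h := congrArg (HomotopyCategory.quotient C c).map
          ((mapComplexAdjunction adj c).right_triangle_components K)
        rw [Functor.map_comp, CategoryTheory.Functor.map_id] at h
        change _ ≫ 𝟙 _ ≫ _ = 𝟙 _
        rw [Category.id_comp]
        exact h }

instance isIso_mapHomotopyCategoryAdjunction_unit [IsIso adj.unit] (K : HomotopyCategory C c) :
    IsIso ((mapHomotopyCategoryAdjunction adj c).unit.app K) :=
  inferInstanceAs (IsIso ((HomotopyCategory.quotient C c).map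
    ((mapComplexAdjunction adj c).unit.app K.as)))

instance isIso_mapHomotopyCategoryAdjunction_counit [IsIso adj.counit]
    (K : HomotopyCategory D c) : IsIso ((mapHomotopyCategoryAdjunction adj c).counit.app K) :=
  inferInstanceAs (IsIso ((HomotopyCategory.quotient D c).map
    ((mapComplexAdjunction adj c).counit.app K.as)))

end AdjunctionComplexes

/-! ### Objects such that a functor is bijective on morphisms from or to them -/

section HomBijective

universe v₁ v₂ u₁ u₂

variable {C : Type u₁} [Category.{v₁} C] {D : Type u₂} [Category.{v₂} D]

/-- The objects `X` such that `G` is bijective on morphisms out of `X`. -/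
def bijectiveFrom (G : D ⥤ C) : ObjectProperty D :=
  fun X => ∀ Y, Function.Bijective (G.map : (X ⟶ Y) → (G.obj X ⟶ G.obj Y))

/-- The objects `X` such that `G` is bijective on morphisms to `X`. -/
def bijectiveTo (G : D ⥤ C) : ObjectProperty D :=
  fun X => ∀ Y, Function.Bijective (G.map : (Y ⟶ X) → (G.obj Y ⟶ G.obj X))

theorem bijective_map_of_iso (G : D ⥤ C) {X X' Y Y' : D} (e : X ≅ X') (e' : Y ≅ Y')
    (h : Function.Bijective (G.map : (X ⟶ Y) → (G.obj X ⟶ G.obj Y))) :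
    Function.Bijective (G.map : (X' ⟶ Y') → (G.obj X' ⟶ G.obj Y')) := by
  have h' : (G.map : (X' ⟶ Y') → (G.obj X' ⟶ G.obj Y')) =
      (Iso.homCongr (G.mapIso e) (G.mapIso e')) ∘ G.map ∘ (Iso.homCongr e e').symm := by
    ext f
    simp [Iso.homCongr]
  rw [h']
  exact (Equiv.bijective _).comp (h.comp (Equiv.bijective _))

instance (G : D ⥤ C) : (bijectiveFrom G).IsClosedUnderIsomorphisms where
  of_iso e h Y := bijective_map_of_iso G e (Iso.refl Y) (h Y)

instance (G : D ⥤ C) : (bijectiveTo G).IsClosedUnderIsomorphisms where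
  of_iso e h Y := bijective_map_of_iso G (Iso.refl Y) e (h Y)

/-- The adjunction bijection is G on morphisms followed by composition with the unit. -/
theorem bijectiveFrom_of_isIso_unit {F : C ⥤ D} {G : D ⥤ C} (adj : F ⊣ G) (X : C)
    [IsIso (adj.unit.app X)] : bijectiveFrom G (F.obj X) := fun Y => by
  have h : (adj.homEquiv X Y : (F.obj X ⟶ Y) → (X ⟶ G.obj Y)) =
      (asIso (adj.unit.app X)).symm.homFromEquiv ∘ G.map := by
    ext f
    simp [Adjunction.homEquiv_unit]
  exact ((asIso (adj.unit.app X)).symm.homFromEquiv.bijective.of_comp_iff' _).1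
    (h ▸ (adj.homEquiv X Y).bijective)

theorem bijectiveTo_of_isIso_counit {G : D ⥤ C} {H : C ⥤ D} (adj : G ⊣ H) (X : C)
    [IsIso (adj.counit.app X)] : bijectiveTo G (H.obj X) := fun Y => by
  have h : ((adj.homEquiv Y X).symm : (Y ⟶ H.obj X) → (G.obj Y ⟶ X)) =
      (asIso (adj.counit.app X)).homToEquiv ∘ G.map := by
    ext f
    simp [Adjunction.homEquiv_counit]
  exact ((asIso (adj.counit.app X)).homToEquiv.bijective.of_comp_iff' _).1
    (h ▸ (adj.homEquiv Y X).symm.bijective)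

end HomBijective

/-! ### Bijectivity on morphisms in derived categories -/

section DerivedBijective

universe v₁ v₂ u₁ u₂

variable {C : Type u₁} [Category.{v₁} C] [Abelian C] [HasDerivedCategory.{w₁} C]
  {D : Type u₂} [Category.{v₂} D] [Abelian D] [HasDerivedCategory.{w₂} D]
  (G : D ⥤ C) [G.Additive] [PreservesFiniteLimits G] [PreservesFiniteColimits G]

/-- G on homotopy categories and G on derived categories form a commutative square with the two
localization maps; three bijective sides force the fourth. -/
theorem bijective_mapDerivedCategory_map (K L : HomotopyCategory D (.up ℤ))
    (h₁ : Function.Bijective (DerivedCategory.Qh.map : (K ⟶ L) → _))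
    (h₂ : Function.Bijective (DerivedCategory.Qh.map :
      ((G.mapHomotopyCategory _).obj K ⟶ (G.mapHomotopyCategory _).obj L) → _))
    (h₃ : Function.Bijective ((G.mapHomotopyCategory (.up ℤ)).map : (K ⟶ L) → _)) :
    Function.Bijective (G.mapDerivedCategory.map :
      (DerivedCategory.Qh.obj K ⟶ DerivedCategory.Qh.obj L) → _) := by
  rw [← h₁.of_comp_iff]
  let e := Iso.homCongr (G.mapDerivedCategoryFactorsh.app K) (G.mapDerivedCategoryFactorsh.app L)
  have h : e ∘ G.mapDerivedCategory.map ∘ (DerivedCategory.Qh.map : (K ⟶ L) → _) =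
      DerivedCategory.Qh.map ∘ (G.mapHomotopyCategory (.up ℤ)).map := by
    ext f
    have := G.mapDerivedCategoryFactorsh.hom.naturality f
    simp only [Functor.comp_map] at this
    simp [e, Iso.homCongr, this]
  exact (e.bijective.of_comp_iff' _).1 (h ▸ h₂.comp h₃)

theorem exists_iso_Qh_obj_quotient (X : DerivedCategory C) :
    ∃ K : CochainComplex C ℤ,
      Nonempty (DerivedCategory.Qh.obj ((HomotopyCategory.quotient _ _).obj K) ≅ X) :=
  ⟨_, ⟨(DerivedCategory.quotientCompQhIso C).app _ ≪≫ DerivedCategory.Q.objObjPreimageIso X⟩⟩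

variable {G}

/-- A functor with a left adjoint such that the unit is an isomorphism is bijective on morphisms
in the derived category from `F P`, if `P` and `F P` are K-projective. -/
theorem bijectiveFrom_mapDerivedCategory {F : C ⥤ D} [F.Additive] (adj : F ⊣ G) [IsIso adj.unit]
    (P : CochainComplex C ℤ) [P.IsKProjective]
    [CochainComplex.IsKProjective ((F.mapHomologicalComplex (.up ℤ)).obj P)] :
    bijectiveFrom G.mapDerivedCategory
      (DerivedCategory.Q.obj ((F.mapHomologicalComplex (.up ℤ)).obj P)) := by
  refine ObjectProperty.prop_of_iso _ ((DerivedCategory.quotientCompQhIso D).app _) fun Y => ?_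
  obtain ⟨L, ⟨e⟩⟩ := exists_iso_Qh_obj_quotient Y
  -- The unit P ≅ G F P makes the image of F P under G K-projective as well, so both localization
  -- maps in the square are bijective.
  have : CochainComplex.IsKProjective ((G.mapHomologicalComplex (.up ℤ)).obj
      ((F.mapHomologicalComplex (.up ℤ)).obj P)) :=
    CochainComplex.isKProjective_of_iso (K₁ := P) (asIso ((mapComplexAdjunction adj (.up ℤ)).unit.app P))
  refine bijective_map_of_iso _ (Iso.refl _) e (bijective_mapDerivedCategory_map G _ _
    (CochainComplex.IsKProjective.Qh_map_bijective _ _)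
    (CochainComplex.IsKProjective.Qh_map_bijective ((G.mapHomologicalComplex (.up ℤ)).obj
      ((F.mapHomologicalComplex (.up ℤ)).obj P)) _) ?_)
  exact bijectiveFrom_of_isIso_unit (mapHomotopyCategoryAdjunction adj (.up ℤ))
    ((HomotopyCategory.quotient _ _).obj P) _

/-- Dual argument: G H E ≅ E by the counit, so it is K-injective together with H E. -/
theorem bijectiveTo_mapDerivedCategory {H : C ⥤ D} [H.Additive] (adj : G ⊣ H) [IsIso adj.counit]
    (E : CochainComplex C ℤ) [E.IsKInjective]
    [CochainComplex.IsKInjective ((H.mapHomologicalComplex (.up ℤ)).obj E)] :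
    bijectiveTo G.mapDerivedCategory
      (DerivedCategory.Q.obj ((H.mapHomologicalComplex (.up ℤ)).obj E)) := by
  refine ObjectProperty.prop_of_iso _ ((DerivedCategory.quotientCompQhIso D).app _) fun Y => ?_
  obtain ⟨L, ⟨e⟩⟩ := exists_iso_Qh_obj_quotient Y
  have : CochainComplex.IsKInjective ((G.mapHomologicalComplex (.up ℤ)).obj
      ((H.mapHomologicalComplex (.up ℤ)).obj E)) :=
    CochainComplex.isKInjective_of_iso (L₁ := E)
      (asIso ((mapComplexAdjunction adj (.up ℤ)).counit.app E)).symm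
  refine bijective_map_of_iso _ e (Iso.refl _) (bijective_mapDerivedCategory_map G _ _
    (CochainComplex.IsKInjective.Qh_map_bijective _ _)
    (CochainComplex.IsKInjective.Qh_map_bijective _ ((G.mapHomologicalComplex (.up ℤ)).obj
      ((H.mapHomologicalComplex (.up ℤ)).obj E))) ?_)
  exact bijectiveTo_of_isIso_counit (mapHomotopyCategoryAdjunction adj (.up ℤ))
    ((HomotopyCategory.quotient _ _).obj E) _

end DerivedBijective

end

end QuantumKleinian

namespace QuantumKleinian

noncomputable section

/-! ### Kan extensions along functors that are full on enough objects -/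

section KanExtension

universe v₁ v₂ v₃ u₁ u₂ u₃

variable {C : Type u₁} [Category.{v₁} C] {D : Type u₂} [Category.{v₂} D]
  {H : Type u₃} [Category.{v₃} H]

/-- Each object X is isomorphic to some W K with K in S, where α is invertible. So β can only be
induced by G X ≅ G W K → Φ K ≅ L W K ≅ L X, and lifting morphisms through W makes this natural. -/
theorem isRightKanExtension_of_isIso {W : C ⥤ D} {L : D ⥤ H} {Φ : C ⥤ H} (α : W ⋙ L ⟶ Φ)
    (S : ObjectProperty C) (hα : ∀ K, S K → IsIso (α.app K))
    (hs : ∀ X, ∃ K, S K ∧ Nonempty (X ≅ W.obj K))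
    (hfull : ∀ K K', S K → ∀ f : W.obj K ⟶ W.obj K', ∃ g, W.map g = f) :
    L.IsRightKanExtension α := by
  choose p hp e' using hs
  have e := fun X => (e' X).some
  have : ∀ X, IsIso (α.app (p X)) := fun X => hα _ (hp X)
  have nat : ∀ {K K' : C} (g : K ⟶ K'), L.map (W.map g) ≫ α.app K' = α.app K ≫ Φ.map g :=
    fun g => α.naturality g
  have nat' : ∀ {K K' : C} (g : K ⟶ K') [IsIso (α.app K)] [IsIso (α.app K')],
      inv (α.app K) ≫ L.map (W.map g) = Φ.map g ≫ inv (α.app K') := fun g _ _ => by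
    rw [IsIso.inv_comp_eq, ← Category.assoc, IsIso.eq_comp_inv, nat]
  let γ (G : D ⥤ H) (β : W ⋙ G ⟶ Φ) : G ⟶ L :=
    { app := fun X => G.map (e X).hom ≫ β.app (p X) ≫ inv (α.app (p X)) ≫ L.map (e X).inv
      naturality := fun X Y f => by
        obtain ⟨g, hg⟩ := hfull _ _ (hp X) ((e X).inv ≫ f ≫ (e Y).hom)
        have h₁ : f ≫ (e Y).hom = (e X).hom ≫ W.map g := by simp [hg]
        have h₂ : (e X).inv ≫ f = W.map g ≫ (e Y).inv := by simp [hg]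
        have h₃ : G.map (W.map g) ≫ β.app (p Y) = β.app (p X) ≫ Φ.map g := β.naturality g
        simp only [Category.assoc]
        rw [← L.map_comp, h₂, ← G.map_comp_assoc, h₁, G.map_comp, L.map_comp, Category.assoc,
          reassoc_of% h₃, reassoc_of% (nat' g)] }
  have hγ : ∀ (G : D ⥤ H) (β : W ⋙ G ⟶ Φ), Functor.whiskerLeft W (γ G β) ≫ α = β := by
    intro G β
    ext K
    -- K itself need not lie in S. The lifted map from the chosen model of W K to K reduces the
    -- triangle at K to the model.
    obtain ⟨g, hg⟩ := hfull _ _ (hp (W.obj K)) (e (W.obj K)).inv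
    have h₃ : G.map (W.map g) ≫ β.app K = β.app (p (W.obj K)) ≫ Φ.map g := β.naturality g
    have h₄ : G.map (e (W.obj K)).hom ≫ G.map (W.map g) = 𝟙 _ := by
      rw [hg, ← G.map_comp, Iso.hom_inv_id, G.map_id]
    change (G.map _ ≫ β.app _ ≫ inv (α.app _) ≫ L.map _) ≫ α.app K = β.app K
    rw [← hg, Category.assoc, Category.assoc, Category.assoc, nat g, IsIso.inv_hom_id_assoc, ← h₃,
      reassoc_of% h₄]
  have huniq : ∀ (G : D ⥤ H) (β : W ⋙ G ⟶ Φ) (μ : G ⟶ L), Functor.whiskerLeft W μ ≫ α = β →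
      μ = γ G β := by
    rintro G _ μ rfl
    ext X
    change μ.app X = G.map _ ≫ (μ.app _ ≫ α.app _) ≫ inv (α.app _) ≫ L.map _
    rw [Category.assoc, IsIso.hom_inv_id_assoc, μ.naturality_assoc, ← L.map_comp, Iso.hom_inv_id,
      L.map_id, Category.comp_id]
  exact ⟨⟨IsTerminal.ofUniqueHom (fun Y => CostructuredArrow.homMk (γ Y.left Y.hom)
    (hγ Y.left Y.hom)) fun Y m => CostructuredArrow.hom_ext _ _
      (huniq Y.left Y.hom m.left (CostructuredArrow.w m))⟩⟩

end KanExtension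

/-! ### Relative adjunctions from bijectivity on morphisms -/

section Relative

universe v₁ v₂ v₃ u₁ u₂ u₃

variable {P : Type u₁} [Category.{v₁} P] {T : Type u₂} [Category.{v₂} T]
  {D : Type u₃} [Category.{v₃} D] {ι : P ⥤ T} {F : P ⥤ D} {G : D ⥤ T}

/-- The relative adjunction with unit `η`. -/
def RelativeAdjunction.ofIso (η : ι ≅ F ⋙ G) (h : ∀ X, bijectiveFrom G (F.obj X)) :
    RelativeAdjunction ι F G where
  homEquiv X Y := (Equiv.ofBijective _ (h X Y)).trans (η.app X).symm.homFromEquiv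
  naturality_left f g := by
    have := η.hom.naturality f
    simp only [Functor.comp_map] at this
    simp [reassoc_of% this]
  naturality_right g h := by simp

theorem RelativeAdjunction.ofIso_unit (η : ι ≅ F ⋙ G) (h : ∀ X, bijectiveFrom G (F.obj X)) :
    (RelativeAdjunction.ofIso η h).unit = η.hom := by
  ext X
  simp [RelativeAdjunction.unit, RelativeAdjunction.ofIso]

section

universe v₄ u₄

variable {C : Type u₄} [Category.{v₄} C] {W : C ⥤ P} {Φ : C ⥤ D}

/-- The natural transformation `W ⋙ F ⟶ Φ` that corresponds to `W ⋙ ι ⟶ Φ ⋙ G` under a relative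
adjunction. -/
def RelativeAdjunction.mate (a : RelativeAdjunction ι F G) (θ : W ⋙ ι ⟶ Φ ⋙ G) : W ⋙ F ⟶ Φ where
  app K := (a.homEquiv (W.obj K) (Φ.obj K)).symm (θ.app K)
  naturality K K' f := (a.homEquiv (W.obj K) (Φ.obj K')).injective (by
    refine (a.naturality_left (W.map f) _).trans (Eq.trans ?_ (a.naturality_right _ _).symm)
    rw [Equiv.apply_symm_apply, Equiv.apply_symm_apply]
    exact θ.naturality f)

theorem RelativeAdjunction.isIso_map_mate_ofIso_app (η : ι ≅ F ⋙ G)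
    (h : ∀ X, bijectiveFrom G (F.obj X)) (θ : W ⋙ ι ⟶ Φ ⋙ G) (K : C) [IsIso (θ.app K)] :
    IsIso (G.map (((RelativeAdjunction.ofIso η h).mate θ).app K)) := by
  have h' : η.hom.app (W.obj K) ≫ G.map (((RelativeAdjunction.ofIso η h).mate θ).app K) =
      θ.app K := ((RelativeAdjunction.ofIso η h).homEquiv _ _).apply_symm_apply _
  have : IsIso (η.hom.app (W.obj K) ≫
      G.map (((RelativeAdjunction.ofIso η h).mate θ).app K)) := h' ▸ inferInstance
  exact IsIso.of_isIso_comp_left (η.hom.app (W.obj K)) _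

end

/-- The relative coadjunction with counit `η⁻¹`. -/
def RelativeCoadjunction.ofIso (η : ι ≅ F ⋙ G) (h : ∀ X, bijectiveTo G (F.obj X)) :
    RelativeCoadjunction ι F G where
  homEquiv Y X := ((Equiv.ofBijective _ (h X Y)).trans (η.app X).symm.homToEquiv).symm
  naturality_left {Y Y' X} h' g := by
    rw [Equiv.symm_apply_eq]
    obtain ⟨g, rfl⟩ := ((Equiv.ofBijective _ (h X Y)).trans (η.app X).symm.homToEquiv).surjective g
    rw [Equiv.symm_apply_apply]
    simp
  naturality_right {Y X X'} g f := by
    rw [Equiv.symm_apply_eq]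
    obtain ⟨g, rfl⟩ := ((Equiv.ofBijective _ (h X Y)).trans (η.app X).symm.homToEquiv).surjective g
    rw [Equiv.symm_apply_apply]
    have := η.inv.naturality f
    simp only [Functor.comp_map] at this
    simp [this]

theorem isIso_of_bijectiveFrom {X Y : D} (hX : bijectiveFrom G X) (hY : bijectiveFrom G Y)
    (f : X ⟶ Y) [IsIso (G.map f)] : IsIso f := by
  obtain ⟨g, hg⟩ := (hY X).2 (inv (G.map f))
  exact ⟨g, (hX X).1 (by simp [hg]), (hY Y).1 (by simp [hg])⟩

theorem bijectiveFrom_lift {𝒟 : ObjectProperty D} {𝒯 : ObjectProperty T}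
    (hG : ∀ X : 𝒟.FullSubcategory, 𝒯 (G.obj X.obj)) (X : 𝒟.FullSubcategory)
    (hX : bijectiveFrom G X.obj) : bijectiveFrom (𝒯.lift (𝒟.ι ⋙ G) hG) X := fun Y =>
  ⟨fun f g h => InducedCategory.hom_ext ((hX Y.obj).1 (congrArg (fun f => f.hom) h)), fun f => by
    obtain ⟨g, hg⟩ := (hX Y.obj).2 f.hom
    exact ⟨ObjectProperty.homMk g, InducedCategory.hom_ext hg⟩⟩

theorem bijectiveTo_lift {𝒟 : ObjectProperty D} {𝒯 : ObjectProperty T}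
    (hG : ∀ X : 𝒟.FullSubcategory, 𝒯 (G.obj X.obj)) (X : 𝒟.FullSubcategory)
    (hX : bijectiveTo G X.obj) : bijectiveTo (𝒯.lift (𝒟.ι ⋙ G) hG) X := fun Y =>
  ⟨fun f g h => InducedCategory.hom_ext ((hX Y.obj).1 (congrArg (fun f => f.hom) h)), fun f => by
    obtain ⟨g, hg⟩ := (hX Y.obj).2 f.hom
    exact ⟨ObjectProperty.homMk g, InducedCategory.hom_ext hg⟩⟩

section Triangulated

variable [HasZeroObject P] [HasShift P ℤ] [Preadditive P]
  [∀ n : ℤ, (shiftFunctor P n).Additive] [Pretriangulated P]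
  [HasZeroObject T] [HasShift T ℤ] [Preadditive T]
  [∀ n : ℤ, (shiftFunctor T n).Additive] [Pretriangulated T]
  [HasZeroObject D] [HasShift D ℤ] [Preadditive D]
  [∀ n : ℤ, (shiftFunctor D n).Additive] [Pretriangulated D]

/-- Everything in a weakly crepant resolution is formal once G F is the inclusion and G is bijective
on morphisms from and to the objects F X: each adjunction bijection is G composed with η. -/
theorem isWeaklyCrepantResolution_of_iso [F.CommShift ℤ] [F.IsTriangulated] [G.CommShift ℤ]
    [G.IsTriangulated] (η : ι ≅ F ⋙ G) (h : ∀ X, bijectiveFrom G (F.obj X))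
    (hto : ∀ X, bijectiveTo G (F.obj X)) : IsWeaklyCrepantResolution ι F G where
  triangulated_up := ⟨inferInstance, inferInstance⟩
  triangulated_down := ⟨inferInstance, inferInstance⟩
  adjoint := ⟨.ofIso η h, by rw [RelativeAdjunction.ofIso_unit]; infer_instance⟩
  crepant := ⟨.ofIso η hto⟩

/-- Version of `isWeaklyCrepantResolution_of_iso` for triangulated subcategories. -/
theorem isWeaklyCrepantResolution_lift {𝒬 : ObjectProperty T} [𝒬.IsTriangulated]
    {F : 𝒬.FullSubcategory ⥤ D} [F.CommShift ℤ] [F.IsTriangulated]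
    [G.CommShift ℤ] [G.IsTriangulated] (η : 𝒬.ι ≅ F ⋙ G) (h : ∀ X, bijectiveFrom G (F.obj X))
    (hto : ∀ X, bijectiveTo G (F.obj X)) {𝒟 : ObjectProperty D} {𝒯 : ObjectProperty T}
    [𝒟.IsTriangulated] [𝒯.IsTriangulated] (hle : 𝒬 ≤ 𝒯) (hF : ∀ X, 𝒟 (F.obj X))
    (hG : ∀ X : 𝒟.FullSubcategory, 𝒯 (G.obj X.obj)) :
    IsWeaklyCrepantResolution (ObjectProperty.ιOfLE hle) (𝒟.lift F hF)
      (𝒯.lift (𝒟.ι ⋙ G) hG) :=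
  isWeaklyCrepantResolution_of_iso
    (NatIso.ofComponents (fun X => 𝒯.isoMk (η.app X)) fun f =>
      InducedCategory.hom_ext (η.hom.naturality f))
    (fun X => bijectiveFrom_lift hG _ (h X)) (fun X => bijectiveTo_lift hG _ (hto X))

variable (F) in
theorem exists_isTriangulated_inv [F.IsEquivalence] [F.CommShift ℤ] [F.IsTriangulated] :
    ∃ _ : F.inv.CommShift ℤ, F.inv.IsTriangulated := by
  let adj : F ⊣ F.inv := F.asEquivalence.toAdjunction
  let _ := adj.rightAdjointCommShift ℤ
  have := adj.commShift_of_leftAdjoint ℤ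
  exact ⟨inferInstance, adj.isTriangulated_rightAdjoint⟩

/-- A triangulated functor that is fully faithful on `𝒟` with image `𝒬` has an inverse on `𝒬`,
which is a triangulated functor. -/
theorem exists_inverse_on [G.CommShift ℤ] [G.IsTriangulated] (𝒟 : ObjectProperty D)
    (𝒬 : ObjectProperty T) [𝒟.IsTriangulated] [𝒬.IsTriangulated] (h : 𝒟 ≤ bijectiveFrom G)
    (hG : ∀ X, 𝒟 X → 𝒬 (G.obj X)) (hs : ∀ Y, 𝒬 Y → ∃ X, 𝒟 X ∧ Nonempty (G.obj X ≅ Y)) :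
    ∃ L : 𝒬.FullSubcategory ⥤ D, (∀ X, 𝒟 (L.obj X)) ∧ Nonempty (𝒬.ι ≅ L ⋙ G) ∧
      ∃ _ : L.CommShift ℤ, L.IsTriangulated := by
  -- The restriction of G to 𝒟 → 𝒬 is an equivalence of triangulated categories, so its inverse
  -- inherits the shift structure and exactness as an adjoint.
  let G' := 𝒬.lift (𝒟.ι ⋙ G) fun X => hG _ X.property
  have hG' : ∀ X, bijectiveFrom G' X := fun X =>
    bijectiveFrom_lift _ X (h _ X.property)
  have : G'.Faithful := ⟨fun h => (hG' _ _).1 h⟩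
  have : G'.Full := ⟨fun f => (hG' _ _).2 f⟩
  have : G'.EssSurj := ⟨fun Y => by
    obtain ⟨X, hX, ⟨e⟩⟩ := hs Y.obj Y.property
    exact ⟨⟨X, hX⟩, ⟨𝒬.isoMk e⟩⟩⟩
  have : G'.IsEquivalence := { }
  obtain ⟨_, _⟩ := exists_isTriangulated_inv G'
  exact ⟨G'.inv ⋙ 𝒟.ι, fun X => (G'.inv.obj X).property,
    ⟨Functor.isoWhiskerRight G'.asEquivalence.counitIso.symm 𝒬.ι⟩, inferInstance, inferInstance⟩

end Triangulated

end Relative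

end

end QuantumKleinian

namespace QuantumKleinian

noncomputable section

/-! ### Quasi-isomorphisms and mapping cones -/

theorem quasiIso_iff_acyclic_mappingCone {C : Type*} [Category* C] [Abelian C]
    {K L : CochainComplex C ℤ} (f : K ⟶ L) :
    QuasiIso f ↔ (CochainComplex.mappingCone f).Acyclic := by
  have h := ObjectProperty.trW_iff_of_distinguished (HomotopyCategory.subcategoryAcyclic C) _
    (HomotopyCategory.mappingCone_triangleh_distinguished f)
  rw [← HomotopyCategory.quasiIso_eq_trW_subcategoryAcyclic] at h
  change HomotopyCategory.quasiIso C _ ((HomotopyCategory.quotient _ _).map f) ↔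
    HomotopyCategory.subcategoryAcyclic C ((HomotopyCategory.quotient _ _).obj _) at h
  rwa [HomotopyCategory.quotient_map_mem_quasiIso_iff, HomologicalComplex.mem_quasiIso_iff,
    HomotopyCategory.quotient_obj_mem_subcategoryAcyclic_iff_acyclic] at h

theorem isStrictlyGE_mapHomologicalComplex {C D : Type*} [Category* C] [Preadditive C]
    [HasZeroObject C] [Category* D]
    [Preadditive D] [HasZeroObject D] (F : C ⥤ D) [F.Additive] (K : CochainComplex C ℤ) (a : ℤ)
    [K.IsStrictlyGE a] :
    CochainComplex.IsStrictlyGE ((F.mapHomologicalComplex (.up ℤ)).obj K) a := by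
  rw [CochainComplex.isStrictlyGE_iff]
  exact fun i hi => F.map_isZero (K.isZero_of_isStrictlyGE a i hi)

theorem isStrictlyLE_mapHomologicalComplex {C D : Type*} [Category* C] [Preadditive C]
    [HasZeroObject C] [Category* D]
    [Preadditive D] [HasZeroObject D] (F : C ⥤ D) [F.Additive] (K : CochainComplex C ℤ) (a : ℤ)
    [K.IsStrictlyLE a] :
    CochainComplex.IsStrictlyLE ((F.mapHomologicalComplex (.up ℤ)).obj K) a := by
  rw [CochainComplex.isStrictlyLE_iff]
  exact fun i hi => F.map_isZero (K.isZero_of_isStrictlyLE a i hi)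

/-! ### `ψ^*` on strictly perfect complexes -/

section PullbackPerfect

variable {k : Type u} [Field k] {n : ℕ} {ζ : k} (q : k) (hζ : IsPrimitiveRoot ζ (n + 1))

/-- The functor `ψ^*` on complexes. -/
abbrev psiUpperStarComplex : CochainComplex (ModuleCat.{u} (B q ζ)ᵐᵒᵖ) ℤ ⥤
    CochainComplex (ModuleCat.{u} (Lambda n q)ᵐᵒᵖ) ℤ :=
  (psiUpperStar q hζ).mapHomologicalComplex (.up ℤ)

/-- The functor `ψ_*` on complexes. -/
abbrev psiLowerStarComplex : CochainComplex (ModuleCat.{u} (Lambda n q)ᵐᵒᵖ) ℤ ⥤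
    CochainComplex (ModuleCat.{u} (B q ζ)ᵐᵒᵖ) ℤ :=
  (psiLowerStar q hζ).mapHomologicalComplex (.up ℤ)

/-- The functor `ψ^!` on complexes. -/
abbrev psiUpperShriekComplex : CochainComplex (ModuleCat.{u} (B q ζ)ᵐᵒᵖ) ℤ ⥤
    CochainComplex (ModuleCat.{u} (Lambda n q)ᵐᵒᵖ) ℤ :=
  (psiUpperShriek q hζ).mapHomologicalComplex (.up ℤ)

/-- The isomorphism `K ≅ ψ_* ψ^* K` for complexes. -/
def psiUnitIso (K : CochainComplex (ModuleCat.{u} (B q ζ)ᵐᵒᵖ) ℤ) :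
    K ≅ (psiLowerStarComplex q hζ).obj ((psiUpperStarComplex q hζ).obj K) :=
  asIso ((mapComplexAdjunction (psiUpperStarAdjunction q hζ) (.up ℤ)).unit.app K)

/-- The right adjoint ψ_* is exact, so ψ^* preserves projectives; e_0 Λ is finitely generated, so
ψ^* preserves finite generation. -/
theorem IsStrictlyPerfect.psiUpperStar {P : CochainComplex (ModuleCat.{u} (B q ζ)ᵐᵒᵖ) ℤ}
    (hP : IsStrictlyPerfect P) : IsStrictlyPerfect ((psiUpperStarComplex q hζ).obj P) := by
  obtain ⟨⟨a, b, ha, hb⟩, hf, hp⟩ := hP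
  refine ⟨⟨a, b, isStrictlyGE_mapHomologicalComplex _ P a,
    isStrictlyLE_mapHomologicalComplex _ P b⟩, fun i => ?_, fun i => ?_⟩
  · have := hf i
    exact inferInstanceAs (Module.Finite (Lambda n q)ᵐᵒᵖ
      (BalancedTensor (B q ζ) (P.X i) (E0Lambda q hζ)))
  · exact (IsProjective.iff_projective _).2 ((psiUpperStarAdjunction q hζ).map_projective _
      ((IsProjective.iff_projective _).1 (hp i)))

variable {q}

/-- For a strictly perfect complex `P` with injective resolution `P → E`, the induced map
`ψ^* P → ψ^! E` is a quasi-isomorphism. -/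
theorem quasiIso_to_psiUpperShriek (hq : q ≠ 0)
    {P E : CochainComplex (ModuleCat.{u} (B q ζ)ᵐᵒᵖ) ℤ} (hP : IsStrictlyPerfect P) (a : ℤ)
    [P.IsStrictlyGE a] [E.IsStrictlyGE a] [∀ i, Injective (E.X i)] (f : P ⟶ E) [QuasiIso f]
    (φ : (psiUpperStarComplex q hζ).obj P ⟶ (psiUpperShriekComplex q hζ).obj E)
    (hφ : (psiLowerStarComplex q hζ).map φ ≫
      (mapComplexAdjunction (psiUpperShriekAdjunction q hζ) (.up ℤ)).counit.app E =
        (psiUnitIso q hζ P).inv ≫ f) : QuasiIso φ := by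
  -- Up to the invertible unit and counit the map ψ_* φ is f.
  have hφ' : QuasiIso ((psiLowerStarComplex q hζ).map φ) := by
    rw [← IsIso.eq_comp_inv] at hφ
    rw [hφ]
    infer_instance
  rw [quasiIso_iff_acyclic_mappingCone] at hφ' ⊢
  have := isStrictlyGE_mapHomologicalComplex (psiUpperStar q hζ) P a
  have := isStrictlyGE_mapHomologicalComplex (psiUpperShriek q hζ) E a
  have : (CochainComplex.mappingCone φ).IsStrictlyGE (a - 1) :=
    CochainComplex.isStrictlyGE_mappingCone φ a a _ (by lia) (by lia)
  refine acyclic_of_koszulExact hq _ (a - 1) (fun i => ?_) fun i j l hij hjl x hx hd => ?_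
  · have := hP.finite (i + 1)
    have := hP.projective (i + 1)
    let e : (CochainComplex.mappingCone φ).X i ≃ₗ[(Lambda n q)ᵐᵒᵖ]
        ((psiUpperStarComplex q hζ).obj P).X (i + 1) × ((psiUpperShriekComplex q hζ).obj E).X i :=
      (HomologicalComplex.homotopyCofiber.XIsoBiprod φ i (i + 1) rfl ≪≫
        ModuleCat.biprodIsoProd _ _).toLinearEquiv
    exact ((koszulExact_balancedTensor hq hζ (P.X (i + 1))).prod
      (koszulExact_psiUpperShriek hq hζ (E.X i))).of_retract e.toLinearMap e.symm.toLinearMap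
        (LinearMap.ext fun x => e.symm_apply_apply x)
  -- ψ_* commutes with cones, so ψ_* of the cone is acyclic. A cycle x = x e_0 of the cone is the
  -- same as the cycle r ↦ x r of ψ_*, and evaluating a primitive at e_0 shows that x is a boundary.
  · have hac : HomologicalComplex.Acyclic
        ((psiLowerStarComplex q hζ).obj (CochainComplex.mappingCone φ)) := fun i =>
      (hφ' i).of_iso (CochainComplex.mappingCone.mapHomologicalComplexIso φ _).symm
    let g : E0Lambda q hζ →ₗ[(Lambda n q)ᵐᵒᵖ] (CochainComplex.mappingCone φ).X j :=
      { toFun := fun r => op r.1 • x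
        map_add' := fun r s => by rw [← add_smul]; rfl
        map_smul' := fun c r => by rw [RingHom.id_apply, ← mul_smul]; rfl }
    obtain ⟨y, hy⟩ := (exactAt_iff_forall_exists _ i j l hij hjl).1 (hac j) g
      (LinearMap.ext (M := E0Lambda q hζ) fun r => by
        change (CochainComplex.mappingCone φ).d j l (op r.1 • x) = 0
        rw [map_smul, hd, smul_zero])
    let y' : E0Lambda q hζ →ₗ[(Lambda n q)ᵐᵒᵖ] (CochainComplex.mappingCone φ).X i := y
    exact ⟨y' (rowGen q hζ), (DFunLike.congr_fun (F := E0Lambda q hζ →ₗ[(Lambda n q)ᵐᵒᵖ]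
      (CochainComplex.mappingCone φ).X j) hy (rowGen q hζ)).trans hx⟩

variable [HasDerivedCategory.{w₁} (ModuleCat.{u} (B q ζ)ᵐᵒᵖ)]
  [HasDerivedCategory.{w₂} (ModuleCat.{u} (Lambda n q)ᵐᵒᵖ)]

theorem bijectiveFrom_psiUpperStar {P : CochainComplex (ModuleCat.{u} (B q ζ)ᵐᵒᵖ) ℤ}
    (hP : IsStrictlyPerfect P) : bijectiveFrom (derivedPsiLowerStar q hζ)
      (DerivedCategory.Q.obj ((psiUpperStarComplex q hζ).obj P)) := by
  have := hP.isKProjective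
  have := (hP.psiUpperStar q hζ).isKProjective
  exact bijectiveFrom_mapDerivedCategory (psiUpperStarAdjunction q hζ) P

/-- This is crepancy: in the derived category ψ^* P is isomorphic to ψ^! E for an injective
resolution E of P, and for ψ^! E bijectivity follows from the adjunction ψ_* ⊣ ψ^!. Injectives and
K-injectivity are preserved since ψ^! is right adjoint to an exact functor and E is bounded below.
-/
theorem bijectiveTo_psiUpperStar (hq : q ≠ 0) {P : CochainComplex (ModuleCat.{u} (B q ζ)ᵐᵒᵖ) ℤ}
    (hP : IsStrictlyPerfect P) : bijectiveTo (derivedPsiLowerStar q hζ)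
      (DerivedCategory.Q.obj ((psiUpperStarComplex q hζ).obj P)) := by
  obtain ⟨a, _, _, _⟩ := hP.bounded
  obtain ⟨E, f, _, _, _⟩ :=
    CochainComplex.Plus.modelCategoryQuillen.exists_quasiIso_injective P a
  let adj := mapComplexAdjunction (psiUpperShriekAdjunction q hζ) (.up ℤ)
  let φ : (psiUpperStarComplex q hζ).obj P ⟶ (psiUpperShriekComplex q hζ).obj E :=
    adj.homEquiv _ _ ((psiUnitIso q hζ P).inv ≫ f)
  have : QuasiIso φ := quasiIso_to_psiUpperShriek hζ hq hP a f φ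
    ((adj.homEquiv_counit _ _ _).symm.trans (Equiv.symm_apply_apply _ _))
  have := isStrictlyGE_mapHomologicalComplex (psiUpperShriek q hζ) E a
  have : ∀ i, Injective (((psiUpperShriekComplex q hζ).obj E).X i) := fun i =>
    (psiUpperShriekAdjunction q hζ).map_injective (E.X i) inferInstance
  have := CochainComplex.isKInjective_of_injective E a
  have := CochainComplex.isKInjective_of_injective ((psiUpperShriekComplex q hζ).obj E) a
  exact ObjectProperty.prop_of_iso _ (asIso (DerivedCategory.Q.map φ)).symm
    (bijectiveTo_mapDerivedCategory (psiUpperShriekAdjunction q hζ) E)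

end PullbackPerfect

end

end QuantumKleinian

namespace QuantumKleinian

noncomputable section

/-! ### Perfect complexes over noetherian rings -/

theorem isNoetherian_homology {R : Type u} [Ring R] (K : CochainComplex (ModuleCat.{u} R) ℤ)
    (i : ℤ) [IsNoetherian R (K.X i)] : IsNoetherian R (K.homology i) := by
  have : IsNoetherian R (K.cycles i) := isNoetherian_of_injective (K.iCycles i).hom
    ((ModuleCat.mono_iff_injective _).1 inferInstance)
  exact isNoetherian_of_surjective (f := (K.homologyπ i).hom)
    (LinearMap.range_eq_top.2 ((ModuleCat.epi_iff_surjective _).1 inferInstance))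

theorem perfect_le_boundedCoherent (R : Type u) [Ring R] [IsNoetherianRing R]
    [HasDerivedCategory.{w₁} (ModuleCat.{u} R)] : perfect R ≤ boundedCoherent R := by
  rintro X ⟨K, ⟨⟨a, b, _, _⟩, hf, -⟩, ⟨e⟩⟩
  refine ObjectProperty.prop_of_iso _ e.symm ?_
  have e' : ∀ i, (DerivedCategory.homologyFunctor (ModuleCat.{u} R) i).obj
      (DerivedCategory.Q.obj K) ≅ K.homology i := fun i =>
    (DerivedCategory.homologyFunctorFactors _ i).app K
  refine ⟨⟨a, b, fun i hi => IsZero.of_iso ?_ (e' i)⟩, fun i => ?_⟩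
  · rw [← HomologicalComplex.exactAt_iff_isZero_homology]
    refine HomologicalComplex.ExactAt.of_isZero ?_
    rcases hi with hi | hi
    · exact K.isZero_of_isStrictlyGE a i hi
    · exact K.isZero_of_isStrictlyLE b i hi
  · have := hf i
    have : IsNoetherian R (K.X i) := isNoetherian_of_isNoetherianRing_of_finite _ _
    have := isNoetherian_homology K i
    exact isNoetherian_of_linearEquiv (e' i).symm.toLinearEquiv

section PullbackPerfect

variable {k : Type u} [Field k] {n : ℕ} {ζ : k} (q : k) (hζ : IsPrimitiveRoot ζ (n + 1))
  [HasDerivedCategory.{w₂} (ModuleCat.{u} (Lambda n q)ᵐᵒᵖ)]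

/-- The objects of `D(Λ)` of the form `ψ^* P` with `P` strictly perfect. -/
def pullbackPerfect : ObjectProperty (DerivedCategory (ModuleCat.{u} (Lambda n q)ᵐᵒᵖ)) :=
  fun X => ∃ P : CochainComplex (ModuleCat.{u} (B q ζ)ᵐᵒᵖ) ℤ, IsStrictlyPerfect P ∧
    Nonempty (X ≅ DerivedCategory.Q.obj ((psiUpperStarComplex q hζ).obj P))

theorem pullbackPerfect_le_perfect : pullbackPerfect q hζ ≤ perfect (Lambda n q)ᵐᵒᵖ := by
  rintro X ⟨P, hP, e⟩
  exact ⟨_, hP.psiUpperStar q hζ, e⟩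

variable [HasDerivedCategory.{w₁} (ModuleCat.{u} (B q ζ)ᵐᵒᵖ)]

/-- The isomorphism `H^i(ψ_* F) ≅ ψ_* H^i(F)`. -/
def homologyPsiLowerStarIso (F : DerivedCategory (ModuleCat.{u} (Lambda n q)ᵐᵒᵖ)) (i : ℤ) :
    (DerivedCategory.homologyFunctor _ i).obj ((derivedPsiLowerStar q hζ).obj F) ≅
      (psiLowerStar q hζ).obj ((DerivedCategory.homologyFunctor _ i).obj F) :=
  let K := DerivedCategory.Q.objPreimage F
  let e : DerivedCategory.Q.obj K ≅ F := DerivedCategory.Q.objObjPreimageIso F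
  (DerivedCategory.homologyFunctor _ i).mapIso ((derivedPsiLowerStar q hζ).mapIso e.symm ≪≫
    (psiLowerStar q hζ).mapDerivedCategoryFactors.app K) ≪≫
    (DerivedCategory.homologyFunctorFactors _ i).app ((psiLowerStarComplex q hζ).obj K) ≪≫
    (K.sc i).mapHomologyIso (psiLowerStar q hζ) ≪≫
    (psiLowerStar q hζ).mapIso ((DerivedCategory.homologyFunctorFactors _ i).symm.app K ≪≫
      (DerivedCategory.homologyFunctor _ i).mapIso e)

theorem boundedCoherent_derivedPsiLowerStar
    (F : DerivedCategory (ModuleCat.{u} (Lambda n q)ᵐᵒᵖ))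
    (hF : boundedCoherent (Lambda n q)ᵐᵒᵖ F) :
    boundedCoherent (B q ζ)ᵐᵒᵖ ((derivedPsiLowerStar q hζ).obj F) := by
  obtain ⟨⟨a, b, h⟩, h'⟩ := hF
  refine ⟨⟨a, b, fun i hi => IsZero.of_iso ((psiLowerStar q hζ).map_isZero (h i hi))
    (homologyPsiLowerStarIso q hζ F i)⟩, fun i => ?_⟩
  have := h' i
  have : IsNoetherian (B q ζ)ᵐᵒᵖ
      ((psiLowerStar q hζ).obj ((DerivedCategory.homologyFunctor _ i).obj F)) :=
    isNoetherian_rightHom _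
  exact isNoetherian_of_linearEquiv (homologyPsiLowerStarIso q hζ F i).symm.toLinearEquiv

/-! ### The derived functor of `ψ^*` -/

/-- The isomorphism `K ≅ ψ_* ψ^* K` in `D(B)` for a complex `K`, where `ψ^*` is applied
termwise. -/
def derivedUnitIso : DerivedCategory.Q ≅
    psiUpperStarComplex q hζ ⋙ DerivedCategory.Q ⋙ derivedPsiLowerStar q hζ :=
  NatIso.ofComponents (fun K => DerivedCategory.Q.mapIso (psiUnitIso q hζ K) ≪≫
    ((psiLowerStar q hζ).mapDerivedCategoryFactors.app ((psiUpperStarComplex q hζ).obj K)).symm)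
    fun {K L} f => by
      have h₁ : f ≫ (psiUnitIso q hζ L).hom = (psiUnitIso q hζ K).hom ≫
          (psiLowerStarComplex q hζ).map ((psiUpperStarComplex q hζ).map f) :=
        (mapComplexAdjunction (psiUpperStarAdjunction q hζ) (.up ℤ)).unit.naturality f
      have h₂ := (psiLowerStar q hζ).mapDerivedCategoryFactors.inv.naturality
        ((psiUpperStarComplex q hζ).map f)
      change DerivedCategory.Q.map f ≫ DerivedCategory.Q.map (psiUnitIso q hζ L).hom ≫ _ =
        (DerivedCategory.Q.map (psiUnitIso q hζ K).hom ≫ _) ≫ _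
      rw [← DerivedCategory.Q.map_comp_assoc, h₁, DerivedCategory.Q.map_comp, Category.assoc,
        Category.assoc]
      exact congrArg (_ ≫ ·) h₂

/-! ### The triangulated subcategory of the objects `ψ^* P` -/

instance : (pullbackPerfect q hζ).IsClosedUnderIsomorphisms where
  of_iso e := by
    rintro ⟨P, hP, ⟨f⟩⟩
    exact ⟨P, hP, ⟨e.symm ≪≫ f⟩⟩

instance : (pullbackPerfect q hζ).IsStableUnderShift ℤ := ⟨fun m => ⟨fun X => by
  rintro ⟨P, hP, ⟨f⟩⟩
  exact ⟨P⟦m⟧, isStrictlyPerfect_shift hP m,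
    ⟨(shiftFunctor _ m).mapIso f ≪≫
      ((psiUpperStarComplex q hζ ⋙ DerivedCategory.Q).commShiftIso m).symm.app P⟩⟩⟩⟩

instance : (psiUpperStarComplex q hζ).Full :=
  have : IsIso (mapComplexAdjunction (psiUpperStarAdjunction q hζ) (.up ℤ)).unit :=
    NatIso.isIso_of_isIso_app _
  (mapComplexAdjunction (psiUpperStarAdjunction q hζ) (.up ℤ)).fullyFaithfulLOfIsIsoUnit.full

instance : (pullbackPerfect q hζ).IsTriangulatedClosed₃ := .mk' fun T hT h₁ h₂ => by
  obtain ⟨K, hK, ⟨e₁⟩⟩ := h₁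
  obtain ⟨L, hL, ⟨e₂⟩⟩ := h₂
  -- The morphism comes from a map of complexes since ψ^* K is K-projective, and then from a map K →
  -- L since ψ^* is full on complexes. So its cone is ψ^* of a cone.
  obtain ⟨f, hf⟩ := (hK.psiUpperStar q hζ).exists_Q_map_eq _ (e₁.inv ≫ T.mor₁ ≫ e₂.hom)
  obtain ⟨g, rfl⟩ := (psiUpperStarComplex q hζ).map_surjective f
  exact ⟨_, isStrictlyPerfect_mappingCone hK hL g,
    ⟨Pretriangulated.Triangle.π₃.mapIso (Pretriangulated.isoTriangleOfIso₁₂ T _ hT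
      (DerivedCategory.mappingCone_triangle_distinguished ((psiUpperStarComplex q hζ).map g))
      e₁ e₂ (by
        change T.mor₁ ≫ e₂.hom = e₁.hom ≫
          DerivedCategory.Q.map ((psiUpperStarComplex q hζ).map g)
        rw [hf, Iso.hom_inv_id_assoc])) ≪≫
      DerivedCategory.Q.mapIso
        (CochainComplex.mappingCone.mapHomologicalComplexIso g (psiUpperStar q hζ)).symm⟩⟩

instance : (pullbackPerfect q hζ).IsTriangulated where
  exists_zero := by
    obtain ⟨X, hX, K, hK, ⟨e⟩⟩ := (perfect (B q ζ)ᵐᵒᵖ).exists_prop_of_containsZero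
    refine ⟨_, ?_, K, hK, ⟨Iso.refl _⟩⟩
    have hX' := hX.of_iso (e ≪≫ (derivedUnitIso q hζ).app K).symm
    -- ψ_* ψ^* K ≅ K is zero, and ψ_* is injective on endomorphisms of ψ^* K.
    exact (IsZero.iff_id_eq_zero _).2 ((bijectiveFrom_psiUpperStar hζ hK _).1 (hX'.eq_of_src _ _))
  toIsTriangulatedClosed₂ := .of_isTriangulatedClosed₃

theorem pullbackPerfect_le_bijectiveFrom :
    pullbackPerfect q hζ ≤ bijectiveFrom (derivedPsiLowerStar q hζ) := by
  rintro X ⟨P, hP, ⟨e⟩⟩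
  exact ObjectProperty.prop_of_iso _ e.symm (bijectiveFrom_psiUpperStar hζ hP)

variable {q} in
theorem pullbackPerfect_le_bijectiveTo (hq : q ≠ 0) :
    pullbackPerfect q hζ ≤ bijectiveTo (derivedPsiLowerStar q hζ) := by
  rintro X ⟨P, hP, ⟨e⟩⟩
  exact ObjectProperty.prop_of_iso _ e.symm (bijectiveTo_psiUpperStar hζ hq hP)

theorem isLeftDerivedOnPerf_of_iso
    (L : Perf (B q ζ)ᵐᵒᵖ ⥤ DerivedCategory (ModuleCat.{u} (Lambda n q)ᵐᵒᵖ))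
    (hL : ∀ X, pullbackPerfect q hζ (L.obj X))
    (η : (perfect (B q ζ)ᵐᵒᵖ).ι ≅ L ⋙ derivedPsiLowerStar q hζ) :
    IsLeftDerivedOnPerf (psiUpperStar q hζ) L := by
  have h := fun X => pullbackPerfect_le_bijectiveFrom q hζ _ (hL X)
  let θ : perfectQ (B q ζ)ᵐᵒᵖ ⋙ (perfect (B q ζ)ᵐᵒᵖ).ι ⟶ ((perfectComplexes (B q ζ)ᵐᵒᵖ).ι ⋙
      psiUpperStarComplex q hζ ⋙ DerivedCategory.Q) ⋙ derivedPsiLowerStar q hζ :=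
    Functor.whiskerLeft (perfectComplexes (B q ζ)ᵐᵒᵖ).ι (derivedUnitIso q hζ).hom
  refine ⟨(RelativeAdjunction.ofIso η h).mate θ,
    isRightKanExtension_of_isIso _ (fun K => IsStrictlyPerfect K.obj) ?_ ?_ ?_⟩
  · intro K hK
    have : IsIso (θ.app K) := inferInstanceAs (IsIso ((derivedUnitIso q hζ).hom.app K.obj))
    have := RelativeAdjunction.isIso_map_mate_ofIso_app η h θ K
    exact isIso_of_bijectiveFrom (G := derivedPsiLowerStar q hζ) (h _)
      (bijectiveFrom_psiUpperStar hζ hK) _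
  · rintro ⟨X, K, hK, ⟨e⟩⟩
    exact ⟨⟨K, K, hK, ⟨Iso.refl _⟩⟩, hK, ⟨ObjectProperty.isoMk _ e⟩⟩
  · intro K K' hK f
    obtain ⟨g, hg⟩ := IsStrictlyPerfect.exists_Q_map_eq _ hK f.hom
    exact ⟨ObjectProperty.homMk g, InducedCategory.hom_ext hg⟩

/-- ψ_* restricts to an equivalence from `pullbackPerfect` to Perf(B), because ψ_* ψ^* P ≅ P; L is
the inverse. Its triangulated structure is thus inherited from ψ_*. -/
theorem exists_derivedPsiUpperStar :
    ∃ L : Perf (B q ζ)ᵐᵒᵖ ⥤ DerivedCategory (ModuleCat.{u} (Lambda n q)ᵐᵒᵖ),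
      (∀ X, pullbackPerfect q hζ (L.obj X)) ∧
      Nonempty ((perfect (B q ζ)ᵐᵒᵖ).ι ≅ L ⋙ derivedPsiLowerStar q hζ) ∧
      ∃ _ : L.CommShift ℤ, L.IsTriangulated := by
  refine exists_inverse_on (pullbackPerfect q hζ) (perfect (B q ζ)ᵐᵒᵖ)
    (pullbackPerfect_le_bijectiveFrom q hζ) ?_ ?_
  · rintro X ⟨P, hP, ⟨e⟩⟩
    exact ⟨P, hP, ⟨(derivedPsiLowerStar q hζ).mapIso e ≪≫ ((derivedUnitIso q hζ).app P).symm⟩⟩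
  · rintro Y ⟨P, hP, ⟨e⟩⟩
    exact ⟨_, ⟨P, hP, ⟨Iso.refl _⟩⟩, ⟨((derivedUnitIso q hζ).app P).symm ≪≫ e.symm⟩⟩

end PullbackPerfect

end

end QuantumKleinian


open QuantumKleinian CategoryTheory in
theorem mainTheorem8 {k : Type u} [Field k] [IsAlgClosed k] [CharZero k] (n : ℕ) (hn : 2 ≤ n)
    (q : k) (hq : q ≠ 0) (ζ : k) (hζ : IsPrimitiveRoot ζ (n + 1))
    [HasDerivedCategory.{w₁} (ModuleCat.{u} (B q ζ)ᵐᵒᵖ)]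
    [HasDerivedCategory.{w₂} (ModuleCat.{u} (Lambda n q)ᵐᵒᵖ)] :
    -- `D(Λ)` is smooth
    HomologicallySmooth k (Lambda n q) ∧
    -- `ψ_* ≅ ψ_!` on right `Λ`-modules
    Nonempty (psiLowerStar q hζ ≅ psiLowerShriek q hζ) ∧
    -- the left derived functor of `ψ^*` exists on `Perf(B)`
    ∃ Lψ : Perf (B q ζ)ᵐᵒᵖ ⥤ DerivedCategory (ModuleCat.{u} (Lambda n q)ᵐᵒᵖ),
      IsLeftDerivedOnPerf (psiUpperStar q hζ) Lψ ∧
      -- `ψ^* : Perf(B) → D(Λ)` and `ψ_* : D(Λ) → D(B)`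
      IsWeaklyCrepantResolution (perfect (B q ζ)ᵐᵒᵖ).ι Lψ (derivedPsiLowerStar q hζ) ∧
      -- `ψ^* : Perf(B) → D^b(mod Λ)` and `ψ_* : D^b(mod Λ) → D^b(mod B)`
      ∃ (hB : perfect (B q ζ)ᵐᵒᵖ ≤ boundedCoherent (B q ζ)ᵐᵒᵖ)
        (hup : ∀ P, boundedCoherent (Lambda n q)ᵐᵒᵖ (Lψ.obj P))
        (hdown : ∀ F : DbCoh (Lambda n q)ᵐᵒᵖ,
          boundedCoherent (B q ζ)ᵐᵒᵖ ((derivedPsiLowerStar q hζ).obj F.obj)),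
        IsWeaklyCrepantResolution (ObjectProperty.ιOfLE hB)
          ((boundedCoherent (Lambda n q)ᵐᵒᵖ).lift Lψ hup)
          ((boundedCoherent (B q ζ)ᵐᵒᵖ).lift
            ((boundedCoherent (Lambda n q)ᵐᵒᵖ).ι ⋙ derivedPsiLowerStar q hζ) hdown) := by
  have := Lambda.isNoetherianRing_op (n := n) hq
  have := isNoetherianRing_B_op hζ hq
  obtain ⟨L, hL, ⟨η⟩, _, _⟩ := exists_derivedPsiUpperStar q hζ
  -- `h` yields the adjunction of ψ^* with ψ_*, and `h'` the reverse one. The same two facts serve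
  -- the bounded categories, which are full subcategories.
  have h := fun X => pullbackPerfect_le_bijectiveFrom q hζ _ (hL X)
  have h' := fun X => pullbackPerfect_le_bijectiveTo hζ hq _ (hL X)
  exact ⟨Lambda.homologicallySmooth n q, ⟨psiLowerStarIso q hζ⟩, L,
    isLeftDerivedOnPerf_of_iso q hζ L hL η, isWeaklyCrepantResolution_of_iso η h h',
    perfect_le_boundedCoherent _,
    fun X => perfect_le_boundedCoherent _ _ (pullbackPerfect_le_perfect q hζ _ (hL X)),
    fun F => boundedCoherent_derivedPsiLowerStar q hζ F.obj F.property,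
    isWeaklyCrepantResolution_lift η h h' _ _ _⟩
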